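/- **Setting.** There are $M$ monitoring nodes (MNs) with $N$ antennas, an untrusted transmitter (UT) with $N_t$ antennas and an untrusted receiver (UR) with $N_r$ antennas. The variable $\alpha_m\in\{0,1\}$ is $1$ if MN $m$ observes and $0$ if it jams. The powers $\rho_t,\rho_r,\rho_J\ge 0$, fading coefficients $\beta_{tr},\beta_{mr},\beta_{tm},\beta_{mm'}\ge 0$ and diagonal matrices $\Lambda_r,\Pi_{mr}\ge 0$ are deterministic, and $\varrho>0$. The coherence interval is $\tau>0$, with $\tau_t+\tau_r\le\tau$ training symbols. *Channels.* $G_{tr}=\sqrt{\beta_{tr}}H_{tr}\in\mathbb C^{N_t\times N_r}$, $G_{mr}=\sqrt{\beta_{mr}}H_{mr}\in\mathbb C^{N\times N_r}$, $G_{tm}=\sqrt{\beta_{tm}}H_{tm}\in\mathbb C^{N_t\times N}$, $G_{mm'}=\sqrt{\beta_{mm'}}H_{mm'}\in\mathbb C^{N\times N}$ for $m\ne m'$ and $G_{mm}=0$, where each $H$ has i.i.d. $\mathcal{CN}(0,1)$ entries. *Training.* Let $\varphi\in\mathbb C^{\tau_r\times N_r}$ and $\Phi\in\mathbb C^{N_r\times\tau_t}$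 be pilots with $\varphi^H\varphi=I$, $\Phi\Phi^H=I$, and let $\Omega_t,\Omega_m,\Omega'_m$ be noise matrices with i.i.d. $\mathcal{CN}(0,1)$ entries. Put $c(\beta)=\sqrt{\tau_r\rho_r}\,\beta/(\tau_r\rho_r\beta+1)$, and $$\hat G_{tr}=c(\beta_{tr})(\sqrt{\tau_r\rho_r}\,G_{tr}\varphi^H+\Omega_t)\varphi,\qquad \hat G_{mr}=c(\beta_{mr})(\sqrt{\tau_r\rho_r}\,G_{mr}\varphi^H+\Omega_m)\varphi .$$ The precoder $W\in\mathbb C^{N_t\times N_r}$ is a measurable function of $\hat G_{tr}$ with its columns normalized to unit Euclidean norm (a zero column is left zero). Let $A_r=G_{tr}^HW$, $B_m=G_{tm}^HW$, and let $b_p^H$ be the $p$-th row of $B_m$. Let $\tilde y_p^H$ be the $p$-th row of $(\sqrt{\tau_t\rho_t}\,B_m\Phi+\Omega'_m)\Phi^H$, and let $\hat B_m$ have the rows $\hat b_p^H$ with $$\hat b_p=E\{b_p\}+\sqrt{\tau_t\rho_t}\,C_p(\tau_t\rho_tC_p+I)^{-1}(\tilde y_p-\sqrt{\tau_t\rho_t}\,E\{b_p\}),\qquad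 C_p=\mathrm{Cov}(b_p).$$ Put $V_m=\hat B_m(\hat B_m^H\hat B_m+\varrho I)^{-1}$. *Data phase.* The symbols are $x\sim\mathcal{CN}(0,I_{N_r})$, the jamming symbols $x^J$ satisfy $E\{x^J(x^J)^H\}=I_{N_r}$, and the noises $\omega_r\in\mathbb C^{N_r}$, $\omega_m\in\mathbb C^N$ have mean zero and identity covariance, with $\omega_m,\omega_l$ uncorrelated for $m\neq l$. With $s_t=\sqrt{\rho_t}W\Lambda_r^{1/2}x$ and $s^J_m=(1-\alpha_m)\sqrt{\rho_J}\hat G_{mr}\Pi_{mr}^{1/2}x^J$, the UR receives $y_r$, MN $m$ receives $y_m$, and the CPU forms $z_c$: $$y_r=G_{tr}^Hs_t+\sum_mG_{mr}^Hs^J_m+\omega_r,\quad y_m=\alpha_mG_{tm}^Hs_t+\sum_{m'}G_{mm'}^Hs^J_{m'}+\omega_m,\quad z_c=\sum_m\alpha_mV_m^Hy_m .$$ *Side information.* $\Theta_r$ and $\Theta_c$ are random elements of arbitrary measurable spaces such that $x$, $x^J$, $\omega_r$ and the tuple ($\Theta_r$, all channels, all training noise) are mutually independent, and likewise $x$, $x^J$,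 $(\omega_m)_m$ and the tuple ($\Theta_c$, all channels, all training noise). **Notation.** Put $F_r^J=\sum_m(1-\alpha_m)G_{mr}^H\hat G_{mr}\Pi_{mr}^{1/2}$, $F_m^J=\sum_{m'}(1-\alpha_{m'})G_{mm'}^H\hat G_{m'r}\Pi_{m'r}^{1/2}$, $D=\sum_m\alpha_mV_m^HB_m\Lambda_r^{1/2}$, and $$\Psi_r=I+\rho_JE\{F_r^J(F_r^J)^H|\Theta_r\}+\rho_tE\{A_r\Lambda_rA_r^H|\Theta_r\}-\rho_tE\{A_r\Lambda_r^{1/2}|\Theta_r\}E\{A_r\Lambda_r^{1/2}|\Theta_r\}^H,$$ $$\Psi_c=\rho_JE\Big\{\sum_{m,l}\alpha_m\alpha_lV_m^HF_m^J(F_l^J)^HV_l\Big|\Theta_c\Big\}+\rho_tE\{DD^H|\Theta_c\}+E\Big\{\sum_m\alpha_mV_m^HV_m\Big|\Theta_c\Big\}-\rho_tE\{D|\Theta_c\}E\{D^H|\Theta_c\},$$ $$\Upsilon_r=\rho_tE\{\Lambda_r^{1/2}A_r^H|\Theta_r\}\Psi_r^{-1}E\{A_r\Lambda_r^{1/2}|\Theta_r\},\qquad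 \Upsilon_c=\rho_tE\{D^H|\Theta_c\}\Psi_c^{-1}E\{D|\Theta_c\},$$ where $\Upsilon_c$ is set to $0$ wherever $\Psi_c$ is singular. For $(y,\Theta)\in\{(y_r,\Theta_r),(z_c,\Theta_c)\}$ let $\hat x=E\{xy^H|\Theta\}\,E\{yy^H|\Theta\}^{-1}y$ (read as $0$ where the matrix is singular) be the (linear) MMSE detector output and $\epsilon=x-\hat x$ its error. The SE under MMSE detection is $$\Big(1-\frac{\tau_t+\tau_r}{\tau}\Big)E\big\{\log_2\det(\pi eI)-\log_2\det(\pi e\,E\{\epsilon\epsilon^H|\Theta\})\big\},$$ and a rate $R$ is called achievable from an observation $U$ if $R\le(1-\frac{\tau_t+\tau_r}{\tau})I(x;U)$, where $I$ is the mutual information in bits. **Proposition 2.** Let $$\mathrm{SE}_r=\Big(1-\frac{\tau_t+\tau_r}{\tau}\Big)E\{\log_2\det(I+\Upsilon_r)\},\qquad \mathrm{SE}_c=\Big(1-\frac{\tau_t+\tau_r}{\tau}\Big)E\{\log_2\det(I+\Upsilon_c)\}.$$ Both expectations are of integrable random variables. The matrix $\Psi_r$ is almost surely invertible, and if $F_r^J$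 is independent of $\Theta_r$, then almost surely its jamming term is $\rho_JE\{F_r^J(F_r^J)^H\}$. The SE under MMSE detection at the UR equals $\mathrm{SE}_r$; the SE under MMSE detection at the CPU equals $\mathrm{SE}_c$ whenever $\Psi_c$ is almost surely invertible. Moreover $\mathrm{SE}_r$ is achievable from $(\hat x,\Theta_r)$ and from $(y_r,\Theta_r)$, and $\mathrm{SE}_c$ is achievable from $(\hat x,\Theta_c)$ and from $(z_c,\Theta_c)$. -/

import Mathlib

open MeasureTheory ProbabilityTheory Matrix
open scoped ENNReal

noncomputable section

namespace Surveillance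

/-! ### Complex Gaussian laws, matrix expectations, mutual information -/

/-- The circularly symmetric law `CN(0,1)` on `ℂ`: independent real and imaginary parts of law
`N(0,1/2)`. -/
def stdCN : Measure ℂ :=
  ((gaussianReal 0 (1 / 2)).prod (gaussianReal 0 (1 / 2))).map fun q : ℝ × ℝ => (⟨q.1, q.2⟩ : ℂ)

/-- The law `CN(0, I_k)` on `ℂ^k`. -/
def stdCNVec (k : ℕ) : Measure (Fin k → ℂ) := Measure.pi fun _ => stdCN

/-- Matrices carry the product σ-algebra of their entries. -/
instance matrixMeasurableSpace {k l : ℕ} : MeasurableSpace (Matrix (Fin k) (Fin l) ℂ) :=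
  inferInstanceAs (MeasurableSpace (Fin k → Fin l → ℂ))

/-- The law of a `k × l` matrix with i.i.d. `CN(0,1)` entries. -/
def stdCNMat (k l : ℕ) : Measure (Matrix (Fin k) (Fin l) ℂ) :=
  Measure.pi fun _ : Fin k => Measure.pi fun _ : Fin l => stdCN

/-- Entrywise expectation `E{X}` of a random matrix. -/
def expMat {Ω : Type*} [MeasurableSpace Ω] (P : Measure Ω) {k l : ℕ}
    (X : Ω → Matrix (Fin k) (Fin l) ℂ) : Matrix (Fin k) (Fin l) ℂ :=
  Matrix.of fun i j => ∫ ω, X ω i j ∂P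

/-- Entrywise conditional expectation `E{X | Θ}` of a random matrix. -/
def condMat {Ω T : Type*} [MeasurableSpace Ω] [mT : MeasurableSpace T] (P : Measure Ω) (Θ : Ω → T)
    {k l : ℕ} (X : Ω → Matrix (Fin k) (Fin l) ℂ) : Ω → Matrix (Fin k) (Fin l) ℂ :=
  fun ω => Matrix.of fun i j => (P[fun ω' => X ω' i j | mT.comap Θ]) ω

/-- The outer product `u vᴴ`. -/
def outer {k l : ℕ} (u : Fin k → ℂ) (v : Fin l → ℂ) : Matrix (Fin k) (Fin l) ℂ :=
  Matrix.vecMulVec u (star v)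

/-- Mutual information `I(X;Y)` in bits: the Kullback-Leibler divergence of the joint law from the
product of the marginal laws, divided by `ln 2`. -/
def mutualInfo {Ω A B : Type*} [MeasurableSpace Ω] [MeasurableSpace A] [MeasurableSpace B]
    (P : Measure Ω) (X : Ω → A) (Y : Ω → B) : ℝ≥0∞ :=
  InformationTheory.klDiv (P.map fun ω => (X ω, Y ω)) ((P.map X).prod (P.map Y))
    / ENNReal.ofReal (Real.log 2)

/-- The rate `R` (bits per channel use) is supported when a fraction `f` of the channel uses
conveys information `I` each. -/
def IsAchievableSE (f : ℝ) (I : ℝ≥0∞) (R : ℝ) : Prop :=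
  ENNReal.ofReal R ≤ ENNReal.ofReal f * I

/-- `X`, `J`, `N`, `S` are mutually independent, written as a chain. -/
def MutuallyIndep {Ω A B C D : Type*} [MeasurableSpace Ω] [MeasurableSpace A] [MeasurableSpace B]
    [MeasurableSpace C] [MeasurableSpace D] (P : Measure Ω)
    (X : Ω → A) (J : Ω → B) (N : Ω → C) (S : Ω → D) : Prop :=
  IndepFun X (fun ω => (J ω, N ω, S ω)) P ∧ IndepFun J (fun ω => (N ω, S ω)) P ∧ IndepFun N S P

/-! ### MMSE detection with side information -/

section Detection

variable {Ω T : Type*} [MeasurableSpace Ω] [MeasurableSpace T] (P : Measure Ω) {k : ℕ}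

/-- The linear MMSE estimate of `x` from `y` given the side information `Θ`:
`C_{xy|Θ} C_{yy|Θ}⁻¹ y`, with `C_{uv|Θ} = E{u vᴴ | Θ}`. -/
def mmseEstimate (Θ : Ω → T) (x y : Ω → Fin k → ℂ) : Ω → Fin k → ℂ := fun ω =>
  (condMat P Θ (fun ω' => outer (x ω') (y ω')) ω *
    (condMat P Θ (fun ω' => outer (y ω') (y ω')) ω)⁻¹) *ᵥ y ω

/-- The conditional error covariance `E{ε εᴴ | Θ}` of the MMSE estimate. -/
def mmseErrorCov (Θ : Ω → T) (x y : Ω → Fin k → ℂ) : Ω → Matrix (Fin k) (Fin k) ℂ :=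
  condMat P Θ fun ω =>
    outer (x ω - mmseEstimate P Θ x y ω) (x ω - mmseEstimate P Θ x y ω)

/-- The real number `log₂ det X`, for matrices `X` whose determinant is real. -/
def log2det (X : Matrix (Fin k) (Fin k) ℂ) : ℝ := Real.logb 2 X.det.re

/-- The SE under MMSE detection of `x ∼ CN(0, I)` with a fraction `f` of the channel uses:
`f * E{log₂ det (πe I) - log₂ det (πe E{ε εᴴ | Θ})}`. -/
def mmseSE (f : ℝ) (Θ : Ω → T) (x y : Ω → Fin k → ℂ) : ℝ :=
  f * ∫ ω, (log2det (((Real.pi * Real.exp 1 : ℝ) : ℂ) • (1 : Matrix (Fin k) (Fin k) ℂ))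
    - log2det (((Real.pi * Real.exp 1 : ℝ) : ℂ) • mmseErrorCov P Θ x y ω)) ∂P

end Detection

/-! ### The surveillance system -/

/-- Divide every column by its Euclidean norm. -/
def normalizeCols {k l : ℕ} (X : Matrix (Fin k) (Fin l) ℂ) : Matrix (Fin k) (Fin l) ℂ :=
  Matrix.of fun i j => X i j / ((Real.sqrt (∑ i', ‖X i' j‖ ^ 2) : ℝ) : ℂ)

/-- Diagonal matrix with entries `√(d n)`. -/
def sqrtDiag {k : ℕ} (d : Fin k → ℝ) : Matrix (Fin k) (Fin k) ℂ :=
  Matrix.diagonal fun n => ((Real.sqrt (d n) : ℝ) : ℂ)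

/-- Deterministic parameters: `M` monitoring nodes (MNs) with `N` antennas, an untrusted
transmitter (UT) with `Nt` antennas, an untrusted receiver (UR) with `Nr` antennas, `τt` and `τr`
training symbols. -/
structure Params (M N Nt Nr τt τr : ℕ) where
  /-- coherence interval -/
  τ : ℕ
  τ_pos : 0 < τ
  training_le : τt + τr ≤ τ
  /-- `true` for observing mode, `false` for jamming mode -/
  observing : Fin M → Bool
  ρt : ℝ
  ρr : ℝ
  ρJ : ℝ
  ρt_nonneg : 0 ≤ ρt
  ρr_nonneg : 0 ≤ ρr
  ρJ_nonneg : 0 ≤ ρJ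
  /-- regularization of the MMSE combiner -/
  reg : ℝ
  reg_pos : 0 < reg
  /-- large-scale fading UT-UR, MN-UR, UT-MN, MN-MN -/
  βtr : ℝ
  βmr : Fin M → ℝ
  βtm : Fin M → ℝ
  βmm : Fin M → Fin M → ℝ
  βtr_nonneg : 0 ≤ βtr
  βmr_nonneg : ∀ m, 0 ≤ βmr m
  βtm_nonneg : ∀ m, 0 ≤ βtm m
  βmm_nonneg : ∀ m m', 0 ≤ βmm m m'
  /-- power coefficients, the diagonals of `Λ_r` and `Π_{mr}` -/
  lam : Fin Nr → ℝ
  lam_nonneg : ∀ n, 0 ≤ lam n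
  pow : Fin M → Fin Nr → ℝ
  pow_nonneg : ∀ m n, 0 ≤ pow m n
  /-- uplink pilots `φ_n` as columns -/
  φ : Matrix (Fin τr) (Fin Nr) ℂ
  φ_orth : φᴴ * φ = 1
  /-- downlink beamforming pilots -/
  Φ : Matrix (Fin Nr) (Fin τt) ℂ
  Φ_orth : Φ * Φᴴ = 1
  /-- unnormalized precoding vectors `w_n` as a function of the UT's channel estimate -/
  precoder : Matrix (Fin Nt) (Fin Nr) ℂ → Matrix (Fin Nt) (Fin Nr) ℂ
  precoder_meas : Measurable precoder

/-- The random quantities of the system. Every small-scale fading matrix and every training noise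
matrix has i.i.d. `CN(0,1)` entries; nothing is imposed on the dependence between different
matrices. The equations `E{u uᴴ} = I` include that `u` is square integrable. -/
structure Model {Ω : Type*} [MeasurableSpace Ω] (P : Measure Ω) (M N Nt Nr τt τr : ℕ) where
  /-- small-scale fading UT-UR, MN-UR, UT-MN, MN-MN -/
  Htr : Ω → Matrix (Fin Nt) (Fin Nr) ℂ
  Hmr : Ω → Fin M → Matrix (Fin N) (Fin Nr) ℂ
  Htm : Ω → Fin M → Matrix (Fin Nt) (Fin N) ℂ
  Hmm : Ω → Fin M → Fin M → Matrix (Fin N) (Fin N) ℂ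
  /-- noise in the uplink training (at UT and MNs) and in the beamforming training (at MNs) -/
  Wt : Ω → Matrix (Fin Nt) (Fin τr) ℂ
  Wul : Ω → Fin M → Matrix (Fin N) (Fin τr) ℂ
  Wdl : Ω → Fin M → Matrix (Fin N) (Fin τt) ℂ
  /-- untrusted symbols and jamming symbols -/
  x : Ω → Fin Nr → ℂ
  xJ : Ω → Fin Nr → ℂ
  /-- noise in the data phase at the UR and at the MNs -/
  wr : Ω → Fin Nr → ℂ
  wm : Ω → Fin M → Fin N → ℂ
  Htr_meas : Measurable Htr
  Hmr_meas : Measurable Hmr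
  Htm_meas : Measurable Htm
  Hmm_meas : Measurable Hmm
  Wt_meas : Measurable Wt
  Wul_meas : Measurable Wul
  Wdl_meas : Measurable Wdl
  x_meas : Measurable x
  xJ_meas : Measurable xJ
  wr_meas : Measurable wr
  wm_meas : Measurable wm
  Htr_law : P.map Htr = stdCNMat Nt Nr
  Hmr_law : ∀ m, P.map (fun ω => Hmr ω m) = stdCNMat N Nr
  Htm_law : ∀ m, P.map (fun ω => Htm ω m) = stdCNMat Nt N
  Hmm_law : ∀ m m', m ≠ m' → P.map (fun ω => Hmm ω m m') = stdCNMat N N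
  Wt_law : P.map Wt = stdCNMat Nt τr
  Wul_law : ∀ m, P.map (fun ω => Wul ω m) = stdCNMat N τr
  Wdl_law : ∀ m, P.map (fun ω => Wdl ω m) = stdCNMat N τt
  /-- Gaussian signaling -/
  x_law : P.map x = stdCNVec Nr
  xJ_cov : expMat P (fun ω => outer (xJ ω) (xJ ω)) = 1
  wr_mean : ∀ i, ∫ ω, wr ω i ∂P = 0
  wr_cov : expMat P (fun ω => outer (wr ω) (wr ω)) = 1
  wm_mean : ∀ m i, ∫ ω, wm ω m i ∂P = 0
  wm_cov : ∀ m, expMat P (fun ω => outer (wm ω m) (wm ω m)) = 1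
  wm_uncorr : ∀ m l, m ≠ l → expMat P (fun ω => outer (wm ω m) (wm ω l)) = 0

namespace Params

variable {M N Nt Nr τt τr : ℕ} (p : Params M N Nt Nr τt τr)

/-- The binary mode variable `α_m`. -/
def α (m : Fin M) : ℂ := if p.observing m then 1 else 0

/-- The pre-log factor `1 - (τt + τr) / τ`. -/
def prelog : ℝ := 1 - ((τt : ℝ) + (τr : ℝ)) / (p.τ : ℝ)

/-- `Λ_r^{1/2}`. -/
def sqrtLam : Matrix (Fin Nr) (Fin Nr) ℂ := sqrtDiag p.lam

/-- `Λ_r`. -/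
def Lam : Matrix (Fin Nr) (Fin Nr) ℂ := Matrix.diagonal fun n => ((p.lam n : ℝ) : ℂ)

/-- `Π_{mr}^{1/2}`. -/
def sqrtPow (m : Fin M) : Matrix (Fin Nr) (Fin Nr) ℂ := sqrtDiag (p.pow m)

/-- `√(τr ρr)`. -/
def ampUL : ℝ := Real.sqrt (τr * p.ρr)

/-- `√(τt ρt)`. -/
def ampDL : ℝ := Real.sqrt (τt * p.ρt)

/-- The estimation gain `√(τr ρr) β / (τr ρr β + 1)`. -/
def gain (β : ℝ) : ℝ := p.ampUL * β / (τr * p.ρr * β + 1)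

end Params

namespace Model

variable {Ω : Type*} [MeasurableSpace Ω] {P : Measure Ω} {M N Nt Nr τt τr : ℕ}
  (S : Model P M N Nt Nr τt τr) (p : Params M N Nt Nr τt τr)

/-- All channels together with all training noise. -/
def state (ω : Ω) :=
  (S.Htr ω, S.Hmr ω, S.Htm ω, S.Hmm ω, S.Wt ω, S.Wul ω, S.Wdl ω)

/-- Channels between UR and UT, UR and MN `m`, MN `m` and UT, MN `m` and MN `m'`. -/
def Gtr (ω : Ω) : Matrix (Fin Nt) (Fin Nr) ℂ := ((Real.sqrt p.βtr : ℝ) : ℂ) • S.Htr ω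

def Gmr (m : Fin M) (ω : Ω) : Matrix (Fin N) (Fin Nr) ℂ :=
  ((Real.sqrt (p.βmr m) : ℝ) : ℂ) • S.Hmr ω m

def Gtm (m : Fin M) (ω : Ω) : Matrix (Fin Nt) (Fin N) ℂ :=
  ((Real.sqrt (p.βtm m) : ℝ) : ℂ) • S.Htm ω m

def Gmm (m m' : Fin M) (ω : Ω) : Matrix (Fin N) (Fin N) ℂ :=
  if m = m' then 0 else ((Real.sqrt (p.βmm m m') : ℝ) : ℂ) • S.Hmm ω m m'

/-- Pilot matrices received in the uplink training at the UT and at MN `m`. -/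
def Ytr (ω : Ω) : Matrix (Fin Nt) (Fin τr) ℂ := ((p.ampUL : ℝ) : ℂ) • (S.Gtr p ω * p.φᴴ) + S.Wt ω

def Ymr (m : Fin M) (ω : Ω) : Matrix (Fin N) (Fin τr) ℂ :=
  ((p.ampUL : ℝ) : ℂ) • (S.Gmr p m ω * p.φᴴ) + S.Wul ω m

/-- Channel estimates `Ĝ_{tr}` at the UT and `Ĝ_{mr}` at MN `m`. -/
def Gtrhat (ω : Ω) : Matrix (Fin Nt) (Fin Nr) ℂ := ((p.gain p.βtr : ℝ) : ℂ) • (S.Ytr p ω * p.φ)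

def Gmrhat (m : Fin M) (ω : Ω) : Matrix (Fin N) (Fin Nr) ℂ :=
  ((p.gain (p.βmr m) : ℝ) : ℂ) • (S.Ymr p m ω * p.φ)

/-- The precoding matrix with normalized columns. -/
def W (ω : Ω) : Matrix (Fin Nt) (Fin Nr) ℂ := normalizeCols (p.precoder (S.Gtrhat p ω))

/-- Effective channels `A_r = G_{tr}ᴴ W` and `B_m = G_{tm}ᴴ W`. -/
def A (ω : Ω) : Matrix (Fin Nr) (Fin Nr) ℂ := (S.Gtr p ω)ᴴ * S.W p ω

def B (m : Fin M) (ω : Ω) : Matrix (Fin N) (Fin Nr) ℂ := (S.Gtm p m ω)ᴴ * S.W p ω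

/-- The beamforming pilots received at MN `m`, projected on `Φ`. -/
def Ymt (m : Fin M) (ω : Ω) : Matrix (Fin N) (Fin Nr) ℂ :=
  (((p.ampDL : ℝ) : ℂ) • ((S.Gtm p m ω)ᴴ * S.W p ω * p.Φ) + S.Wdl ω m) * p.Φᴴ

/-- `b_i`, where `b_iᴴ` is the `i`-th row of `B_m`. -/
def b (m : Fin M) (i : Fin N) (ω : Ω) : Fin Nr → ℂ := star (S.B p m ω i)

/-- `E{b_i}`. -/
def bMean (m : Fin M) (i : Fin N) : Fin Nr → ℂ := fun n => ∫ ω, S.b p m i ω n ∂P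

/-- The covariance matrix of `b_i`. -/
def bCov (m : Fin M) (i : Fin N) : Matrix (Fin Nr) (Fin Nr) ℂ :=
  expMat P fun ω => outer (S.b p m i ω - S.bMean p m i) (S.b p m i ω - S.bMean p m i)

/-- The MMSE estimate of `b_i` from the observation `√(τt ρt) b_i + noise`. -/
def bhat (m : Fin M) (i : Fin N) (ω : Ω) : Fin Nr → ℂ :=
  S.bMean p m i + ((p.ampDL : ℝ) : ℂ) •
    ((S.bCov p m i * (((τt * p.ρt : ℝ) : ℂ) • S.bCov p m i + 1)⁻¹) *ᵥ
      (star (S.Ymt p m ω i) - ((p.ampDL : ℝ) : ℂ) • S.bMean p m i))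

/-- `B̂_m`, with rows `b̂_iᴴ`. -/
def Bhat (m : Fin M) (ω : Ω) : Matrix (Fin N) (Fin Nr) ℂ :=
  Matrix.of fun i => star (S.bhat p m i ω)

/-- The MMSE combining matrix of MN `m`. -/
def V (m : Fin M) (ω : Ω) : Matrix (Fin N) (Fin Nr) ℂ :=
  S.Bhat p m ω * ((S.Bhat p m ω)ᴴ * S.Bhat p m ω + ((p.reg : ℝ) : ℂ) • 1)⁻¹

/-- The signal transmitted by the UT. -/
def st (ω : Ω) : Fin Nt → ℂ :=
  ((Real.sqrt p.ρt : ℝ) : ℂ) • ((S.W p ω * p.sqrtLam) *ᵥ S.x ω)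

/-- The jamming signal transmitted by MN `m`. -/
def sJ (m : Fin M) (ω : Ω) : Fin N → ℂ :=
  ((1 - p.α m) * ((Real.sqrt p.ρJ : ℝ) : ℂ)) • ((S.Gmrhat p m ω * p.sqrtPow m) *ᵥ S.xJ ω)

/-- The signal received at the UR. -/
def yr (ω : Ω) : Fin Nr → ℂ :=
  (S.Gtr p ω)ᴴ *ᵥ S.st p ω + ∑ m, (S.Gmr p m ω)ᴴ *ᵥ S.sJ p m ω + S.wr ω

/-- The signal received at MN `m`. -/
def ym (m : Fin M) (ω : Ω) : Fin N → ℂ :=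
  p.α m • ((S.Gtm p m ω)ᴴ *ᵥ S.st p ω) + ∑ m', (S.Gmm p m m' ω)ᴴ *ᵥ S.sJ p m' ω + S.wm ω m

/-- The signal aggregated at the CPU. -/
def zc (ω : Ω) : Fin Nr → ℂ := ∑ m, p.α m • ((S.V p m ω)ᴴ *ᵥ S.ym p m ω)

/-- Effective jamming channel to the UR. -/
def FJr (ω : Ω) : Matrix (Fin Nr) (Fin Nr) ℂ :=
  ∑ m, (1 - p.α m) • ((S.Gmr p m ω)ᴴ * S.Gmrhat p m ω * p.sqrtPow m)

/-- Effective jamming channel to MN `m`. -/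
def FJm (m : Fin M) (ω : Ω) : Matrix (Fin N) (Fin Nr) ℂ :=
  ∑ m', (1 - p.α m') • ((S.Gmm p m m' ω)ᴴ * S.Gmrhat p m' ω * p.sqrtPow m')

/-- `D = ∑ m, α_m V_mᴴ B_m Λ_r^{1/2}`. -/
def D (ω : Ω) : Matrix (Fin Nr) (Fin Nr) ℂ :=
  ∑ m, p.α m • ((S.V p m ω)ᴴ * S.B p m ω * p.sqrtLam)

section SideInformation

variable {T : Type*} [MeasurableSpace T] (Θ : Ω → T)

/-- The effective noise covariance at the UR. -/
def Psir (ω : Ω) : Matrix (Fin Nr) (Fin Nr) ℂ :=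
  1 + (p.ρJ : ℂ) • condMat P Θ (fun ω' => S.FJr p ω' * (S.FJr p ω')ᴴ) ω
    + (p.ρt : ℂ) • condMat P Θ (fun ω' => S.A p ω' * p.Lam * (S.A p ω')ᴴ) ω
    - (p.ρt : ℂ) • (condMat P Θ (fun ω' => S.A p ω' * p.sqrtLam) ω *
        (condMat P Θ (fun ω' => S.A p ω' * p.sqrtLam) ω)ᴴ)

/-- `Psir` with the unconditional jamming covariance. -/
def PsirUncond (ω : Ω) : Matrix (Fin Nr) (Fin Nr) ℂ :=
  1 + (p.ρJ : ℂ) • expMat P (fun ω' => S.FJr p ω' * (S.FJr p ω')ᴴ)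
    + (p.ρt : ℂ) • condMat P Θ (fun ω' => S.A p ω' * p.Lam * (S.A p ω')ᴴ) ω
    - (p.ρt : ℂ) • (condMat P Θ (fun ω' => S.A p ω' * p.sqrtLam) ω *
        (condMat P Θ (fun ω' => S.A p ω' * p.sqrtLam) ω)ᴴ)

def Upsilonr (ω : Ω) : Matrix (Fin Nr) (Fin Nr) ℂ :=
  (p.ρt : ℂ) • (condMat P Θ (fun ω' => p.sqrtLam * (S.A p ω')ᴴ) ω * (S.Psir p Θ ω)⁻¹ *
    condMat P Θ (fun ω' => S.A p ω' * p.sqrtLam) ω)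

/-- The effective noise covariance at the CPU. -/
def Psic (ω : Ω) : Matrix (Fin Nr) (Fin Nr) ℂ :=
  (p.ρJ : ℂ) • condMat P Θ (fun ω' => ∑ m, ∑ l, (p.α m * p.α l) •
      ((S.V p m ω')ᴴ * S.FJm p m ω' * (S.FJm p l ω')ᴴ * S.V p l ω')) ω
    + (p.ρt : ℂ) • condMat P Θ (fun ω' => S.D p ω' * (S.D p ω')ᴴ) ω
    + condMat P Θ (fun ω' => ∑ m, p.α m • ((S.V p m ω')ᴴ * S.V p m ω')) ω
    - (p.ρt : ℂ) • (condMat P Θ (S.D p) ω * condMat P Θ (fun ω' => (S.D p ω')ᴴ) ω)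

def Upsilonc (ω : Ω) : Matrix (Fin Nr) (Fin Nr) ℂ :=
  (p.ρt : ℂ) • (condMat P Θ (fun ω' => (S.D p ω')ᴴ) ω * (S.Psic p Θ ω)⁻¹ *
    condMat P Θ (S.D p) ω)

/-- The SE expression `(1 - (τt + τr)/τ) E{log₂ det (I + Υ_r)}` at the UR. -/
def SEr : ℝ := p.prelog * ∫ ω, log2det (1 + S.Upsilonr p Θ ω) ∂P

/-- The SE expression `(1 - (τt + τr)/τ) E{log₂ det (I + Υ_c)}` at the CPU. -/
def SEc : ℝ := p.prelog * ∫ ω, log2det (1 + S.Upsilonc p Θ ω) ∂P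

end SideInformation

end Model

end Surveillance

end

/-! Both received signals have the form `y = R u`. The vector `u` stacks the symbols, the jamming
symbols and the noise. It is white and independent of the pair formed by the random matrix `R` and
the side information `Θ`. Everything is therefore proved once for such a `WhiteChannel` and then
specialized to the receiver and the CPU.

Let `R₁` be the signal columns of `R`, and put `E = E{R₁|Θ}`, `C = E{R Rᴴ|Θ}`, `Ψ = C - E Eᴴ` and `Q
= 1 + Eᴴ Ψ⁻¹ E`. Whiteness gives `E{y yᴴ|Θ} = C` and `E{x yᴴ|Θ} = Eᴴ`. Where `Ψ` is invertible, the
linear MMSE matrix is thus `Eᴴ C⁻¹`, and the matrix inversion lemma `one_sub_conj_inv_eq` turns its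
error covariance into `Q⁻¹` (`condExp_error_mul_star`). This is the formula for the SE under MMSE
detection, because `Q = 1 + Υ`.

Achievability does not need the effective noise to be Gaussian or independent of the signal. By the
Donsker-Varadhan bound, `I(x;U)` is at least the mean of any log-likelihood ratio of an auxiliary
posterior to the prior. The auxiliary posterior is Gaussian with mean `x̂` and precision `Q`, and
its ratio has integral one (`lintegral_gaussian_ratio`). Its mean logarithm is `E log det Q - E{εᴴ Q
ε} + E‖x‖²`. The last two terms are `-k` and `k`, since `E{ε εᴴ|Θ} = Q⁻¹`, so exactly `E log det Q`
remains. Where `Ψ` is singular the estimate is replaced by `0` and `Q` by `1`; the same identities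
hold there, and the singular set is known from `Θ`.

Two analytic points remain. The matrices `Q` and `Eᴴ C⁻¹` are unbounded functions of `Θ`, so
integrability of the quadratic forms is obtained from positivity (`integrable_sum_mul_of_nonneg`).
Integrability of `log det Q` uses that signal and noise pass through a common factor `L`: if `R₁ = L
B` and the noise part dominates `L Lᴴ`, a generalized Cauchy-Schwarz inequality gives `Eᴴ Ψ⁻¹ E ≤
E{Bᴴ B|Θ}`, however small the eigenvalues of `Ψ` are. -/

namespace Surveillance

/-! ### Positive semidefinite matrices, Schur complements and determinants -/

section MatrixAlgebra

variable {ι κ : Type*} [Fintype ι] [Fintype κ]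

open scoped ComplexOrder

lemma trace_re_le_of_posSemidef_sub {A B : Matrix ι ι ℂ} (h : (B - A).PosSemidef) :
    A.trace.re ≤ B.trace.re := by
  have := (Complex.nonneg_iff.1 h.trace_nonneg).1
  simpa [trace_sub] using this

/-- Schur complement of the identity corner. With `A` a conditional second moment and `E` a
conditional mean, it says that a conditional covariance is positive semidefinite. -/
lemma posSemidef_sub_mul_conjTranspose [DecidableEq κ] {A : Matrix ι ι ℂ}
    {E : Matrix ι κ ℂ}
    (h : (fromBlocks A E Eᴴ (1 : Matrix κ κ ℂ)).PosSemidef) : (A - E * Eᴴ).PosSemidef := by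
  have : Invertible (1 : Matrix κ κ ℂ) := invertibleOne
  have := (PosDef.fromBlocks₂₂ A E (D := (1 : Matrix κ κ ℂ)) PosDef.one).1 h
  simpa using this

variable [DecidableEq ι]

/-- The matrix inversion lemma for the error covariance of a linear MMSE estimate. -/
lemma one_sub_conj_inv_eq [DecidableEq κ] {Ψ : Matrix ι ι ℂ} (hΨ : Ψ.PosDef) (E : Matrix ι κ ℂ) :
    1 - Eᴴ * (Ψ + E * Eᴴ)⁻¹ * E = (1 + Eᴴ * Ψ⁻¹ * E)⁻¹ := by
  have hC : (Ψ + E * Eᴴ).PosDef := hΨ.add_posSemidef (posSemidef_self_mul_conjTranspose E)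
  have h1 : (Ψ + E * Eᴴ)⁻¹ * (Ψ + E * Eᴴ) = 1 :=
    nonsing_inv_mul _ ((isUnit_iff_isUnit_det _).1 hC.isUnit)
  have h2 : Ψ * Ψ⁻¹ = 1 := mul_nonsing_inv _ ((isUnit_iff_isUnit_det _).1 hΨ.isUnit)
  symm
  apply inv_eq_left_inv
  have h3 : (Ψ + E * Eᴴ)⁻¹ * (E * Eᴴ) = 1 - (Ψ + E * Eᴴ)⁻¹ * Ψ := by
    rw [← h1]; simp [mul_add]
  calc (1 - Eᴴ * (Ψ + E * Eᴴ)⁻¹ * E) * (1 + Eᴴ * Ψ⁻¹ * E)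
      = 1 + Eᴴ * Ψ⁻¹ * E - Eᴴ * (Ψ + E * Eᴴ)⁻¹ * E
        - Eᴴ * ((Ψ + E * Eᴴ)⁻¹ * (E * Eᴴ)) * Ψ⁻¹ * E := by
        simp only [Matrix.sub_mul, Matrix.mul_add, Matrix.mul_one, Matrix.one_mul, Matrix.mul_assoc]
        abel
    _ = 1 + Eᴴ * Ψ⁻¹ * E - Eᴴ * (Ψ + E * Eᴴ)⁻¹ * E
        - (Eᴴ * Ψ⁻¹ * E - Eᴴ * (Ψ + E * Eᴴ)⁻¹ * (Ψ * Ψ⁻¹) * E) := by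
        rw [h3]; simp only [Matrix.sub_mul, Matrix.mul_sub, Matrix.mul_one, Matrix.mul_assoc]
    _ = 1 := by rw [h2, Matrix.mul_one]; abel

lemma det_eq_ofReal_re {Q : Matrix ι ι ℂ} (hQ : Q.IsHermitian) : Q.det = ((Q.det.re : ℝ) : ℂ) := by
  rw [hQ.det_eq_prod_eigenvalues]
  norm_cast

lemma det_re_pos {Q : Matrix ι ι ℂ} (hQ : Q.PosDef) : 0 < Q.det.re :=
  (Complex.pos_iff.1 hQ.det_pos).1

lemma log_det_le_trace {Q : Matrix ι ι ℂ} (hQ : Q.PosDef) :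
    Real.log Q.det.re ≤ Q.trace.re - Fintype.card ι := by
  rw [hQ.1.det_eq_prod_eigenvalues, hQ.1.trace_eq_sum_eigenvalues]
  simp only [Complex.coe_algebraMap, ← Complex.ofReal_prod, ← Complex.ofReal_sum,
    Complex.ofReal_re]
  rw [Real.log_prod fun i _ => (hQ.eigenvalues_pos i).ne']
  calc ∑ i, Real.log (hQ.1.eigenvalues i) ≤ ∑ i, (hQ.1.eigenvalues i - 1) :=
        Finset.sum_le_sum fun i _ => Real.log_le_sub_one_of_pos (hQ.eigenvalues_pos i)
    _ = _ := by simp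

lemma det_inv_re {Q : Matrix ι ι ℂ} (hQ : Q.PosDef) : (Q⁻¹).det.re = (Q.det.re)⁻¹ := by
  rw [det_nonsing_inv, Ring.inverse_eq_inv', det_eq_ofReal_re hQ.1, ← Complex.ofReal_inv,
    Complex.ofReal_re, Complex.ofReal_re]

lemma le_log_det {Q : Matrix ι ι ℂ} (hQ : Q.PosDef) :
    Fintype.card ι - (Q⁻¹).trace.re ≤ Real.log Q.det.re := by
  have := log_det_le_trace hQ.inv
  rw [det_inv_re hQ, Real.log_inv] at this
  linarith

/-- A generalized Cauchy-Schwarz inequality, from positivity of a block Gram matrix. -/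
lemma posSemidef_sub_conj_inv {Ψ K : Matrix ι ι ℂ} {E : Matrix ι κ ℂ} {G : Matrix κ κ ℂ}
    (hΨ : Ψ.PosDef) (hK : (Ψ - K).PosSemidef) (h : (fromBlocks K E Eᴴ G).PosSemidef) :
    (G - Eᴴ * Ψ⁻¹ * E).PosSemidef := by
  have := hΨ.isUnit.invertible
  rw [← PosDef.fromBlocks₁₁ E G hΨ]
  -- Enlarging the corner `K` to `Ψ` keeps the block matrix positive semidefinite, so the Schur
  -- complement is taken at the invertible `Ψ`; `K` itself may be singular.
  have h0 : (fromBlocks (Ψ - K) (0 : Matrix ι κ ℂ) 0 (0 : Matrix κ κ ℂ)).PosSemidef := by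
    have : fromBlocks (Ψ - K) (0 : Matrix ι κ ℂ) 0 (0 : Matrix κ κ ℂ)
        = fromRows (1 : Matrix ι ι ℂ) (0 : Matrix κ ι ℂ) * (Ψ - K) *
          (fromRows (1 : Matrix ι ι ℂ) (0 : Matrix κ ι ℂ))ᴴ := by
      rw [conjTranspose_fromRows_eq_fromCols_conjTranspose, fromRows_mul, fromRows_mul_fromCols]
      simp
    rw [this]
    exact hK.mul_mul_conjTranspose_same _
  have := h.add h0
  rwa [fromBlocks_add, add_sub_cancel, add_zero, add_zero, add_zero] at this

end MatrixAlgebra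

/-! ### Conditional expectations of products and of random matrices -/

section CondExp

lemma stronglyMeasurable_of_apply {Ω ι : Type*} [Finite ι] {m : MeasurableSpace Ω} {f : ι → Ω → ℂ}
    (hf : ∀ i, StronglyMeasurable (f i)) : StronglyMeasurable fun ω i => f i ω :=
  (measurable_pi_iff.2 fun i => (hf i).measurable).stronglyMeasurable

variable {Ω : Type*} {m 𝓢 mΩ : MeasurableSpace Ω} {P : Measure Ω} {ι κ : Type*}

lemma condExp_pi_apply [Fintype ι] (g : Ω → ι → ℂ) (hg : Integrable g P) (i : ι) :
    (fun ω => (P[g | m]) ω i) =ᵐ[P] P[fun ω => g ω i | m] :=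
  (ContinuousLinearMap.proj (R := ℝ) (φ := fun _ : ι => ℂ) i).comp_condExp_comm hg

/-- Pull-out property for a sum of products whose terms need not be integrable. -/
lemma condExp_sum_mul [Fintype ι] {f g : ι → Ω → ℂ} (hf : ∀ i, StronglyMeasurable[m] (f i))
    (hg : ∀ i, Integrable (g i) P) (hfg : Integrable (fun ω => ∑ i, f i ω * g i ω) P) :
    P[fun ω => ∑ i, f i ω * g i ω | m] =ᵐ[P] fun ω => ∑ i, f i ω * (P[g i | m]) ω := by
  -- The sum is viewed as one bilinear pairing of two random vectors, so the pull-out property asks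
  -- for integrability of the pairing only, not of each product.
  let B : (ι → ℂ) →L[ℝ] (ι → ℂ) →L[ℝ] ℂ :=
    ∑ i, (ContinuousLinearMap.mul ℝ ℂ).bilinearComp
      (ContinuousLinearMap.proj (R := ℝ) (φ := fun _ : ι => ℂ) i)
      (ContinuousLinearMap.proj (R := ℝ) (φ := fun _ : ι => ℂ) i)
  have hB : ∀ a b, B a b = ∑ i, a i * b i := by
    intro a b
    simp [B]
  have hg' : Integrable (fun ω i => g i ω) P := Integrable.of_eval hg
  have h := condExp_bilin_of_stronglyMeasurable_left (μ := P) (m := m) B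
    (f := fun ω i => f i ω) (g := fun ω i => g i ω) 
    (stronglyMeasurable_of_apply hf)
    (by simpa only [hB] using hfg) hg'
  simp only [hB] at h
  filter_upwards [h, ae_all_iff.2 fun i => condExp_pi_apply (m := m) _ hg' i] with ω h1 h2
  rw [h1]
  exact Finset.sum_congr rfl fun i _ => by rw [h2 i]

lemma condExp_mul_left {f g : Ω → ℂ} (hf : StronglyMeasurable[m] f) (hg : Integrable g P)
    (hfg : Integrable (fun ω => f ω * g ω) P) :
    P[fun ω => f ω * g ω | m] =ᵐ[P] fun ω => f ω * (P[g | m]) ω :=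
  condExp_bilin_of_stronglyMeasurable_left (ContinuousLinearMap.mul ℝ ℂ) hf hfg hg

open scoped ComplexOrder in
/-- A nonnegative sum of products is integrable when its formal conditional expectation is. -/
lemma integrable_sum_mul_of_nonneg [Fintype ι] [IsFiniteMeasure P] (hm : m ≤ mΩ)
    {f g : ι → Ω → ℂ}
    (hf : ∀ i, StronglyMeasurable[m] (f i)) (hg : ∀ i, Integrable (g i) P)
    (hpos : ∀ᵐ ω ∂P, 0 ≤ ∑ i, f i ω * g i ω)
    (hint : Integrable (fun ω => ∑ i, f i ω * (P[g i | m]) ω) P) :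
    Integrable (fun ω => ∑ i, f i ω * g i ω) P := by
  -- Truncation to the sets where all coefficients are at most `n`. They lie in `m`, so the
  -- indicator can be absorbed into the `m`-measurable coefficients, and on them every term is
  -- integrable.
  let s : ℕ → Set Ω := fun n => {ω | ∀ i, ‖f i ω‖ ≤ n}
  have hs : ∀ n, MeasurableSet[m] (s n) := by
    intro n
    have : s n = ⋂ i, {ω | ‖f i ω‖ ≤ n} := by ext; simp [s]
    rw [this]
    exact MeasurableSet.iInter fun i =>
      (hf i).norm.measurable measurableSet_Iic
  have hcover : AECover P Filter.atTop s := by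
    refine ⟨Filter.Eventually.of_forall fun ω => ?_, fun n => hm _ (hs n)⟩
    obtain ⟨n, hn⟩ := exists_nat_ge (∑ i, ‖f i ω‖)
    filter_upwards [Filter.eventually_ge_atTop n] with k hk i
    calc ‖f i ω‖ ≤ ∑ i, ‖f i ω‖ :=
          Finset.single_le_sum (f := fun i => ‖f i ω‖) (fun _ _ => norm_nonneg _) (Finset.mem_univ i)
      _ ≤ k := hn.trans (by exact_mod_cast hk)
  have hterm : ∀ n i, Integrable (fun ω => (s n).indicator (f i) ω * g i ω) P := by
    intro n i
    refine (hg i).bdd_mul (c := n)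
      (((hf i).mono hm).indicator (hm _ (hs n))).aestronglyMeasurable (.of_forall fun ω => ?_)
    by_cases h : ω ∈ s n
    · simpa [h] using h i
    · simp [h]
  have hind : ∀ n, (s n).indicator (fun ω => ∑ i, f i ω * g i ω)
      = fun ω => ∑ i, (s n).indicator (f i) ω * g i ω := by
    intro n; ext ω
    by_cases h : ω ∈ s n <;> simp [h]
  have hind' : ∀ n, (s n).indicator (fun ω => ∑ i, f i ω * (P[g i | m]) ω)
      = fun ω => ∑ i, (s n).indicator (f i) ω * (P[g i | m]) ω := by
    intro n; ext ω
    by_cases h : ω ∈ s n <;> simp [h]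
  have hfi : ∀ n, IntegrableOn (fun ω => ∑ i, f i ω * g i ω) (s n) P := by
    intro n
    rw [← integrable_indicator_iff (hm _ (hs n)), hind]
    exact integrable_finsetSum _ fun i _ => hterm n i
  refine hcover.integrable_of_integral_norm_bounded
    (∫ ω, ‖∑ i, f i ω * (P[g i | m]) ω‖ ∂P) hfi (.of_forall fun n => ?_)
  -- Positivity is used here: the integral of the norm is the real part of the integral, in which
  -- each `g i` may be replaced by its conditional expectation. The resulting bound does not depend
  -- on `n`.
  have h1 : ∫ ω in s n, ‖∑ i, f i ω * g i ω‖ ∂P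
      = (∫ ω in s n, ∑ i, f i ω * g i ω ∂P).re := by
    have h2 : ∀ᵐ ω ∂P.restrict (s n), ‖∑ i, f i ω * g i ω‖ = (∑ i, f i ω * g i ω).re :=
      ae_restrict_of_ae (hpos.mono fun ω h => by
        rw [Complex.norm_eq_sqrt_sq_add_sq, ← (Complex.nonneg_iff.1 h).2]
        simpa using Real.sqrt_sq (Complex.nonneg_iff.1 h).1)
    rw [integral_congr_ae h2]
    exact integral_re (hfi n)
  have h3 : ∫ ω in s n, ∑ i, f i ω * g i ω ∂P
      = ∫ ω in s n, ∑ i, f i ω * (P[g i | m]) ω ∂P := by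
    rw [← integral_indicator (hm _ (hs n)), ← integral_indicator (hm _ (hs n)), hind, hind',
      ← integral_condExp hm]
    exact integral_congr_ae (condExp_sum_mul (fun i => (hf i).indicator (hs n)) hg
      (integrable_finsetSum _ fun i _ => hterm n i))
  rw [h1, h3]
  calc (∫ ω in s n, ∑ i, f i ω * (P[g i | m]) ω ∂P).re
      ≤ ‖∫ ω in s n, ∑ i, f i ω * (P[g i | m]) ω ∂P‖ := Complex.re_le_norm _
    _ ≤ ∫ ω in s n, ‖∑ i, f i ω * (P[g i | m]) ω‖ ∂P := norm_integral_le_integral_norm _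
    _ ≤ _ := setIntegral_le_integral hint.norm (.of_forall fun _ => norm_nonneg _)

/-- A factor independent of the side information and of the other factor comes out of the
conditional expectation as its mean. -/
lemma condExp_mul_of_indep [IsProbabilityMeasure P] {𝓤 : MeasurableSpace Ω} (hm : m ≤ 𝓢)
    (h𝓢 : 𝓢 ≤ mΩ) (h𝓤 : 𝓤 ≤ mΩ) (hind : Indep 𝓤 𝓢 P) {f g : Ω → ℂ}
    (hf : StronglyMeasurable[𝓤] f) (hg : StronglyMeasurable[𝓢] g)
    (hfi : Integrable f P) (hgi : Integrable g P) :
    Integrable (fun ω => f ω * g ω) P ∧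
      P[fun ω => f ω * g ω | m] =ᵐ[P] fun ω => (∫ ω', f ω' ∂P) * (P[g | m]) ω := by
  have hfg : Integrable (fun ω => g ω * f ω) P := by
    have h : IndepFun g f P := by
      rw [IndepFun_iff_Indep]
      exact indep_of_indep_of_le_left (indep_of_indep_of_le_right hind.symm
        (hf.measurable.comap_le)) (hg.measurable.comap_le)
    exact h.integrable_mul hgi hfi
  refine ⟨by simpa only [mul_comm] using hfg, ?_⟩
  -- Conditioning goes through the larger `𝓢`, where `g` is known and `f` is independent; the tower
  -- property then descends to `m`.
  have h1 : P[fun ω => g ω * f ω | 𝓢] =ᵐ[P] fun ω => (∫ ω', f ω' ∂P) • g ω := by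
    filter_upwards [condExp_mul_left hg hfi hfg, condExp_indep_eq h𝓤 h𝓢 hf hind] with ω h1 h2
    rw [h1, h2, smul_eq_mul, mul_comm]
  have h2 := (condExp_condExp_of_le hm h𝓢 (f := fun ω => g ω * f ω) (μ := P)).symm.trans
    (condExp_congr_ae h1)
  simp only [mul_comm (f _)]
  refine h2.trans ?_
  exact condExp_smul (μ := P) (∫ ω', f ω' ∂P) g m

/-- Entrywise conditional expectation of a random matrix, given a σ-algebra. -/
noncomputable def condExpMat (P : Measure Ω) (m : MeasurableSpace Ω) (X : Ω → Matrix ι κ ℂ) :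
    Ω → Matrix ι κ ℂ :=
  fun ω => Matrix.of fun i j => (P[fun ω' => X ω' i j | m]) ω

lemma condExp_star {g : Ω → ℂ} (hg : Integrable g P) :
    P[fun ω => star (g ω) | m] =ᵐ[P] fun ω => star ((P[g | m]) ω) :=
  (Complex.conjCLE.toContinuousLinearMap.comp_condExp_comm (m := m) hg).symm

lemma condExpMat_conjTranspose [Finite ι] [Finite κ] {X : Ω → Matrix ι κ ℂ}
    (hX : ∀ i j, Integrable (fun ω => X ω i j) P) :
    condExpMat P m (fun ω => (X ω)ᴴ) =ᵐ[P] fun ω => (condExpMat P m X ω)ᴴ := by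
  filter_upwards [ae_all_iff.2 fun i => ae_all_iff.2 fun j => condExp_star (m := m) (hX i j)]
    with ω h
  ext i j
  exact h j i

lemma condExpMat_smul [Finite ι] [Finite κ] (c : ℂ) (X : Ω → Matrix ι κ ℂ) :
    condExpMat P m (fun ω => c • X ω) =ᵐ[P] fun ω => c • condExpMat P m X ω := by
  filter_upwards [ae_all_iff.2 fun i => ae_all_iff.2 fun j =>
    condExp_smul (μ := P) c (fun ω => X ω i j) m] with ω h
  ext i j
  exact h i j

lemma condExpMat_add [Finite ι] [Finite κ] {X Y : Ω → Matrix ι κ ℂ}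
    (hX : ∀ i j, Integrable (fun ω => X ω i j) P)
    (hY : ∀ i j, Integrable (fun ω => Y ω i j) P) :
    condExpMat P m (fun ω => X ω + Y ω) =ᵐ[P]
      fun ω => condExpMat P m X ω + condExpMat P m Y ω := by
  filter_upwards [ae_all_iff.2 fun i => ae_all_iff.2 fun j => condExp_add (hX i j) (hY i j) m]
    with ω hω
  ext i j
  exact hω i j

open scoped ComplexOrder in
-- For a fixed vector the conditional quadratic form is almost surely nonnegative, but the null set
-- depends on the vector. A countable dense set of vectors gives one common null set, and continuity
-- in the vector extends the inequality to all of them.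
lemma condExpMat_posSemidef [Fintype ι] {X : Ω → Matrix ι ι ℂ}
    (hX : ∀ i j, Integrable (fun ω => X ω i j) P) (hpos : ∀ᵐ ω ∂P, (X ω).PosSemidef) :
    ∀ᵐ ω ∂P, (condExpMat P m X ω).PosSemidef := by
  have hquad : ∀ v : ι → ℂ, ∀ᵐ ω ∂P, 0 ≤ star v ⬝ᵥ (condExpMat P m X ω *ᵥ v) := by
    intro v
    have hsum : ∀ M : Matrix ι ι ℂ,
        star v ⬝ᵥ (M *ᵥ v) = ∑ q : ι × ι, (star (v q.1) * v q.2) * M q.1 q.2 := by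
      intro M
      simp only [dotProduct, mulVec, Pi.star_apply, Finset.mul_sum, Fintype.sum_prod_type]
      exact Finset.sum_congr rfl fun i _ => Finset.sum_congr rfl fun j _ => by ring
    have hint : Integrable (fun ω => star v ⬝ᵥ (X ω *ᵥ v)) P := by
      simp only [hsum]
      exact integrable_finsetSum _ fun q _ => (hX q.1 q.2).const_mul _
    have h1 : P[fun ω => star v ⬝ᵥ (X ω *ᵥ v) | m]
        =ᵐ[P] fun ω => star v ⬝ᵥ (condExpMat P m X ω *ᵥ v) := by
      simp only [hsum] at hint ⊢
      exact condExp_sum_mul (fun q => stronglyMeasurable_const) (fun q => hX q.1 q.2) hint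
    -- The quadratic form is almost surely real, so its conditional expectation is that of its real
    -- part, to which monotonicity applies.
    have h2 : P[fun ω => star v ⬝ᵥ (X ω *ᵥ v) | m]
        =ᵐ[P] fun ω => (((P[fun ω => (star v ⬝ᵥ (X ω *ᵥ v)).re | m]) ω : ℝ) : ℂ) := by
      have h3 : (fun ω => star v ⬝ᵥ (X ω *ᵥ v))
          =ᵐ[P] fun ω => (((star v ⬝ᵥ (X ω *ᵥ v)).re : ℝ) : ℂ) :=
        hpos.mono fun ω h => Complex.eq_re_of_ofReal_le (h.dotProduct_mulVec_nonneg v)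
      exact (condExp_congr_ae h3).trans
        (Complex.ofRealCLM.comp_condExp_comm (m := m) hint.re).symm
    filter_upwards [h1, h2, condExp_nonneg (m := m) (μ := P)
      (f := fun ω => (star v ⬝ᵥ (X ω *ᵥ v)).re) (hpos.mono fun ω h =>
        (Complex.nonneg_iff.1 (h.dotProduct_mulVec_nonneg v)).1)] with ω h1 h2 h3
    rw [← h1, h2]
    exact_mod_cast h3
  have hherm : ∀ᵐ ω ∂P, (condExpMat P m X ω).IsHermitian := by
    have h1 : condExpMat P m (fun ω => (X ω)ᴴ) =ᵐ[P] condExpMat P m X := by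
      filter_upwards [ae_all_iff.2 fun i => ae_all_iff.2 fun j => condExp_congr_ae (m := m)
        (hpos.mono fun ω h => congr_fun (congr_fun h.1 i) j :
          (fun ω => (X ω)ᴴ i j) =ᵐ[P] fun ω => X ω i j)] with ω h
      ext i j
      exact h i j
    filter_upwards [h1, condExpMat_conjTranspose (m := m) hX] with ω h1 h2
    exact (h2.symm.trans h1)
  filter_upwards [hherm, ae_all_iff.2 fun n => hquad (TopologicalSpace.denseSeq (ι → ℂ) n)]
    with ω h1 h2
  refine .of_dotProduct_mulVec_nonneg h1 fun v => ?_
  have hclosed : IsClosed {v : ι → ℂ | 0 ≤ star v ⬝ᵥ (condExpMat P m X ω *ᵥ v)} := by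
    refine isClosed_le continuous_const ?_
    simp only [dotProduct, mulVec, Pi.star_apply]
    fun_prop
  exact hclosed.closure_subset_iff.2 (Set.range_subset_iff.2 h2)
    (TopologicalSpace.denseRange_denseSeq (ι → ℂ) v)

end CondExp

/-! ### Densities of complex Gaussian vectors -/

section Gaussian

instance isProbabilityMeasure_stdCN : IsProbabilityMeasure stdCN := by
  unfold stdCN
  exact Measure.isProbabilityMeasure_map
    (Complex.measurableEquivRealProd.symm.measurable.aemeasurable)

instance isProbabilityMeasure_stdCNVec (k : ℕ) : IsProbabilityMeasure (stdCNVec k) := by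
  unfold stdCNVec; infer_instance

/-- The density of `CN(0,1)`. -/
noncomputable def stdCNDensity (z : ℂ) : ℝ := Real.pi⁻¹ * Real.exp (-‖z‖ ^ 2)

lemma stdCNDensity_nonneg (z : ℂ) : 0 ≤ stdCNDensity z := by
  unfold stdCNDensity; positivity

lemma measurable_stdCNDensity : Measurable stdCNDensity := by
  unfold stdCNDensity; fun_prop

lemma gaussianPDF_mul_gaussianPDF (a b : ℝ) :
    gaussianPDF 0 (1 / 2) a * gaussianPDF 0 (1 / 2) b = ENNReal.ofReal (stdCNDensity ⟨a, b⟩) := by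
  rw [gaussianPDF, gaussianPDF, ← ENNReal.ofReal_mul (gaussianPDFReal_nonneg _ _ _)]
  congr 1
  simp only [gaussianPDFReal, stdCNDensity]
  have h : Real.sqrt (2 * Real.pi * ((1 / 2 : NNReal) : ℝ)) = Real.sqrt Real.pi := by
    congr 1; push_cast; ring
  rw [h, ← Complex.normSq_eq_norm_sq, Complex.normSq_mk,
    show ∀ p q r : ℝ, p * q * (p * r) = (p * p) * (q * r) by intros; ring, ← Real.exp_add,
    ← mul_inv, Real.mul_self_sqrt Real.pi_pos.le]
  congr 2
  push_cast; ring

lemma stdCN_eq_withDensity :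
    stdCN = (volume : Measure ℂ).withDensity fun z => ENNReal.ofReal (stdCNDensity z) := by
  have hv : (1 / 2 : NNReal) ≠ 0 := by norm_num
  unfold stdCN
  rw [gaussianReal_of_var_ne_zero _ hv,
    prod_withDensity (measurable_gaussianPDF _ _) (measurable_gaussianPDF _ _)]
  ext s hs
  have hmeas : Measurable fun q : ℝ × ℝ => (⟨q.1, q.2⟩ : ℂ) :=
    Complex.measurableEquivRealProd.symm.measurable
  rw [Measure.map_apply hmeas hs, withDensity_apply _ (hmeas hs), withDensity_apply _ hs]
  simp only [gaussianPDF_mul_gaussianPDF]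
  exact (Complex.volume_preserving_equiv_real_prod.symm).setLIntegral_comp_preimage hs
    measurable_stdCNDensity.ennreal_ofReal

/-- The total mass is read off from `stdCN` being a probability measure, so no Gaussian integral has
to be evaluated. -/
lemma integrable_stdCNDensity : Integrable stdCNDensity := by
  refine ⟨measurable_stdCNDensity.aestronglyMeasurable, ?_⟩
  have h := measure_univ (μ := stdCN)
  rw [stdCN_eq_withDensity, withDensity_apply _ .univ, setLIntegral_univ] at h
  rw [hasFiniteIntegral_iff_ofReal (.of_forall stdCNDensity_nonneg), h]
  exact ENNReal.one_lt_top

/-- The density of `CN(0, I_k)`. -/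
noncomputable def stdCNVecDensity {k : ℕ} (x : Fin k → ℂ) : ℝ := ∏ i, stdCNDensity (x i)

lemma stdCNVecDensity_eq {k : ℕ} (x : Fin k → ℂ) :
    stdCNVecDensity x = (Real.pi⁻¹) ^ k * Real.exp (-∑ i, ‖x i‖ ^ 2) := by
  simp [stdCNVecDensity, stdCNDensity, Finset.prod_mul_distrib, ← Real.exp_sum]

lemma measurable_stdCNVecDensity {k : ℕ} : Measurable (stdCNVecDensity (k := k)) := by
  unfold stdCNVecDensity
  exact Finset.measurable_fun_prod _ fun i _ => measurable_stdCNDensity.comp (measurable_pi_apply i)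

lemma stdCNVec_eq_withDensity (k : ℕ) :
    stdCNVec k = (volume : Measure (Fin k → ℂ)).withDensity
      fun x => ENNReal.ofReal (stdCNVecDensity x) := by
  symm
  unfold stdCNVec
  symm
  refine Measure.pi_eq fun s hs => ?_
  rw [withDensity_apply _ (MeasurableSet.univ_pi hs), volume_pi, Measure.restrict_pi_pi,
    ← ofReal_integral_eq_lintegral_ofReal]
  · unfold stdCNVecDensity
    rw [integral_fintype_prod_eq_prod,
      ENNReal.ofReal_prod_of_nonneg fun i _ => integral_nonneg fun _ => stdCNDensity_nonneg _]
    refine Finset.prod_congr rfl fun i _ => ?_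
    rw [stdCN_eq_withDensity, withDensity_apply _ (hs i), ofReal_integral_eq_lintegral_ofReal
      integrable_stdCNDensity.integrableOn (.of_forall stdCNDensity_nonneg)]
  · exact Integrable.fintype_prod fun i => integrable_stdCNDensity.integrableOn
  · exact .of_forall fun x => Finset.prod_nonneg fun i _ => stdCNDensity_nonneg _

open scoped ComplexOrder MatrixOrder in
/-- The complex Gaussian density with precision matrix `Q` and mean `c`, relative to
`CN(0, I_k)`, has integral one. -/
lemma lintegral_gaussian_ratio {k : ℕ} {Q : Matrix (Fin k) (Fin k) ℂ} (hQ : Q.PosDef)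
    (c : Fin k → ℂ) :
    ∫⁻ x, ENNReal.ofReal (Real.exp (Real.log Q.det.re
      - (star (x - c) ⬝ᵥ (Q *ᵥ (x - c))).re + ∑ i, ‖x i‖ ^ 2)) ∂(stdCNVec k) = 1 := by
  -- Writing `Q = Rᴴ R`, the substitution `x ↦ R (x - c)` turns the integrand, multiplied by the
  -- prior density, into the standard density times `|det R|² = det Q`.
  obtain ⟨R, hR, hQR⟩ :=
    CStarAlgebra.isStrictlyPositive_iff_eq_star_mul_self.mp hQ.isStrictlyPositive
  have hdet : Q.det.re = ‖R.det‖ ^ 2 := by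
    rw [hQR, det_mul, star_eq_conjTranspose, det_conjTranspose, ← Complex.normSq_eq_norm_sq]
    simp [Complex.normSq_apply]
  have hRdet : R.det ≠ 0 := ((isUnit_iff_isUnit_det R).1 hR).ne_zero
  have hquad : ∀ v : Fin k → ℂ, (star v ⬝ᵥ (Q *ᵥ v)).re = ∑ i, ‖(R *ᵥ v) i‖ ^ 2 := by
    intro v
    have : star v ⬝ᵥ (Q *ᵥ v) = star (R *ᵥ v) ⬝ᵥ (R *ᵥ v) := by
      rw [hQR, star_eq_conjTranspose, star_mulVec, ← mulVec_mulVec, dotProduct_mulVec]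
    rw [this]
    simp only [dotProduct, Pi.star_apply, Complex.re_sum]
    refine Finset.sum_congr rfl fun i _ => ?_
    rw [← Complex.normSq_eq_norm_sq]
    simp [Complex.normSq_apply]
  have hm : Measurable fun x : Fin k → ℂ => ENNReal.ofReal (Real.exp (Real.log Q.det.re
      - (star (x - c) ⬝ᵥ (Q *ᵥ (x - c))).re + ∑ i, ‖x i‖ ^ 2)) := by
    simp only [dotProduct, mulVec, Pi.star_apply, Pi.sub_apply]
    fun_prop
  rw [stdCNVec_eq_withDensity,
    lintegral_withDensity_eq_lintegral_mul _ measurable_stdCNVecDensity.ennreal_ofReal hm]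
  -- Lebesgue measure scales by the real determinant, which for a complex linear map is the squared
  -- modulus of the complex one.
  let f : (Fin k → ℂ) →ₗ[ℝ] (Fin k → ℂ) := (Matrix.toLin' R).restrictScalars ℝ
  have hf : LinearMap.det f = ‖R.det‖ ^ 2 := by
    simp only [f]
    rw [LinearMap.det_restrictScalars, LinearMap.det_toLin', Algebra.norm_complex_apply,
      Complex.normSq_eq_norm_sq]
  have hfne : LinearMap.det f ≠ 0 := by rw [hf]; positivity
  have hpt : ∀ x : Fin k → ℂ, ENNReal.ofReal (stdCNVecDensity x) *
      ENNReal.ofReal (Real.exp (Real.log Q.det.re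
        - (star (x - c) ⬝ᵥ (Q *ᵥ (x - c))).re + ∑ i, ‖x i‖ ^ 2))
      = ENNReal.ofReal (‖R.det‖ ^ 2) * ENNReal.ofReal (stdCNVecDensity (f (x - c))) := by
    intro x
    rw [← ENNReal.ofReal_mul (by rw [stdCNVecDensity_eq]; positivity),
      ← ENNReal.ofReal_mul (by positivity)]
    congr 1
    rw [stdCNVecDensity_eq, stdCNVecDensity_eq, hquad, ← hdet, Real.exp_add, Real.exp_sub,
      Real.exp_log (det_re_pos hQ), Real.exp_neg, Real.exp_neg]
    have : f (x - c) = R *ᵥ (x - c) := rfl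
    rw [this]
    field_simp
  simp only [Pi.mul_apply, hpt]
  rw [lintegral_const_mul _ (by
      have := f.continuous_of_finiteDimensional.measurable
      exact (measurable_stdCNVecDensity.comp
        (this.comp (measurable_id.sub_const c))).ennreal_ofReal),
    lintegral_sub_right_eq_self (fun x => ENNReal.ofReal (stdCNVecDensity (f x))) c]
  have hmap := Measure.map_linearMap_addHaar_eq_smul_addHaar
    (volume : Measure (Fin k → ℂ)) hfne
  have hone : ∫⁻ x : Fin k → ℂ, ENNReal.ofReal (stdCNVecDensity x) = 1 := by
    have h := measure_univ (μ := stdCNVec k)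
    rwa [stdCNVec_eq_withDensity, withDensity_apply _ .univ, setLIntegral_univ] at h
  have hint := lintegral_map (μ := (volume : Measure (Fin k → ℂ)))
    (measurable_stdCNVecDensity (k := k)).ennreal_ofReal
    f.continuous_of_finiteDimensional.measurable
  rw [← hint, hmap, lintegral_smul_measure, hone, hf, smul_eq_mul, mul_one,
    ← ENNReal.ofReal_mul (by positivity), abs_of_nonneg (by positivity),
    mul_inv_cancel₀ (by positivity), ENNReal.ofReal_one]

end Gaussian

/-! ### Variational lower bounds for mutual information -/

section Information

/-- The Donsker-Varadhan lower bound for the Kullback-Leibler divergence. -/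
lemma ofReal_integral_le_klDiv {α : Type*} [MeasurableSpace α] {μ ν : Measure α}
    [IsProbabilityMeasure μ] [IsProbabilityMeasure ν] {f : α → ℝ} (hf : Integrable f μ)
    (hfm : Measurable f) (hexp : ∫⁻ a, ENNReal.ofReal (Real.exp (f a)) ∂ν = 1) :
    ENNReal.ofReal (∫ a, f a ∂μ) ≤ InformationTheory.klDiv μ ν := by
  by_cases htop : InformationTheory.klDiv μ ν = ∞
  · rw [htop]; exact le_top
  obtain ⟨hac, hllr⟩ := InformationTheory.klDiv_ne_top_iff.1 htop
  have hexpi : Integrable (fun a => Real.exp (f a)) ν := by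
    refine ⟨hfm.exp.aestronglyMeasurable, ?_⟩
    rw [hasFiniteIntegral_iff_ofReal (.of_forall fun a => (Real.exp_pos _).le), hexp]
    exact ENNReal.one_lt_top
  have hexp1 : ∫ a, Real.exp (f a) ∂ν = 1 := by
    rw [integral_eq_lintegral_of_nonneg_ae (.of_forall fun a => (Real.exp_pos _).le)
      hexpi.aestronglyMeasurable, hexp, ENNReal.toReal_one]
  -- The bound is Gibbs' inequality for `μ` against `ν` tilted by `f`; the log-normalizer of the
  -- tilting vanishes by `hexp`.
  have := isProbabilityMeasure_tilted hexpi
  have hnn := InformationTheory.integral_llr_add_sub_measure_univ_nonneg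
    (hac.trans (absolutelyContinuous_tilted hexpi))
    (integrable_llr_tilted_right hac hf hllr hexpi)
  rw [integral_llr_tilted_right hac hf hexpi hllr, hexp1, Real.log_one] at hnn
  simp only [probReal_univ] at hnn
  have hkl : (InformationTheory.klDiv μ ν).toReal = ∫ a, llr μ ν a ∂μ := by
    rw [InformationTheory.toReal_klDiv_of_measure_eq hac (by simp)]
  rw [← ENNReal.ofReal_toReal htop, hkl]
  exact ENNReal.ofReal_le_ofReal (by linarith)

/-- The log-likelihood ratio of a Gaussian posterior with mean `c` and precision `Q`, relative to
the prior `CN(0, I_k)`. -/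
noncomputable def posteriorLogRatio {k : ℕ} (Q : Matrix (Fin k) (Fin k) ℂ) (c x : Fin k → ℂ) : ℝ :=
  Real.log Q.det.re - (star (x - c) ⬝ᵥ (Q *ᵥ (x - c))).re + ∑ i, ‖x i‖ ^ 2

open scoped ComplexOrder in
/-- The mutual information of a Gaussian vector with any observation is bounded below by the mean
log-likelihood ratio of an auxiliary Gaussian posterior. -/
lemma ofReal_integral_le_klDiv_prod {Ω 𝒰 : Type*} [MeasurableSpace Ω] [MeasurableSpace 𝒰]
    {P : Measure Ω} [IsProbabilityMeasure P] {k : ℕ} {x : Ω → Fin k → ℂ} (hx : Measurable x)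
    (hlaw : P.map x = stdCNVec k) {U : Ω → 𝒰} (hU : Measurable U)
    {Q : 𝒰 → Matrix (Fin k) (Fin k) ℂ} (hQm : ∀ i j, Measurable fun u => Q u i j)
    {c : 𝒰 → Fin k → ℂ} (hc : Measurable c) (hQ : ∀ᵐ ω ∂P, (Q (U ω)).PosDef)
    (hint : Integrable (fun ω => posteriorLogRatio (Q (U ω)) (c (U ω)) (x ω)) P) :
    ENNReal.ofReal (∫ ω, posteriorLogRatio (Q (U ω)) (c (U ω)) (x ω) ∂P)
      ≤ InformationTheory.klDiv (P.map fun ω => (x ω, U ω)) ((P.map x).prod (P.map U)) := by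
  have := Measure.isProbabilityMeasure_map (μ := P) hx.aemeasurable
  have := Measure.isProbabilityMeasure_map (μ := P) hU.aemeasurable
  have := Measure.isProbabilityMeasure_map (μ := P) (hx.prodMk hU).aemeasurable
  have hm : Measurable fun q : (Fin k → ℂ) × 𝒰 => posteriorLogRatio (Q q.2) (c q.2) q.1 := by
    have hdet : Measurable fun u => (Q u).det := by
      simp only [det_apply]
      fun_prop
    have hc' : ∀ i, Measurable fun q : (Fin k → ℂ) × 𝒰 => c q.2 i := fun i =>
      (measurable_pi_apply i).comp (hc.comp measurable_snd)
    have hQ' : ∀ i j, Measurable fun q : (Fin k → ℂ) × 𝒰 => Q q.2 i j := fun i j =>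
      (hQm i j).comp measurable_snd
    have hdet' : Measurable fun q : (Fin k → ℂ) × 𝒰 => (Q q.2).det := hdet.comp measurable_snd
    unfold posteriorLogRatio
    simp only [dotProduct, mulVec, Pi.star_apply, Pi.sub_apply]
    fun_prop
  have hi : Integrable (fun q : (Fin k → ℂ) × 𝒰 => posteriorLogRatio (Q q.2) (c q.2) q.1)
      (P.map fun ω => (x ω, U ω)) :=
    (integrable_map_measure hm.aestronglyMeasurable (hx.prodMk hU).aemeasurable).2 hint
  have h := ofReal_integral_le_klDiv (ν := (P.map x).prod (P.map U)) hi hm ?_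
  · rwa [integral_map (hx.prodMk hU).aemeasurable hm.aestronglyMeasurable] at h
  -- Under the product measure `x` is integrated first with `U` fixed, where the posterior ratio has
  -- integral one.
  · rw [lintegral_prod_symm _ hm.exp.ennreal_ofReal.aemeasurable,
      lintegral_map (hm.exp.ennreal_ofReal.lintegral_prod_left') hU, hlaw]
    have : ∀ᵐ ω ∂P, ∫⁻ x, ENNReal.ofReal (Real.exp (posteriorLogRatio (Q (U ω)) (c (U ω)) x))
        ∂(stdCNVec k) = 1 := hQ.mono fun ω h => lintegral_gaussian_ratio h _
    rw [lintegral_congr_ae this]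
    simp

end Information

/-! ### Entrywise measurability of random matrices -/

section EntryMeasurable

variable {Ω ι κ η : Type*} {m : MeasurableSpace Ω}

/-- A random matrix all of whose entries are measurable. -/
def EntryMeasurable (m : MeasurableSpace Ω) (X : Ω → Matrix ι κ ℂ) : Prop :=
  ∀ i j, Measurable[m] fun ω => X ω i j

namespace EntryMeasurable

lemma const (A : Matrix ι κ ℂ) : EntryMeasurable m fun _ => A := fun _ _ => measurable_const

lemma add {X Y : Ω → Matrix ι κ ℂ} (hX : EntryMeasurable m X) (hY : EntryMeasurable m Y) :
    EntryMeasurable m fun ω => X ω + Y ω := fun i j => (hX i j).add (hY i j)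

lemma sub {X Y : Ω → Matrix ι κ ℂ} (hX : EntryMeasurable m X) (hY : EntryMeasurable m Y) :
    EntryMeasurable m fun ω => X ω - Y ω := fun i j => (hX i j).sub (hY i j)

lemma smul {X : Ω → Matrix ι κ ℂ} (c : ℂ) (hX : EntryMeasurable m X) :
    EntryMeasurable m fun ω => c • X ω := fun i j => (hX i j).const_mul c

lemma conjTranspose {X : Ω → Matrix ι κ ℂ} (hX : EntryMeasurable m X) :
    EntryMeasurable m fun ω => (X ω)ᴴ := fun i j =>
  (Complex.continuous_conj.measurable).comp (hX j i)

lemma mul [Fintype κ] {X : Ω → Matrix ι κ ℂ} {Y : Ω → Matrix κ η ℂ} (hX : EntryMeasurable m X)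
    (hY : EntryMeasurable m Y) : EntryMeasurable m fun ω => X ω * Y ω := fun i j => by
  simp only [mul_apply]
  exact Finset.measurable_fun_sum _ fun l _ => (hX i l).mul (hY l j)

lemma sum {ν : Type*} (s : Finset ν) {X : ν → Ω → Matrix ι κ ℂ}
    (hX : ∀ a, EntryMeasurable m (X a)) :
    EntryMeasurable m fun ω => ∑ a ∈ s, X a ω := fun i j => by
  simp only [Matrix.sum_apply]
  exact Finset.measurable_fun_sum _ fun a _ => hX a i j

lemma det [Fintype ι] [DecidableEq ι] {X : Ω → Matrix ι ι ℂ} (hX : EntryMeasurable m X) :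
    Measurable[m] fun ω => (X ω).det := by
  simp only [det_apply]
  exact Finset.measurable_fun_sum _ fun σ _ =>
    (Finset.measurable_fun_prod _ fun i _ => hX (σ i) i).const_smul _

/-- Cramer's rule: cofactors times the inverse determinant. Singular matrices are covered, since the
inverse of `0` is `0` on both sides. -/
lemma inv [Fintype ι] [DecidableEq ι] {X : Ω → Matrix ι ι ℂ} (hX : EntryMeasurable m X) :
    EntryMeasurable m fun ω => (X ω)⁻¹ := fun i j => by
  simp only [inv_def, Ring.inverse_eq_inv', Matrix.smul_apply, adjugate_apply, smul_eq_mul]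
  refine hX.det.inv.mul (det fun a b => ?_)
  simp only [updateRow_apply]
  split_ifs
  exacts [measurable_const, hX a b]

lemma condExpMat {mΩ : MeasurableSpace Ω} (P : Measure Ω) (X : Ω → Matrix ι κ ℂ) :
    EntryMeasurable m (condExpMat P m X) := fun _ _ => stronglyMeasurable_condExp.measurable

lemma ite {X : Ω → Matrix ι κ ℂ} {p : Ω → Prop} [DecidablePred p] (hp : MeasurableSet[m] {ω | p ω})
    (hX : EntryMeasurable m X) : EntryMeasurable m fun ω => if p ω then 0 else X ω := fun i j => by
  have : (fun ω => (if p ω then 0 else X ω : Matrix ι κ ℂ) i j)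
      = fun ω => if p ω then 0 else X ω i j := by
    ext ω; split_ifs <;> simp
  rw [this]
  exact Measurable.ite hp measurable_const (hX i j)

/-- Doob-Dynkin factorization, by which a receiver that knows `Θ` can evaluate the precision and the
estimator matrix. -/
lemma exists_eq_comp [Finite ι] [Finite κ] {T : Type*} [mT : MeasurableSpace T] {Θ : Ω → T}
    {X : Ω → Matrix ι κ ℂ} (hX : EntryMeasurable (mT.comap Θ) X) :
    ∃ X' : T → Matrix ι κ ℂ, EntryMeasurable mT X' ∧ X = X' ∘ Θ := by
  choose f hf h using fun i j => (hX i j).exists_eq_measurable_comp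
  refine ⟨fun t => Matrix.of fun i j => f i j t, hf, ?_⟩
  ext ω i j
  exact congr_fun (h i j) ω

end EntryMeasurable

end EntryMeasurable

/-! ### White vectors observed through an independent random matrix: second moments -/

section WhiteChannel

set_option linter.unusedSectionVars false

variable {Ω : Type*} {m 𝓢 𝓤 mΩ : MeasurableSpace Ω} {P : Measure Ω} {k : ℕ} {η : Type*}

/-- The observation `y = R u` of a white random vector `u` through a random matrix `R` that is
independent of `u`, with side information `m` also independent of `u`. The first `k` coordinates of
`u` form the signal, the others the interference and noise. -/
structure WhiteChannel [DecidableEq η] (P : Measure Ω) (m 𝓢 𝓤 : MeasurableSpace Ω)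
    (u : Ω → Fin k ⊕ η → ℂ) (R : Ω → Matrix (Fin k) (Fin k ⊕ η) ℂ) : Prop where
  side_le : m ≤ 𝓢
  state_le : 𝓢 ≤ mΩ
  source_le : 𝓤 ≤ mΩ
  indep : Indep 𝓤 𝓢 P
  source_meas : ∀ a, Measurable[𝓤] fun ω => u ω a
  source_memLp : ∀ a, MemLp (fun ω => u ω a) 2 P
  source_white : ∀ a b, ∫ ω, u ω a * star (u ω b) ∂P = if a = b then 1 else 0
  matrix_meas : EntryMeasurable 𝓢 R
  matrix_memLp : ∀ i a, MemLp (fun ω => R ω i a) 2 P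

lemma integrable_mul_star {f g : Ω → ℂ} (hf : MemLp f 2 P) (hg : MemLp g 2 P) :
    Integrable (fun ω => f ω * star (g ω)) P := hf.integrable_mul hg.star

lemma memLp_two_of_integrable_mul_star {f : Ω → ℂ} (hf : AEStronglyMeasurable f P)
    (h : Integrable (fun ω => f ω * star (f ω)) P) : MemLp f 2 P := by
  rw [memLp_two_iff_integrable_sq_norm hf]
  refine h.norm.congr (.of_forall fun ω => ?_)
  simp [sq]

/-- The conditional mean of the signal part of the channel matrix. -/
noncomputable def meanGain (P : Measure Ω) (m : MeasurableSpace Ω)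
    (R : Ω → Matrix (Fin k) (Fin k ⊕ η) ℂ) :
    Ω → Matrix (Fin k) (Fin k) ℂ :=
  condExpMat P m fun ω => (R ω).toCols₁

/-- The conditional covariance of the observation. -/
noncomputable def obsCov [Fintype η] (P : Measure Ω) (m : MeasurableSpace Ω)
    (R : Ω → Matrix (Fin k) (Fin k ⊕ η) ℂ) :
    Ω → Matrix (Fin k) (Fin k) ℂ :=
  condExpMat P m fun ω => R ω * (R ω)ᴴ

/-- The effective noise covariance, with the gain uncertainty counted as noise. -/
noncomputable def effNoise [Fintype η] (P : Measure Ω) (m : MeasurableSpace Ω)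
    (R : Ω → Matrix (Fin k) (Fin k ⊕ η) ℂ) :
    Ω → Matrix (Fin k) (Fin k) ℂ :=
  fun ω => obsCov P m R ω - meanGain P m R ω * (meanGain P m R ω)ᴴ

/-- The inverse of the conditional error covariance of the linear MMSE estimate. -/
noncomputable def precision [Fintype η] (P : Measure Ω) (m : MeasurableSpace Ω)
    (R : Ω → Matrix (Fin k) (Fin k ⊕ η) ℂ) :
    Ω → Matrix (Fin k) (Fin k) ℂ :=
  fun ω => 1 + (meanGain P m R ω)ᴴ * (effNoise P m R ω)⁻¹ * meanGain P m R ω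

open scoped Classical in
/-- The matrix of the linear MMSE estimate, set to zero where the effective noise covariance is
singular. -/
noncomputable def estimator [Fintype η] (P : Measure Ω) (m : MeasurableSpace Ω)
    (R : Ω → Matrix (Fin k) (Fin k ⊕ η) ℂ) :
    Ω → Matrix (Fin k) (Fin k) ℂ :=
  fun ω => if (effNoise P m R ω).det = 0 then 0 else
    (meanGain P m R ω)ᴴ * (obsCov P m R ω)⁻¹

namespace WhiteChannel

section Measurability

variable [Fintype η] (R : Ω → Matrix (Fin k) (Fin k ⊕ η) ℂ)

lemma entryMeasurable_effNoise : EntryMeasurable m (effNoise P m R) :=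
  (EntryMeasurable.condExpMat P _).sub
    ((EntryMeasurable.condExpMat P _).mul (EntryMeasurable.condExpMat P _).conjTranspose)

lemma entryMeasurable_precision : EntryMeasurable m (precision P m R) :=
  (EntryMeasurable.const 1).add ((((EntryMeasurable.condExpMat P _).conjTranspose).mul
    (entryMeasurable_effNoise R).inv).mul (EntryMeasurable.condExpMat P _))

lemma measurableSet_singular : MeasurableSet[m] {ω | (effNoise P m R ω).det = 0} :=
  (entryMeasurable_effNoise R).det (measurableSet_singleton 0)

lemma entryMeasurable_estimator : EntryMeasurable m (estimator P m R) :=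
  EntryMeasurable.ite (measurableSet_singular R)
    (((EntryMeasurable.condExpMat P _).conjTranspose).mul (EntryMeasurable.condExpMat P _).inv)

end Measurability

variable [DecidableEq η] {u : Ω → Fin k ⊕ η → ℂ} {R : Ω → Matrix (Fin k) (Fin k ⊕ η) ℂ}

section Moments

variable [IsProbabilityMeasure P]

lemma side_le' (h : WhiteChannel P m 𝓢 𝓤 u R) : m ≤ mΩ := h.side_le.trans h.state_le

/-- Independence replaces a product of two coordinates of `u` by its mean, a Kronecker delta. After
expansion of `y = R u` into coordinates, only the diagonal terms survive conditioning. -/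
lemma condExp_source_mul (h : WhiteChannel P m 𝓢 𝓤 u R) {g : Ω → ℂ} (hg : Measurable[𝓢] g)
    (hgi : Integrable g P) (a b : Fin k ⊕ η) :
    Integrable (fun ω => u ω a * star (u ω b) * g ω) P ∧
    P[fun ω => u ω a * star (u ω b) * g ω | m] =ᵐ[P]
      fun ω => (if a = b then 1 else 0) * (P[g | m]) ω := by
  have hm : Measurable[𝓤] fun ω => u ω a * star (u ω b) :=
    (h.source_meas a).mul (Complex.continuous_conj.measurable.comp (h.source_meas b))
  have := condExp_mul_of_indep h.side_le h.state_le h.source_le h.indep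
    hm.stronglyMeasurable hg.stronglyMeasurable
    (integrable_mul_star (h.source_memLp a) (h.source_memLp b)) hgi
  simpa only [h.source_white a b] using this

variable [Fintype η]

lemma measurable_obs (h : WhiteChannel P m 𝓢 𝓤 u R) (i : Fin k) :
    Measurable fun ω => (R ω *ᵥ u ω) i := by
  simp only [mulVec, dotProduct]
  exact Finset.measurable_fun_sum _ fun a _ => ((h.matrix_meas i a).mono h.state_le le_rfl).mul
    ((h.source_meas a).mono h.source_le le_rfl)

lemma integrable_matrix_mul (h : WhiteChannel P m 𝓢 𝓤 u R) (i j : Fin k) :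
    Integrable (fun ω => (R ω * (R ω)ᴴ) i j) P := by
  simp only [mul_apply, conjTranspose_apply]
  exact integrable_finsetSum _ fun a _ =>
    integrable_mul_star (h.matrix_memLp i a) (h.matrix_memLp j a)

lemma condExp_obs_mul_star (h : WhiteChannel P m 𝓢 𝓤 u R) (i j : Fin k) :
    Integrable (fun ω => (R ω *ᵥ u ω) i * star ((R ω *ᵥ u ω) j)) P ∧
    P[fun ω => (R ω *ᵥ u ω) i * star ((R ω *ᵥ u ω) j) | m] =ᵐ[P]
      fun ω => obsCov P m R ω i j := by
  have hexp : (fun ω => (R ω *ᵥ u ω) i * star ((R ω *ᵥ u ω) j))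
      = ∑ q : (Fin k ⊕ η) × (Fin k ⊕ η), fun ω =>
        u ω q.1 * star (u ω q.2) * (R ω i q.1 * star (R ω j q.2)) := by
    ext ω
    simp only [mulVec, dotProduct, star_sum, star_mul', Finset.sum_mul_sum, Finset.sum_apply,
      Fintype.sum_prod_type]
    exact Finset.sum_congr rfl fun a _ => Finset.sum_congr rfl fun b _ => by ring
  have hterm := fun q : (Fin k ⊕ η) × (Fin k ⊕ η) => h.condExp_source_mul
    ((h.matrix_meas i q.1).mul (Complex.continuous_conj.measurable.comp (h.matrix_meas j q.2)))
    (integrable_mul_star (h.matrix_memLp i q.1) (h.matrix_memLp j q.2)) q.1 q.2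
  have hcov : (fun ω => (R ω * (R ω)ᴴ) i j)
      = ∑ a, fun ω => R ω i a * star (R ω j a) := by
    ext ω; simp [mul_apply]
  refine ⟨by rw [hexp]; exact integrable_finsetSum' _ fun q _ => (hterm q).1, ?_⟩
  rw [hexp]
  refine (condExp_finsetSum (fun q _ => (hterm q).1) m).trans ?_
  have h2 : (fun ω => obsCov P m R ω i j) =ᵐ[P]
      ∑ a, P[fun ω => R ω i a * star (R ω j a) | m] := by
    refine .trans ?_ (condExp_finsetSum (fun a _ =>
      integrable_mul_star (h.matrix_memLp i a) (h.matrix_memLp j a)) m)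
    rw [← hcov]; rfl
  refine .trans ?_ h2.symm
  filter_upwards [ae_all_iff.2 fun q => (hterm q).2] with ω hω
  simp only [Finset.sum_apply, Fintype.sum_prod_type, hω]
  simp
  rfl

lemma memLp_obs (h : WhiteChannel P m 𝓢 𝓤 u R) (i : Fin k) :
    MemLp (fun ω => (R ω *ᵥ u ω) i) 2 P :=
  memLp_two_of_integrable_mul_star (h.measurable_obs i).aestronglyMeasurable
    (h.condExp_obs_mul_star i i).1

lemma condExp_signal_mul_star_obs (h : WhiteChannel P m 𝓢 𝓤 u R) (i j : Fin k) :
    P[fun ω => u ω (.inl i) * star ((R ω *ᵥ u ω) j) | m] =ᵐ[P]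
      fun ω => (meanGain P m R ω)ᴴ i j := by
  have hexp : (fun ω => u ω (.inl i) * star ((R ω *ᵥ u ω) j))
      = ∑ a : Fin k ⊕ η, fun ω => u ω (.inl i) * star (u ω a) * star (R ω j a) := by
    ext ω
    simp only [mulVec, dotProduct, star_sum, star_mul', Finset.mul_sum, Finset.sum_apply]
    exact Finset.sum_congr rfl fun a _ => by ring
  have hint : ∀ a, Integrable (fun ω => R ω j a) P := fun a =>
    (h.matrix_memLp j a).integrable one_le_two
  have hterm := fun a : Fin k ⊕ η => h.condExp_source_mul
    (Complex.continuous_conj.measurable.comp (h.matrix_meas j a))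
    ((h.matrix_memLp j a).star.integrable one_le_two) (.inl i) a
  rw [hexp]
  refine (condExp_finsetSum (fun a _ => (hterm a).1) m).trans ?_
  filter_upwards [ae_all_iff.2 fun a => (hterm a).2, condExp_star (m := m) (hint (.inl i))]
    with ω h1 h2
  simp only [Finset.sum_apply, h1]
  simp only [ite_mul, one_mul, zero_mul, Finset.sum_ite_eq, Finset.mem_univ, if_true]
  exact h2

lemma condExp_signal_mul_star_signal (h : WhiteChannel P m 𝓢 𝓤 u R) (i j : Fin k) :
    P[fun ω => u ω (.inl i) * star (u ω (.inl j)) | m] =ᵐ[P]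
      fun _ => (1 : Matrix (Fin k) (Fin k) ℂ) i j := by
  have := (h.condExp_source_mul (g := fun _ => 1) measurable_const (integrable_const _)
    (.inl i) (.inl j)).2
  simp only [mul_one] at this
  refine this.trans ?_
  rw [condExp_const h.side_le']
  exact .of_forall fun ω => by simp [one_apply]

end Moments

section Positivity

variable [IsProbabilityMeasure P] [Fintype η]

open scoped ComplexOrder

lemma memLp_toCols (h : WhiteChannel P m 𝓢 𝓤 u R) :
    ∀ i j, Integrable (fun ω => (R ω).toCols₁ i j) P := fun i j =>
  (h.matrix_memLp i (.inl j)).integrable one_le_two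

/-- The effective noise covariance dominates the conditional covariance of the noise part. -/
lemma effNoise_sub_posSemidef (h : WhiteChannel P m 𝓢 𝓤 u R) :
    ∀ᵐ ω ∂P, (effNoise P m R ω
      - condExpMat P m (fun ω => (R ω).toCols₂ * ((R ω).toCols₂)ᴴ) ω).PosSemidef := by
  have hX : ∀ a b, Integrable (fun ω => (fromBlocks ((R ω).toCols₁ * ((R ω).toCols₁)ᴴ) (R ω).toCols₁
      ((R ω).toCols₁)ᴴ (1 : Matrix (Fin k) (Fin k) ℂ)) a b) P := by
    rintro (i | i) (j | j)
    · simp only [fromBlocks_apply₁₁, mul_apply, conjTranspose_apply]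
      exact integrable_finsetSum _ fun a _ =>
        integrable_mul_star (h.matrix_memLp i (.inl a)) (h.matrix_memLp j (.inl a))
    · exact h.memLp_toCols i j
    · exact (h.matrix_memLp j (.inl i)).star.integrable one_le_two
    · exact integrable_const _
  -- The block matrix is the Gram matrix of `R₁` stacked on the identity. Conditioning preserves its
  -- positivity, and the Schur complement yields `E{R₁ R₁ᴴ|m} ≥ E{R₁|m} E{R₁|m}ᴴ`.
  have h1 := condExpMat_posSemidef (m := m) hX (.of_forall fun ω => by
    have : fromBlocks ((R ω).toCols₁ * ((R ω).toCols₁)ᴴ) (R ω).toCols₁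
        ((R ω).toCols₁)ᴴ (1 : Matrix (Fin k) (Fin k) ℂ)
        = fromRows (R ω).toCols₁ 1 * (fromRows (R ω).toCols₁ (1 : Matrix (Fin k) (Fin k) ℂ))ᴴ := by
      rw [conjTranspose_fromRows_eq_fromCols_conjTranspose, fromRows_mul_fromCols]
      simp
    rw [this]
    exact posSemidef_self_mul_conjTranspose _)
  have h2 : ∀ i j, (fun ω => obsCov P m R ω i j) =ᵐ[P] fun ω =>
      condExpMat P m (fun ω => (R ω).toCols₁ * ((R ω).toCols₁)ᴴ) ω i j
        + condExpMat P m (fun ω => (R ω).toCols₂ * ((R ω).toCols₂)ᴴ) ω i j := by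
    intro i j
    have hsum : (fun ω => (R ω * (R ω)ᴴ) i j)
        = (fun ω => ((R ω).toCols₁ * ((R ω).toCols₁)ᴴ) i j)
          + fun ω => ((R ω).toCols₂ * ((R ω).toCols₂)ᴴ) i j := by
      ext ω; simp [mul_apply, toCols₁, toCols₂]
    have := condExp_add (μ := P) (hX (.inl i) (.inl j))
      (g := fun ω => ((R ω).toCols₂ * ((R ω).toCols₂)ᴴ) i j) (by
        simp only [mul_apply, conjTranspose_apply]
        exact integrable_finsetSum _ fun a _ =>
          integrable_mul_star (h.matrix_memLp i (.inr a)) (h.matrix_memLp j (.inr a))) m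
    unfold obsCov condExpMat
    simp only [of_apply]
    rw [hsum]
    exact this
  filter_upwards [h1, condExpMat_conjTranspose (m := m) h.memLp_toCols,
    ae_all_iff.2 fun i => ae_all_iff.2 (h2 i)] with ω h1 h3 h2
  have hblk : condExpMat P m (fun ω => fromBlocks ((R ω).toCols₁ * ((R ω).toCols₁)ᴴ) (R ω).toCols₁
      ((R ω).toCols₁)ᴴ (1 : Matrix (Fin k) (Fin k) ℂ)) ω
      = fromBlocks (condExpMat P m (fun ω => (R ω).toCols₁ * ((R ω).toCols₁)ᴴ) ω)
        (meanGain P m R ω) (meanGain P m R ω)ᴴ 1 := by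
    ext (i | i) (j | j)
    · rfl
    · rfl
    · exact congr_fun (congr_fun h3 i) j
    · simp [condExpMat, condExp_const h.side_le']
  rw [hblk] at h1
  have h4 := posSemidef_sub_mul_conjTranspose h1
  convert h4 using 1
  ext i j
  simp only [effNoise, Matrix.sub_apply, h2 i j]
  ring

lemma effNoise_posSemidef (h : WhiteChannel P m 𝓢 𝓤 u R) :
    ∀ᵐ ω ∂P, (effNoise P m R ω).PosSemidef := by
  have hX : ∀ i j, Integrable (fun ω => ((R ω).toCols₂ * ((R ω).toCols₂)ᴴ) i j) P := by
    intro i j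
    simp only [mul_apply, conjTranspose_apply]
    exact integrable_finsetSum _ fun a _ =>
      integrable_mul_star (h.matrix_memLp i (.inr a)) (h.matrix_memLp j (.inr a))
  filter_upwards [h.effNoise_sub_posSemidef, condExpMat_posSemidef (m := m) hX
    (.of_forall fun ω => posSemidef_self_mul_conjTranspose _)] with ω h1 h2
  simpa using h1.add h2

lemma precision_posDef (h : WhiteChannel P m 𝓢 𝓤 u R) :
    ∀ᵐ ω ∂P, (precision P m R ω).PosDef := by
  filter_upwards [h.effNoise_posSemidef] with ω h1
  exact PosDef.one.add_posSemidef (h1.inv.conjTranspose_mul_mul_same _)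

/-- The algebraic identities satisfied by the estimator matrix. -/
lemma estimator_identities (h : WhiteChannel P m 𝓢 𝓤 u R) :
    ∀ᵐ ω ∂P, estimator P m R ω * obsCov P m R ω * (estimator P m R ω)ᴴ
        = 1 - (precision P m R ω)⁻¹ ∧
      estimator P m R ω * meanGain P m R ω = 1 - (precision P m R ω)⁻¹ ∧
      (meanGain P m R ω)ᴴ * (estimator P m R ω)ᴴ = 1 - (precision P m R ω)⁻¹ := by
  filter_upwards [h.effNoise_posSemidef] with ω h1
  by_cases hdet : (effNoise P m R ω).det = 0
  -- On the singular set the matrix inverse is `0` by convention, hence the precision is `1`, the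
  -- estimator is `0`, and all three identities read `0 = 0`.
  · have hinv : (effNoise P m R ω)⁻¹ = 0 := nonsing_inv_apply_not_isUnit _ (by simp [hdet])
    simp [estimator, hdet, precision, hinv]
  · have hpd := h1.posDef_iff_det_ne_zero.2 hdet
    have hC : obsCov P m R ω
        = effNoise P m R ω + meanGain P m R ω * (meanGain P m R ω)ᴴ := by simp [effNoise]
    have hCpd : (obsCov P m R ω).PosDef := by
      rw [hC]; exact hpd.add_posSemidef (posSemidef_self_mul_conjTranspose _)
    have hQ : 1 - (precision P m R ω)⁻¹
        = (meanGain P m R ω)ᴴ * (obsCov P m R ω)⁻¹ * meanGain P m R ω := by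
      rw [precision, ← one_sub_conj_inv_eq hpd, hC]; simp
    have hinv : (obsCov P m R ω)⁻¹ * obsCov P m R ω = 1 :=
      nonsing_inv_mul _ ((isUnit_iff_isUnit_det _).1 hCpd.isUnit)
    have hH : ((meanGain P m R ω)ᴴ * (obsCov P m R ω)⁻¹)ᴴ
        = (obsCov P m R ω)⁻¹ * meanGain P m R ω := by
      rw [conjTranspose_mul, conjTranspose_conjTranspose, hCpd.inv.1.eq]
    simp only [estimator, hdet, if_false, hH, hQ]
    refine ⟨?_, trivial, ?_⟩
    · rw [Matrix.mul_assoc _ (obsCov P m R ω)⁻¹, hinv, Matrix.mul_one, Matrix.mul_assoc]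
    · rw [Matrix.mul_assoc]

end Positivity

end WhiteChannel

end WhiteChannel

/-! ### Error covariance, mean log-likelihood ratio and integrability of the log-determinant -/

namespace WhiteChannel

set_option linter.unusedSectionVars false

variable {Ω : Type*} {m 𝓢 𝓤 mΩ : MeasurableSpace Ω} {P : Measure Ω} {k : ℕ} {η : Type*}
  [DecidableEq η] [Fintype η] {u : Ω → Fin k ⊕ η → ℂ} {R : Ω → Matrix (Fin k) (Fin k ⊕ η) ℂ}
  [IsProbabilityMeasure P]

open scoped ComplexOrder

lemma mulVec_mul_star_mulVec (A : Matrix (Fin k) (Fin k) ℂ) (v : Fin k → ℂ) (i j : Fin k) :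
    (A *ᵥ v) i * star ((A *ᵥ v) j)
      = ∑ q : Fin k × Fin k, (A i q.1 * star (A j q.2)) * (v q.1 * star (v q.2)) := by
  simp only [mulVec, dotProduct, star_sum, star_mul', Finset.sum_mul_sum, Fintype.sum_prod_type]
  exact Finset.sum_congr rfl fun a _ => Finset.sum_congr rfl fun b _ => by ring

lemma mul_mul_conjTranspose_apply (A B : Matrix (Fin k) (Fin k) ℂ) (i j : Fin k) :
    (A * B * Aᴴ) i j = ∑ q : Fin k × Fin k, (A i q.1 * star (A j q.2)) * B q.1 q.2 := by
  simp only [mul_apply, conjTranspose_apply, Finset.sum_mul, Fintype.sum_prod_type]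
  rw [Finset.sum_comm]
  exact Finset.sum_congr rfl fun a _ => Finset.sum_congr rfl fun b _ => by ring

/-- Both `Q⁻¹` and `1 - Q⁻¹ = M C Mᴴ` are positive semidefinite, so the diagonal entry lies in `[0,
1]`. It is the conditional power of one coordinate of the estimate, bounded by the power of the
signal. -/
lemma norm_diag_one_sub_inv_precision_le (h : WhiteChannel P m 𝓢 𝓤 u R) (i : Fin k) :
    ∀ᵐ ω ∂P, ‖(1 - (precision P m R ω)⁻¹) i i‖ ≤ 1 := by
  have hX := condExpMat_posSemidef (m := m) h.integrable_matrix_mul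
    (.of_forall fun ω => posSemidef_self_mul_conjTranspose _)
  filter_upwards [h.precision_posDef, h.estimator_identities, hX] with ω h1 h2 h3
  have hnn : 0 ≤ (1 - (precision P m R ω)⁻¹) i i := by
    rw [← h2.1]
    exact (h3.mul_mul_conjTranspose_same _).diag_nonneg
  have hinv : 0 ≤ (precision P m R ω)⁻¹ i i := h1.inv.posSemidef.diag_nonneg
  rw [Matrix.sub_apply, one_apply_eq] at hnn ⊢
  obtain ⟨a1, a2⟩ := Complex.nonneg_iff.1 hnn
  obtain ⟨b1, b2⟩ := Complex.nonneg_iff.1 hinv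
  have : 1 - (precision P m R ω)⁻¹ i i = ((1 - ((precision P m R ω)⁻¹ i i).re : ℝ) : ℂ) := by
    apply Complex.ext <;> simp [← b2]
  rw [this, Complex.norm_real, Real.norm_eq_abs, abs_le]
  simp only [Complex.sub_re, Complex.one_re] at a1
  constructor <;> linarith

/-- The estimator matrix may be unbounded, so square integrability does not follow from that of `y`.
The squared modulus is nonnegative and its formal conditional expectation is at most one, which
suffices by `integrable_sum_mul_of_nonneg`. -/
lemma memLp_estimate (h : WhiteChannel P m 𝓢 𝓤 u R) (i : Fin k) :
    MemLp (fun ω => (estimator P m R ω *ᵥ (R ω *ᵥ u ω)) i) 2 P := by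
  have hM : ∀ i j, Measurable[m] fun ω => estimator P m R ω i j := entryMeasurable_estimator R
  have hMs : ∀ i j, Measurable[m] fun ω => star (estimator P m R ω i j) := fun i j =>
    Complex.continuous_conj.measurable.comp (hM i j)
  refine memLp_two_of_integrable_mul_star (Measurable.aestronglyMeasurable ?_) ?_
  · simp only [mulVec, dotProduct]
    exact Finset.measurable_fun_sum _ fun a _ => ((hM i a).mono h.side_le' le_rfl).mul
      (h.measurable_obs a)
  have hpos : ∀ ω, 0 ≤ (estimator P m R ω *ᵥ (R ω *ᵥ u ω)) i *
      star ((estimator P m R ω *ᵥ (R ω *ᵥ u ω)) i) := fun ω => mul_star_self_nonneg _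
  simp only [mulVec_mul_star_mulVec] at hpos ⊢
  refine integrable_sum_mul_of_nonneg h.side_le'
    (fun q => ((hM i q.1).mul (hMs i q.2)).stronglyMeasurable)
    (fun q => (h.condExp_obs_mul_star q.1 q.2).1) (.of_forall hpos) ?_
  have heq : (fun ω => ∑ q : Fin k × Fin k, ((fun ω => estimator P m R ω i q.1) *
      fun ω => star (estimator P m R ω i q.2)) ω *
      (P[fun ω => (R ω *ᵥ u ω) q.1 * star ((R ω *ᵥ u ω) q.2) | m]) ω)
      =ᵐ[P] fun ω => (1 - (precision P m R ω)⁻¹) i i := by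
    filter_upwards [ae_all_iff.2 fun q : Fin k × Fin k => (h.condExp_obs_mul_star q.1 q.2).2,
      h.estimator_identities] with ω h1 h2
    rw [← h2.1, mul_mul_conjTranspose_apply]
    exact Finset.sum_congr rfl fun q _ => by rw [h1 q]; rfl
  refine Integrable.congr ?_ heq.symm
  refine Integrable.of_bound (C := 1) ?_ (h.norm_diag_one_sub_inv_precision_le i)
  exact ((((EntryMeasurable.const (m := m) (1 : Matrix (Fin k) (Fin k) ℂ)).sub
    (entryMeasurable_precision (P := P) R).inv) i i).mono h.side_le' le_rfl).aestronglyMeasurable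

lemma memLp_error (h : WhiteChannel P m 𝓢 𝓤 u R) (i : Fin k) :
    MemLp (fun ω => u ω (.inl i) - (estimator P m R ω *ᵥ (R ω *ᵥ u ω)) i) 2 P :=
  (h.source_memLp (.inl i)).sub (h.memLp_estimate i)

/-- The conditional error covariance of the linear MMSE estimate. -/
lemma condExp_error_mul_star (h : WhiteChannel P m 𝓢 𝓤 u R) (i j : Fin k) :
    P[fun ω => (u ω (.inl i) - (estimator P m R ω *ᵥ (R ω *ᵥ u ω)) i) *
        star (u ω (.inl j) - (estimator P m R ω *ᵥ (R ω *ᵥ u ω)) j) | m]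
      =ᵐ[P] fun ω => (precision P m R ω)⁻¹ i j := by
  have hM : ∀ i j, Measurable[m] fun ω => estimator P m R ω i j := entryMeasurable_estimator R
  have hMs : ∀ i j, Measurable[m] fun ω => star (estimator P m R ω i j) := fun i j =>
    Complex.continuous_conj.measurable.comp (hM i j)
  have ixc := fun i j => integrable_mul_star (h.source_memLp (.inl i)) (h.memLp_estimate j)
  have icx := fun i j => integrable_mul_star (h.memLp_estimate i) (h.source_memLp (.inl j))
  have icc := fun i j => integrable_mul_star (h.memLp_estimate i) (h.memLp_estimate j)
  have ixx := fun i j : Fin k =>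
    integrable_mul_star (h.source_memLp (.inl i)) (h.source_memLp (.inl j))
  have exc : ∀ i j, P[fun ω => u ω (.inl i) *
      star ((estimator P m R ω *ᵥ (R ω *ᵥ u ω)) j) | m] =ᵐ[P]
      fun ω => ((meanGain P m R ω)ᴴ * (estimator P m R ω)ᴴ) i j := by
    intro i j
    have hexp : (fun ω => u ω (.inl i) * star ((estimator P m R ω *ᵥ (R ω *ᵥ u ω)) j))
        = fun ω => ∑ l, star (estimator P m R ω j l) *
          (u ω (.inl i) * star ((R ω *ᵥ u ω) l)) := by
      ext ω
      conv_lhs => rw [mulVec, dotProduct, star_sum, Finset.mul_sum]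
      exact Finset.sum_congr rfl fun l _ => by rw [star_mul']; ring
    have hi := ixc i j
    rw [hexp] at hi ⊢
    filter_upwards [condExp_sum_mul (m := m) (fun l => (hMs j l).stronglyMeasurable)
      (fun l => integrable_mul_star (h.source_memLp (.inl i)) (h.memLp_obs l)) hi,
      ae_all_iff.2 fun l => h.condExp_signal_mul_star_obs i l] with ω h1 h2
    rw [h1, mul_apply]
    exact Finset.sum_congr rfl fun l _ => by rw [h2 l, mul_comm]; rfl
  have ecx : P[fun ω => (estimator P m R ω *ᵥ (R ω *ᵥ u ω)) i * star (u ω (.inl j)) | m] =ᵐ[P]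
      fun ω => (estimator P m R ω * meanGain P m R ω) i j := by
    have hstar : (fun ω => (estimator P m R ω *ᵥ (R ω *ᵥ u ω)) i * star (u ω (.inl j)))
        = fun ω => star (u ω (.inl j) * star ((estimator P m R ω *ᵥ (R ω *ᵥ u ω)) i)) := by
      ext ω; simp [mul_comm]
    rw [hstar]
    filter_upwards [condExp_star (m := m) (ixc j i), exc j i] with ω h1 h2
    rw [h1, h2, ← conjTranspose_apply, conjTranspose_mul, conjTranspose_conjTranspose,
      conjTranspose_conjTranspose]
  have ecc : P[fun ω => (estimator P m R ω *ᵥ (R ω *ᵥ u ω)) i *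
      star ((estimator P m R ω *ᵥ (R ω *ᵥ u ω)) j) | m] =ᵐ[P]
      fun ω => (estimator P m R ω * obsCov P m R ω * (estimator P m R ω)ᴴ) i j := by
    have hi := icc i j
    simp only [mulVec_mul_star_mulVec] at hi ⊢
    filter_upwards [condExp_sum_mul (m := m)
      (fun q : Fin k × Fin k => ((hM i q.1).mul (hMs j q.2)).stronglyMeasurable)
      (fun q => (h.condExp_obs_mul_star q.1 q.2).1) hi,
      ae_all_iff.2 fun q : Fin k × Fin k => (h.condExp_obs_mul_star q.1 q.2).2] with ω h1 h2
    rw [mul_mul_conjTranspose_apply]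
    refine h1.trans (Finset.sum_congr rfl fun q _ => ?_)
    rw [h2 q]; rfl
  have hexp : (fun ω => (u ω (.inl i) - (estimator P m R ω *ᵥ (R ω *ᵥ u ω)) i) *
        star (u ω (.inl j) - (estimator P m R ω *ᵥ (R ω *ᵥ u ω)) j))
      = ((fun ω => u ω (.inl i) * star (u ω (.inl j)))
        - (fun ω => u ω (.inl i) * star ((estimator P m R ω *ᵥ (R ω *ᵥ u ω)) j)))
        - ((fun ω => (estimator P m R ω *ᵥ (R ω *ᵥ u ω)) i * star (u ω (.inl j)))
        - (fun ω => (estimator P m R ω *ᵥ (R ω *ᵥ u ω)) i *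
            star ((estimator P m R ω *ᵥ (R ω *ᵥ u ω)) j))) := by
    ext ω; simp only [Pi.sub_apply, star_sub]; ring
  rw [hexp]
  filter_upwards [condExp_sub ((ixx i j).sub (ixc i j)) ((icx i j).sub (icc i j)) m,
    condExp_sub (ixx i j) (ixc i j) m, condExp_sub (icx i j) (icc i j) m, exc i j, ecx, ecc,
    h.condExp_signal_mul_star_signal i j, h.estimator_identities]
    with ω h1 h2 h3 h4 h5 h6 h7 h8
  -- The two cross terms and the second moment of the estimate all equal `1 - Q⁻¹`, so `1 - 2 (1 -
  -- Q⁻¹) + (1 - Q⁻¹) = Q⁻¹` remains.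
  rw [h1, Pi.sub_apply, h2, h3, Pi.sub_apply, Pi.sub_apply, h4, h5, h6, h7, h8.1, h8.2.1, h8.2.2]
  simp

/-- The mean log-likelihood ratio of the Gaussian posterior with the linear MMSE estimate as its
mean. -/
lemma integral_posteriorLogRatio (h : WhiteChannel P m 𝓢 𝓤 u R)
    (hlog : Integrable (fun ω => Real.log (precision P m R ω).det.re) P) :
    Integrable (fun ω => posteriorLogRatio (precision P m R ω)
      (estimator P m R ω *ᵥ (R ω *ᵥ u ω)) (fun i => u ω (.inl i))) P ∧
    ∫ ω, posteriorLogRatio (precision P m R ω)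
      (estimator P m R ω *ᵥ (R ω *ᵥ u ω)) (fun i => u ω (.inl i)) ∂P
      = ∫ ω, Real.log (precision P m R ω).det.re ∂P := by
  let e : Ω → Fin k → ℂ := fun ω => (fun i => u ω (.inl i)) - estimator P m R ω *ᵥ (R ω *ᵥ u ω)
  have hquad : ∀ ω, star (e ω) ⬝ᵥ (precision P m R ω *ᵥ e ω)
      = ∑ q : Fin k × Fin k, precision P m R ω q.1 q.2 * (e ω q.2 * star (e ω q.1)) := by
    intro ω
    simp only [dotProduct, mulVec, Pi.star_apply, Finset.mul_sum, Fintype.sum_prod_type]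
    exact Finset.sum_congr rfl fun i _ => Finset.sum_congr rfl fun j _ => by ring
  have hQ : ∀ q : Fin k × Fin k, StronglyMeasurable[m] fun ω => precision P m R ω q.1 q.2 :=
    fun q => (entryMeasurable_precision R q.1 q.2).stronglyMeasurable
  have he : ∀ q : Fin k × Fin k, Integrable (fun ω => e ω q.2 * star (e ω q.1)) P := fun q =>
    integrable_mul_star (h.memLp_error q.2) (h.memLp_error q.1)
  -- The conditional mean of `εᴴ Q ε` is `tr (Q Q⁻¹) = k`; it later cancels against `E‖x‖² = k`.
  have hformal : (fun ω => ∑ q : Fin k × Fin k, precision P m R ω q.1 q.2 *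
      (P[fun ω => e ω q.2 * star (e ω q.1) | m]) ω) =ᵐ[P] fun _ => (k : ℂ) := by
    filter_upwards [h.precision_posDef,
      ae_all_iff.2 fun q : Fin k × Fin k => h.condExp_error_mul_star q.2 q.1] with ω h1 h2
    have h3 : (precision P m R ω * (precision P m R ω)⁻¹).trace = k := by
      rw [mul_nonsing_inv _ ((isUnit_iff_isUnit_det _).1 h1.isUnit)]; simp
    rw [← h3]
    simp only [trace, diag_apply, mul_apply, Fintype.sum_prod_type]
    exact Finset.sum_congr rfl fun i _ => Finset.sum_congr rfl fun j _ =>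
      congrArg _ (h2 (i, j))
  have hint : Integrable (fun ω => star (e ω) ⬝ᵥ (precision P m R ω *ᵥ e ω)) P := by
    have hpos : ∀ᵐ ω ∂P, 0 ≤ star (e ω) ⬝ᵥ (precision P m R ω *ᵥ e ω) :=
      h.precision_posDef.mono fun ω h => h.posSemidef.dotProduct_mulVec_nonneg _
    simp only [hquad] at hpos ⊢
    exact integrable_sum_mul_of_nonneg h.side_le' hQ he hpos
      ((integrable_const (k : ℂ)).congr hformal.symm)
  have hval : ∫ ω, star (e ω) ⬝ᵥ (precision P m R ω *ᵥ e ω) ∂P = k := by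
    simp only [hquad] at hint ⊢
    rw [← integral_condExp h.side_le',
      integral_congr_ae ((condExp_sum_mul (m := m) hQ he hint).trans hformal)]
    simp
  have hx : ∀ i : Fin k, Integrable (fun ω => ‖u ω (.inl i)‖ ^ 2) P := fun i =>
    (memLp_two_iff_integrable_sq_norm (h.source_memLp (.inl i)).1).1 (h.source_memLp (.inl i))
  have hx1 : ∀ i : Fin k, ∫ ω, ‖u ω (.inl i)‖ ^ 2 ∂P = 1 := by
    intro i
    have h1 := h.source_white (.inl i) (.inl i)
    rw [if_pos rfl] at h1
    have h2 : (fun ω => u ω (.inl i) * star (u ω (.inl i)))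
        = fun ω => ((‖u ω (.inl i)‖ ^ 2 : ℝ) : ℂ) := by
      ext ω
      rw [Complex.star_def, Complex.mul_conj, Complex.normSq_eq_norm_sq]
    rw [h2, integral_complex_ofReal] at h1
    exact_mod_cast h1
  have hre : ∫ ω, (star (e ω) ⬝ᵥ (precision P m R ω *ᵥ e ω)).re ∂P = k := by
    have := integral_re hint
    rw [hval] at this
    simpa using this
  have hsum : Integrable (fun ω => ∑ i : Fin k, ‖u ω (.inl i)‖ ^ 2) P :=
    integrable_finsetSum _ fun i _ => hx i
  have hre' : Integrable (fun ω => (star (e ω) ⬝ᵥ (precision P m R ω *ᵥ e ω)).re) P := hint.re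
  refine ⟨(hlog.sub hre').add hsum, ?_⟩
  have heq : (fun ω => posteriorLogRatio (precision P m R ω)
      (estimator P m R ω *ᵥ (R ω *ᵥ u ω)) (fun i => u ω (.inl i)))
      = fun ω => Real.log (precision P m R ω).det.re
        - (star (e ω) ⬝ᵥ (precision P m R ω *ᵥ e ω)).re + ∑ i : Fin k, ‖u ω (.inl i)‖ ^ 2 := rfl
  have hadd := integral_add (hlog.sub hre') hsum
  simp only [Pi.sub_apply] at hadd
  rw [heq, hadd, integral_sub hlog hre', hre,
    integral_finsetSum _ fun i _ => hx i]
  simp [hx1]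

/-- Integrability of the log-determinant, for a signal part that factors through a part of the
noise. -/
lemma integrable_log_det_precision (h : WhiteChannel P m 𝓢 𝓤 u R) {κ : Type*} [Fintype κ]
    {L : Ω → Matrix (Fin k) κ ℂ} {B : Ω → Matrix κ (Fin k) ℂ}
    (hL : ∀ i a, MemLp (fun ω => L ω i a) 2 P) (hB : ∀ a i, MemLp (fun ω => B ω a i) 2 P)
    (hLB : ∀ ω, (R ω).toCols₁ = L ω * B ω)
    (hnoise : ∀ ω, ((R ω).toCols₂ * ((R ω).toCols₂)ᴴ - L ω * (L ω)ᴴ).PosSemidef) :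
    Integrable (fun ω => Real.log (precision P m R ω).det.re) P := by
  have hLL : ∀ i j, Integrable (fun ω => (L ω * (L ω)ᴴ) i j) P := by
    intro i j
    simp only [mul_apply, conjTranspose_apply]
    exact integrable_finsetSum _ fun a _ => integrable_mul_star (hL i a) (hL j a)
  have hBB : ∀ i j, Integrable (fun ω => ((B ω)ᴴ * B ω) i j) P := by
    intro i j
    simp only [mul_apply, conjTranspose_apply]
    exact integrable_finsetSum _ fun a _ => by
      simpa only [mul_comm] using integrable_mul_star (hB a j) (hB a i)
  have hNN : ∀ i j, Integrable (fun ω => ((R ω).toCols₂ * ((R ω).toCols₂)ᴴ) i j) P := by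
    intro i j
    simp only [mul_apply, conjTranspose_apply]
    exact integrable_finsetSum _ fun a _ =>
      integrable_mul_star (h.matrix_memLp i (.inr a)) (h.matrix_memLp j (.inr a))
  have hX : ∀ a b, Integrable (fun ω => (fromBlocks (L ω * (L ω)ᴴ) (R ω).toCols₁
      ((R ω).toCols₁)ᴴ ((B ω)ᴴ * B ω)) a b) P := by
    rintro (i | i) (j | j)
    · exact hLL i j
    · exact h.memLp_toCols i j
    · exact (h.matrix_memLp j (.inl i)).star.integrable one_le_two
    · exact hBB i j
  -- Gram matrix of `L` stacked on `Bᴴ`; its off-diagonal block is `L B = R₁`, whose conditional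
  -- expectation is the mean gain.
  have h1 := condExpMat_posSemidef (m := m) hX (.of_forall fun ω => by
    have : fromBlocks (L ω * (L ω)ᴴ) (R ω).toCols₁ ((R ω).toCols₁)ᴴ ((B ω)ᴴ * B ω)
        = fromRows (L ω) (B ω)ᴴ * (fromRows (L ω) (B ω)ᴴ)ᴴ := by
      rw [conjTranspose_fromRows_eq_fromCols_conjTranspose, fromRows_mul_fromCols, hLB,
        conjTranspose_conjTranspose, conjTranspose_mul]
    rw [this]
    exact posSemidef_self_mul_conjTranspose _)
  have h2 := condExpMat_posSemidef (m := m) (P := P)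
    (X := fun ω => (R ω).toCols₂ * ((R ω).toCols₂)ᴴ - L ω * (L ω)ᴴ)
    (fun i j => (hNN i j).sub (hLL i j)) (.of_forall hnoise)
  have h3 : ∀ᵐ ω ∂P, condExpMat P m (fun ω => (R ω).toCols₂ * ((R ω).toCols₂)ᴴ - L ω * (L ω)ᴴ) ω
      = condExpMat P m (fun ω => (R ω).toCols₂ * ((R ω).toCols₂)ᴴ) ω
        - condExpMat P m (fun ω => L ω * (L ω)ᴴ) ω := by
    filter_upwards [ae_all_iff.2 fun i => ae_all_iff.2 fun j =>
      condExp_sub (hNN i j) (hLL i j) m] with ω hω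
    ext i j
    exact hω i j
  -- Since `Ψ` dominates the conditional noise covariance and hence `E{L Lᴴ|m}`, Cauchy-Schwarz
  -- gives `Eᴴ Ψ⁻¹ E ≤ E{Bᴴ B|m}`. With `log det Q ≤ tr Q - k` this leaves an integrable bound free
  -- of `Ψ⁻¹`.
  have hupper : ∀ᵐ ω ∂P, Real.log (precision P m R ω).det.re
      ≤ (condExpMat P m (fun ω => (B ω)ᴴ * B ω) ω).trace.re := by
    filter_upwards [h1, h2, h3, h.effNoise_sub_posSemidef, h.effNoise_posSemidef,
      h.precision_posDef, condExpMat_conjTranspose (m := m) h.memLp_toCols,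
      condExpMat_posSemidef (m := m) hBB (.of_forall fun ω =>
        posSemidef_conjTranspose_mul_self (B ω))] with ω h1 h2 h3 h4 h5 h6 h7 h8
    by_cases hdet : (effNoise P m R ω).det = 0
    · have hinv : (effNoise P m R ω)⁻¹ = 0 := nonsing_inv_apply_not_isUnit _ (by simp [hdet])
      simpa [precision, hinv] using (Complex.nonneg_iff.1 h8.trace_nonneg).1
    · have hpd := h5.posDef_iff_det_ne_zero.2 hdet
      have hblk : condExpMat P m (fun ω => fromBlocks (L ω * (L ω)ᴴ) (R ω).toCols₁
          ((R ω).toCols₁)ᴴ ((B ω)ᴴ * B ω)) ω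
          = fromBlocks (condExpMat P m (fun ω => L ω * (L ω)ᴴ) ω)
            (meanGain P m R ω) (meanGain P m R ω)ᴴ
            (condExpMat P m (fun ω => (B ω)ᴴ * B ω) ω) := by
        ext (i | i) (j | j)
        · rfl
        · rfl
        · exact congr_fun (congr_fun h7 i) j
        · rfl
      rw [hblk] at h1
      rw [h3] at h2
      have h9 := posSemidef_sub_conj_inv hpd (by simpa using h4.add h2) h1
      refine (log_det_le_trace h6).trans ?_
      have := trace_re_le_of_posSemidef_sub h9
      simpa [precision, trace_add] using this
  -- Here `log det Q ≥ k - tr Q⁻¹`, and `Q⁻¹ ≤ 1`.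
  have hlower : ∀ᵐ ω ∂P, 0 ≤ Real.log (precision P m R ω).det.re := by
    have hC := condExpMat_posSemidef (m := m) h.integrable_matrix_mul
      (.of_forall fun ω => posSemidef_self_mul_conjTranspose _)
    filter_upwards [h.precision_posDef, h.estimator_identities, hC] with ω h1 h2 h3
    refine le_trans ?_ (le_log_det h1)
    have h4 := (h3.mul_mul_conjTranspose_same (estimator P m R ω))
    have h5 : (1 - (precision P m R ω)⁻¹).PosSemidef := h2.1 ▸ h4
    have := trace_re_le_of_posSemidef_sub h5
    simp only [trace_one, Fintype.card_fin, Complex.natCast_re] at this ⊢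
    linarith
  have htr : Integrable (fun ω => (condExpMat P m (fun ω => (B ω)ᴴ * B ω) ω).trace.re) P := by
    simp only [trace, diag_apply, Complex.re_sum]
    exact integrable_finsetSum _ fun i _ =>
      (integrable_condExp (m := m) (f := fun ω => ((B ω)ᴴ * B ω) i i)).re
  refine htr.mono' ?_ ?_
  · have := (entryMeasurable_precision (P := P) (m := m) R).det
    exact (Real.measurable_log.comp (Complex.measurable_re.comp
      (this.mono h.side_le' le_rfl))).aestronglyMeasurable
  · filter_upwards [hupper, hlower] with ω h1 h2
    rwa [Real.norm_of_nonneg h2]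

end WhiteChannel

/-! ### MMSE detection and achievable rates with side information -/

namespace WhiteChannel

set_option linter.unusedSectionVars false

variable {Ω T : Type*} {𝓢 𝓤 : MeasurableSpace Ω} [mΩ : MeasurableSpace Ω]
  [mT : MeasurableSpace T] {P : Measure Ω}
  [IsProbabilityMeasure P] {k : ℕ} {η : Type*} [DecidableEq η] [Fintype η]
  {Θ : Ω → T} {u : Ω → Fin k ⊕ η → ℂ}
  {R : Ω → Matrix (Fin k) (Fin k ⊕ η) ℂ} {x y : Ω → Fin k → ℂ}

/-- Restricted to invertible effective noise because elsewhere the two may differ: the MMSE estimate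
inverts the observation covariance, which can be invertible although the effective noise is not,
whereas `estimator` is zero there. -/
lemma mmseEstimate_eq (h : WhiteChannel P (mT.comap Θ) 𝓢 𝓤 u R)
    (hx : ∀ ω i, x ω i = u ω (.inl i)) (hy : ∀ ω, y ω = R ω *ᵥ u ω) :
    ∀ᵐ ω ∂P, (effNoise P (mT.comap Θ) R ω).det ≠ 0 →
      mmseEstimate P Θ x y ω = estimator P (mT.comap Θ) R ω *ᵥ y ω := by
  filter_upwards [ae_all_iff.2 fun i => ae_all_iff.2 (h.condExp_signal_mul_star_obs i),
    ae_all_iff.2 fun i => ae_all_iff.2 fun j => (h.condExp_obs_mul_star i j).2] with ω h1 h2 hdet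
  have e1 : condMat P Θ (fun ω' => outer (x ω') (y ω')) ω
      = (meanGain P (mT.comap Θ) R ω)ᴴ := by
    ext i j
    rw [← h1 i j]
    simp only [condMat, outer, vecMulVec_apply, Pi.star_apply, of_apply, hx, hy]
  have e2 : condMat P Θ (fun ω' => outer (y ω') (y ω')) ω = obsCov P (mT.comap Θ) R ω := by
    ext i j
    rw [← h2 i j]
    simp only [condMat, outer, vecMulVec_apply, Pi.star_apply, of_apply, hy]
  simp only [mmseEstimate, estimator, hdet, if_false, e1, e2]

lemma mmseErrorCov_eq (h : WhiteChannel P (mT.comap Θ) 𝓢 𝓤 u R)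
    (hx : ∀ ω i, x ω i = u ω (.inl i)) (hy : ∀ ω, y ω = R ω *ᵥ u ω)
    (hdet : ∀ᵐ ω ∂P, (effNoise P (mT.comap Θ) R ω).det ≠ 0) :
    mmseErrorCov P Θ x y =ᵐ[P] fun ω => (precision P (mT.comap Θ) R ω)⁻¹ := by
  have hcongr : ∀ i j, P[fun ω => outer (x ω - mmseEstimate P Θ x y ω)
      (x ω - mmseEstimate P Θ x y ω) i j | mT.comap Θ] =ᵐ[P]
      fun ω => (precision P (mT.comap Θ) R ω)⁻¹ i j := by
    intro i j
    refine (condExp_congr_ae ?_).trans (h.condExp_error_mul_star i j)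
    filter_upwards [h.mmseEstimate_eq hx hy, hdet] with ω h1 h2
    rw [h1 h2, hy ω]
    simp [outer, vecMulVec_apply, hx]
  filter_upwards [ae_all_iff.2 fun i => ae_all_iff.2 (hcongr i)] with ω hω
  ext i j
  exact hω i j

open scoped ComplexOrder in
lemma logb_two_pi_exp_sub (c : ℝ) (hc : 0 < c) {Q : Matrix (Fin k) (Fin k) ℂ} (hQ : Q.PosDef) :
    log2det (((c : ℝ) : ℂ) • (1 : Matrix (Fin k) (Fin k) ℂ)) - log2det (((c : ℝ) : ℂ) • Q⁻¹)
      = log2det Q := by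
  have h1 : ∀ X : Matrix (Fin k) (Fin k) ℂ, (((c : ℝ) : ℂ) • X).det.re = c ^ k * X.det.re := by
    intro X
    rw [det_smul, Fintype.card_fin, ← Complex.ofReal_pow, Complex.re_ofReal_mul]
  have hd := det_re_pos hQ
  unfold log2det
  rw [h1, h1, det_inv_re hQ, det_one, Complex.one_re, mul_one,
    Real.logb_mul (by positivity) (by positivity), Real.logb_inv]
  ring

/-- The SE under MMSE detection in terms of the precision matrix. -/
lemma mmseSE_eq (h : WhiteChannel P (mT.comap Θ) 𝓢 𝓤 u R)
    (hx : ∀ ω i, x ω i = u ω (.inl i)) (hy : ∀ ω, y ω = R ω *ᵥ u ω)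
    (hdet : ∀ᵐ ω ∂P, (effNoise P (mT.comap Θ) R ω).det ≠ 0) (f : ℝ) :
    mmseSE P f Θ x y = f * ∫ ω, log2det (precision P (mT.comap Θ) R ω) ∂P := by
  unfold mmseSE
  congr 1
  refine integral_congr_ae ?_
  filter_upwards [h.mmseErrorCov_eq hx hy hdet, h.precision_posDef] with ω h1 h2
  rw [h1]
  exact logb_two_pi_exp_sub _ (by positivity) h2

/-- A lower bound on the mutual information for every observation from which the side information
and the linear MMSE estimate can be recovered. -/
lemma isAchievableSE_of_recoverable (h : WhiteChannel P (mT.comap Θ) 𝓢 𝓤 u R)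
    (hx : ∀ ω i, x ω i = u ω (.inl i)) (hxm : Measurable x) (hlaw : P.map x = stdCNVec k)
    (hlog : Integrable (fun ω => Real.log (precision P (mT.comap Θ) R ω).det.re) P)
    {f : ℝ} (hf : 0 ≤ f) {𝒰 : Type*} [MeasurableSpace 𝒰] {U : Ω → 𝒰} (hU : Measurable U)
    {t : 𝒰 → T} (ht : Measurable t) (htU : ∀ ω, t (U ω) = Θ ω) {c : 𝒰 → Fin k → ℂ}
    (hc : Measurable c)
    (hcU : ∀ᵐ ω ∂P, c (U ω) = estimator P (mT.comap Θ) R ω *ᵥ (R ω *ᵥ u ω)) :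
    IsAchievableSE f (mutualInfo P x U)
      (f * ∫ ω, log2det (precision P (mT.comap Θ) R ω) ∂P) := by
  -- The auxiliary posterior must be a function of the observation `U` alone; its precision is one
  -- because it is a function of `Θ`, and its mean by `hcU`.
  obtain ⟨Q, hQm, hQ⟩ :=
    (entryMeasurable_precision (P := P) (m := mT.comap Θ) R).exists_eq_comp
  have hQU : ∀ ω, Q (t (U ω)) = precision P (mT.comap Θ) R ω := fun ω => by rw [htU, hQ]; rfl
  obtain ⟨hi, hv⟩ := h.integral_posteriorLogRatio hlog
  have heq : (fun ω => posteriorLogRatio (precision P (mT.comap Θ) R ω)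
      (estimator P (mT.comap Θ) R ω *ᵥ (R ω *ᵥ u ω)) (fun i => u ω (.inl i)))
      =ᵐ[P] fun ω => posteriorLogRatio (Q (t (U ω))) (c (U ω)) (x ω) := by
    filter_upwards [hcU] with ω hω
    rw [hQU, hω]
    congr 1
    ext i
    exact (hx ω i).symm
  have hkl := ofReal_integral_le_klDiv_prod hxm hlaw hU (Q := fun v => Q (t v))
    (fun i j => (hQm i j).comp ht) hc
    (h.precision_posDef.mono fun ω hω => by rw [hQU]; exact hω) (hi.congr heq)
  rw [← integral_congr_ae heq, hv] at hkl
  unfold IsAchievableSE mutualInfo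
  rw [ENNReal.ofReal_mul hf]
  gcongr
  have hlog2 : 0 < Real.log 2 := Real.log_pos one_lt_two
  have hint : ∫ ω, log2det (precision P (mT.comap Θ) R ω) ∂P
      = (∫ ω, Real.log (precision P (mT.comap Θ) R ω).det.re ∂P) / Real.log 2 := by
    simp only [log2det, Real.logb]
    exact integral_div _ _
  rw [hint, ENNReal.ofReal_div_of_pos hlog2]
  gcongr

lemma measurable_mulVec {S : Type*} [MeasurableSpace S] {A : S → Matrix (Fin k) (Fin k) ℂ}
    (hA : EntryMeasurable inferInstance A) {v : S → Fin k → ℂ} (hv : Measurable v) :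
    Measurable fun s => A s *ᵥ v s := by
  refine measurable_pi_iff.2 fun i => ?_
  simp only [mulVec, dotProduct]
  exact Finset.measurable_fun_sum _ fun j _ => (hA i j).mul ((measurable_pi_apply j).comp hv)

lemma measurable_mmseEstimate (hΘ : Measurable Θ) (hym : Measurable y) :
    Measurable (mmseEstimate P Θ x y) := by
  have hc : ∀ X : Ω → Matrix (Fin k) (Fin k) ℂ, EntryMeasurable mΩ (condMat P Θ X) := fun X i j =>
    (EntryMeasurable.condExpMat (m := mT.comap Θ) P X i j).mono hΘ.comap_le le_rfl
  exact measurable_mulVec ((hc _).mul (hc _).inv) hym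

lemma measurable_obs_vec (h : WhiteChannel P (mT.comap Θ) 𝓢 𝓤 u R)
    (hy : ∀ ω, y ω = R ω *ᵥ u ω) : Measurable y := by
  refine measurable_pi_iff.2 fun i => ?_
  simp only [hy]
  exact h.measurable_obs i

open scoped Classical in
lemma isAchievableSE_estimate (h : WhiteChannel P (mT.comap Θ) 𝓢 𝓤 u R) (hΘ : Measurable Θ)
    (hx : ∀ ω i, x ω i = u ω (.inl i)) (hy : ∀ ω, y ω = R ω *ᵥ u ω) (hxm : Measurable x)
    (hlaw : P.map x = stdCNVec k)
    (hlog : Integrable (fun ω => Real.log (precision P (mT.comap Θ) R ω).det.re) P)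
    {f : ℝ} (hf : 0 ≤ f) :
    IsAchievableSE f (mutualInfo P x fun ω => (mmseEstimate P Θ x y ω, Θ ω))
      (f * ∫ ω, log2det (precision P (mT.comap Θ) R ω) ∂P) := by
  -- The singular set is an event of the side information, so from `(x̂, Θ)` the value `x̂` can be
  -- replaced by `0` exactly where `estimator` vanishes.
  obtain ⟨s, hs, hsΘ⟩ := measurableSet_singular (P := P) (m := mT.comap Θ) R
  refine h.isAchievableSE_of_recoverable hx hxm hlaw hlog hf
    ((measurable_mmseEstimate hΘ (h.measurable_obs_vec hy)).prodMk hΘ) measurable_snd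
    (fun _ => rfl) (c := fun q => if q.2 ∈ s then 0 else q.1)
    (Measurable.ite (measurable_snd hs) measurable_const measurable_fst) ?_
  filter_upwards [h.mmseEstimate_eq hx hy] with ω hω
  have hmem : Θ ω ∈ s ↔ (effNoise P (mT.comap Θ) R ω).det = 0 := Set.ext_iff.1 hsΘ ω
  by_cases hdet : (effNoise P (mT.comap Θ) R ω).det = 0
  · simp [hmem, hdet, estimator]
  · simp only [hmem, hdet, if_false]
    rw [hω hdet, hy]

lemma isAchievableSE_obs (h : WhiteChannel P (mT.comap Θ) 𝓢 𝓤 u R) (hΘ : Measurable Θ)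
    (hx : ∀ ω i, x ω i = u ω (.inl i)) (hy : ∀ ω, y ω = R ω *ᵥ u ω) (hxm : Measurable x)
    (hlaw : P.map x = stdCNVec k)
    (hlog : Integrable (fun ω => Real.log (precision P (mT.comap Θ) R ω).det.re) P)
    {f : ℝ} (hf : 0 ≤ f) :
    IsAchievableSE f (mutualInfo P x fun ω => (y ω, Θ ω))
      (f * ∫ ω, log2det (precision P (mT.comap Θ) R ω) ∂P) := by
  obtain ⟨A, hA, hAΘ⟩ := (entryMeasurable_estimator (P := P) (m := mT.comap Θ) R).exists_eq_comp
  refine h.isAchievableSE_of_recoverable hx hxm hlaw hlog hf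
    ((h.measurable_obs_vec hy).prodMk hΘ) measurable_snd
    (fun _ => rfl) (c := fun q => A q.2 *ᵥ q.1)
    (measurable_mulVec (fun i j => (hA i j).comp measurable_snd) measurable_fst)
    (.of_forall fun ω => ?_)
  rw [hAΘ, ← hy]; rfl

end WhiteChannel

/-! ### Moments of Gaussian matrices and vectors -/

section Moments

variable {Ω : Type*} [MeasurableSpace Ω] {P : Measure Ω} {ι κ η : Type*}

/-- A random matrix whose entries have finite moments of all orders. -/
def AllMoments (P : Measure Ω) (X : Ω → Matrix ι κ ℂ) : Prop :=
  ∀ i j, ∀ p : ℝ≥0∞, p ≠ ∞ → MemLp (fun ω => X ω i j) p P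

lemma memLp_mul_of_double {f g : Ω → ℂ} {p : ℝ≥0∞} (hf : MemLp f (2 * p) P)
    (hg : MemLp g (2 * p) P) : MemLp (fun ω => f ω * g ω) p P := by
  have : ENNReal.HolderTriple (2 * p) (2 * p) p := ⟨by
    rw [← two_mul, ENNReal.mul_inv (by simp) (by simp), ← mul_assoc,
      ENNReal.mul_inv_cancel (by simp) (by simp), one_mul]⟩
  exact hg.mul' hf

namespace AllMoments

lemma const [IsFiniteMeasure P] (A : Matrix ι κ ℂ) : AllMoments P fun _ => A :=
  fun _ _ _ _ => memLp_const _

lemma of_bounded [IsFiniteMeasure P] {X : Ω → Matrix ι κ ℂ} (hX : EntryMeasurable inferInstance X)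
    (c : ℝ) (hc : ∀ ω i j, ‖X ω i j‖ ≤ c) :
    AllMoments P X := fun i j _ _ =>
  MemLp.of_bound (hX i j).aestronglyMeasurable c (.of_forall fun ω => hc ω i j)

lemma add {X Y : Ω → Matrix ι κ ℂ} (hX : AllMoments P X) (hY : AllMoments P Y) :
    AllMoments P fun ω => X ω + Y ω := fun i j p hp => (hX i j p hp).add (hY i j p hp)

lemma smul {X : Ω → Matrix ι κ ℂ} (c : ℂ) (hX : AllMoments P X) :
    AllMoments P fun ω => c • X ω := fun i j p hp => (hX i j p hp).const_mul c

lemma conjTranspose {X : Ω → Matrix ι κ ℂ} (hX : AllMoments P X) :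
    AllMoments P fun ω => (X ω)ᴴ := fun i j p hp => (hX j i p hp).star

/-- Hölder's inequality trades order `p` for order `2 p`, so the factors may be arbitrarily
dependent. This closure under products is the reason for asking for all moments, not only the
second. -/
lemma mul [Fintype κ] {X : Ω → Matrix ι κ ℂ} {Y : Ω → Matrix κ η ℂ} (hX : AllMoments P X)
    (hY : AllMoments P Y) : AllMoments P fun ω => X ω * Y ω := fun i j p hp => by
  simp only [mul_apply]
  have h2 : 2 * p ≠ ∞ := ENNReal.mul_ne_top (by simp) hp
  exact memLp_finsetSum _ fun l _ => memLp_mul_of_double (hX i l _ h2) (hY l j _ h2)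

lemma sum {ν : Type*} (s : Finset ν) {X : ν → Ω → Matrix ι κ ℂ}
    (hX : ∀ a, AllMoments P (X a)) : AllMoments P fun ω => ∑ a ∈ s, X a ω := fun i j p hp => by
  simp only [Matrix.sum_apply]
  exact memLp_finsetSum _ fun a _ => hX a i j p hp

lemma memLp_two {X : Ω → Matrix ι κ ℂ} (hX : AllMoments P X) (i : ι) (j : κ) :
    MemLp (fun ω => X ω i j) 2 P := hX i j 2 (by simp)

lemma integrable [IsFiniteMeasure P] {X : Ω → Matrix ι κ ℂ} (hX : AllMoments P X) (i : ι) (j : κ) :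
    Integrable (fun ω => X ω i j) P := (hX.memLp_two i j).integrable one_le_two

end AllMoments

lemma memLp_id_stdCN {p : ℝ≥0∞} (hp : p ≠ ∞) : MemLp (fun z : ℂ => z) p stdCN := by
  have hmeas : Measurable fun q : ℝ × ℝ => (⟨q.1, q.2⟩ : ℂ) :=
    Complex.measurableEquivRealProd.symm.measurable
  unfold stdCN
  refine (memLp_map_measure_iff (by fun_prop) hmeas.aemeasurable).2 ?_
  have h0 := memLp_id_gaussianReal' (μ := 0) (v := 1 / 2) p hp
  have h1 : MemLp (fun q : ℝ × ℝ => ((q.1 : ℝ) : ℂ)) p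
      ((gaussianReal 0 (1 / 2)).prod (gaussianReal 0 (1 / 2))) :=
    (h0.comp_measurePreserving measurePreserving_fst).ofReal
  have h2 : MemLp (fun q : ℝ × ℝ => ((q.2 : ℝ) : ℂ)) p
      ((gaussianReal 0 (1 / 2)).prod (gaussianReal 0 (1 / 2))) :=
    (h0.comp_measurePreserving measurePreserving_snd).ofReal
  convert h1.add (h2.const_mul Complex.I) using 1
  ext q
  simp [Complex.mk_eq_add_mul_I, mul_comm]

lemma integral_id_stdCN : ∫ z, z ∂stdCN = 0 := by
  have hmeas : Measurable fun q : ℝ × ℝ => (⟨q.1, q.2⟩ : ℂ) :=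
    Complex.measurableEquivRealProd.symm.measurable
  have hneg : stdCN.map (fun z => -z) = stdCN := by
    unfold stdCN
    rw [Measure.map_map (by fun_prop) hmeas]
    have h : (fun z : ℂ => -z) ∘ (fun q : ℝ × ℝ => (⟨q.1, q.2⟩ : ℂ))
        = (fun q : ℝ × ℝ => (⟨q.1, q.2⟩ : ℂ)) ∘ Prod.map (fun a : ℝ => -a) (fun a : ℝ => -a) := by
      ext q
      apply Complex.ext <;> simp
    rw [h, ← Measure.map_map hmeas (by fun_prop), ← Measure.map_prod_map _ _ (by fun_prop)
      (by fun_prop), gaussianReal_map_neg, neg_zero]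
  have h : ∫ z, z ∂stdCN = ∫ z, -z ∂stdCN := by
    conv_lhs => rw [← hneg]
    exact integral_map (by fun_prop) (by fun_prop)
  rw [integral_neg] at h
  exact self_eq_neg.1 h

lemma integral_sq_gaussianReal (v : NNReal) : ∫ a, a ^ 2 ∂(gaussianReal 0 v) = v := by
  have h := variance_fun_id_gaussianReal (μ := 0) (v := v)
  rw [variance_eq_sub (X := fun a : ℝ => a) (memLp_id_gaussianReal 2)] at h
  simpa using h

lemma integral_mul_star_stdCN : ∫ z, z * star z ∂stdCN = 1 := by
  have hmeas : Measurable fun q : ℝ × ℝ => (⟨q.1, q.2⟩ : ℂ) :=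
    Complex.measurableEquivRealProd.symm.measurable
  have h0 : Integrable (fun a : ℝ => a ^ 2) (gaussianReal 0 (1 / 2)) :=
    (memLp_id_gaussianReal 2).integrable_sq
  unfold stdCN
  rw [integral_map hmeas.aemeasurable (by fun_prop)]
  have h : ∀ q : ℝ × ℝ, (⟨q.1, q.2⟩ : ℂ) * star (⟨q.1, q.2⟩ : ℂ)
      = ((q.1 ^ 2 + q.2 ^ 2 : ℝ) : ℂ) := by
    intro q
    rw [Complex.star_def, Complex.mul_conj, Complex.normSq_mk]
    congr 1; ring
  simp only [h]
  rw [integral_complex_ofReal, integral_add (h0.comp_fst _) (h0.comp_snd _),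
    integral_fun_fst (fun a : ℝ => a ^ 2), integral_fun_snd (fun a : ℝ => a ^ 2),
    integral_sq_gaussianReal]
  simp
  norm_num

lemma allMoments_of_law {a b : ℕ} {X : Ω → Matrix (Fin a) (Fin b) ℂ} (hX : Measurable X)
    (hlaw : P.map X = stdCNMat a b) : AllMoments P X := by
  intro i j p hp
  have h1 : MeasurePreserving X P (stdCNMat a b) := ⟨hX, hlaw⟩
  have h2 : MeasurePreserving (fun A : Matrix (Fin a) (Fin b) ℂ => A i j) (stdCNMat a b) stdCN :=
    (measurePreserving_eval (fun _ : Fin b => stdCN) j).comp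
      (measurePreserving_eval (fun _ : Fin a => Measure.pi fun _ : Fin b => stdCN) i)
  exact (memLp_id_stdCN hp).comp_measurePreserving (h2.comp h1)

section Vector

variable {k : ℕ} {x : Ω → Fin k → ℂ}

lemma measurePreserving_apply_of_law (hx : Measurable x) (hlaw : P.map x = stdCNVec k) (i : Fin k) :
    MeasurePreserving (fun ω => x ω i) P stdCN :=
  (measurePreserving_eval (fun _ : Fin k => stdCN) i).comp ⟨hx, hlaw⟩

lemma memLp_of_law (hx : Measurable x) (hlaw : P.map x = stdCNVec k) (i : Fin k) :
    MemLp (fun ω => x ω i) 2 P :=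
  (memLp_id_stdCN (by simp)).comp_measurePreserving (measurePreserving_apply_of_law hx hlaw i)

lemma integral_of_law (hx : Measurable x) (hlaw : P.map x = stdCNVec k) (i : Fin k) :
    ∫ ω, x ω i ∂P = 0 := by
  have h := measurePreserving_apply_of_law hx hlaw i
  rw [← integral_id_stdCN, ← h.map_eq, integral_map h.measurable.aemeasurable (by fun_prop)]

lemma integral_mul_star_of_law (hx : Measurable x) (hlaw : P.map x = stdCNVec k) (i j : Fin k) :
    ∫ ω, x ω i * star (x ω j) ∂P = if i = j then 1 else 0 := by
  split_ifs with hij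
  · subst hij
    have h := measurePreserving_apply_of_law hx hlaw i
    rw [← integral_mul_star_stdCN, ← h.map_eq,
      integral_map h.measurable.aemeasurable (by fun_prop)]
  · have h1 : ∫ ω, x ω i * star (x ω j) ∂P = ∫ v, v i * star (v j) ∂(stdCNVec k) := by
      rw [← hlaw, integral_map hx.aemeasurable (by fun_prop)]
    have hind : IndepFun (fun v : Fin k → ℂ => v i) (fun v => star (v j)) (stdCNVec k) := by
      have := (iIndepFun_pi (μ := fun _ : Fin k => stdCN) (X := fun _ z => z)
        (fun _ => by fun_prop)).indepFun hij
      exact this.comp measurable_id (Complex.continuous_conj.measurable)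
    have hz : ∫ v, v i ∂(stdCNVec k) = 0 := by
      rw [← integral_of_law hx hlaw i, ← hlaw,
        integral_map hx.aemeasurable (measurable_pi_apply i).aestronglyMeasurable]
    rw [h1, hind.integral_fun_mul_eq_mul_integral (measurable_pi_apply i).aestronglyMeasurable
      (Complex.continuous_conj.measurable.comp (measurable_pi_apply j)).aestronglyMeasurable, hz,
      zero_mul]

/-- The integral of a non-integrable function is `0` by convention, so the value `1` forces
integrability. -/
lemma memLp_of_integral_mul_star_eq_one {f : Ω → ℂ} (hf : Measurable f)
    (h : ∫ ω, f ω * star (f ω) ∂P = 1) : MemLp f 2 P :=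
  memLp_two_of_integrable_mul_star hf.aestronglyMeasurable
    (not_not.1 fun hn => zero_ne_one ((integral_undef hn).symm.trans h))

end Vector

end Moments

/-! ### Regrouping independent families -/

section Independence

variable {Ω : Type*} [MeasurableSpace Ω] {P : Measure Ω}
  {A B C D E : Type*} [MeasurableSpace A] [MeasurableSpace B] [MeasurableSpace C]
  [MeasurableSpace D] [MeasurableSpace E]

/-- The joint law is the product of the three marginals, and products of measures associate. -/
lemma indepFun_prodMk_of_chain [IsProbabilityMeasure P] {X : Ω → A} {Y : Ω → B} {Z : Ω → C}
    (hX : Measurable X) (hY : Measurable Y) (hZ : Measurable Z) (h1 : IndepFun X (fun ω => (Y ω, Z ω)) P)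
    (h2 : IndepFun Y Z P) : IndepFun (fun ω => (X ω, Y ω)) Z P := by
  have := Measure.isProbabilityMeasure_map (μ := P) hX.aemeasurable
  have := Measure.isProbabilityMeasure_map (μ := P) hY.aemeasurable
  have := Measure.isProbabilityMeasure_map (μ := P) hZ.aemeasurable
  have hXY : IndepFun X Y P := h1.comp measurable_id measurable_fst
  rw [indepFun_iff_map_prod_eq_prod_map_map (by fun_prop) (by fun_prop)] at h1 h2 hXY ⊢
  rw [hXY]
  refine (MeasurableEquiv.map_measurableEquiv_injective MeasurableEquiv.prodAssoc) ?_
  rw [Measure.prodAssoc_prod, ← h2, ← h1,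
    Measure.map_map MeasurableEquiv.prodAssoc.measurable (by fun_prop)]
  rfl

lemma MutuallyIndep.indepFun_source [IsProbabilityMeasure P] {X : Ω → A} {J : Ω → B} {N : Ω → C}
    {S : Ω → D}
    (h : MutuallyIndep P X J N S) (hX : Measurable X) (hJ : Measurable J) (hN : Measurable N)
    (hS : Measurable S) : IndepFun (fun ω => (X ω, J ω, N ω)) S P := by
  obtain ⟨h1, h2, h3⟩ := h
  have h4 := indepFun_prodMk_of_chain hJ hN hS h2 h3
  refine indepFun_prodMk_of_chain hX (hJ.prodMk hN) hS ?_ h4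
  exact h1.comp (ψ := fun q : B × C × D => ((q.1, q.2.1), q.2.2)) measurable_id (by fun_prop)

lemma MutuallyIndep.comp_noise {X : Ω → A} {J : Ω → B} {N : Ω → C} {S : Ω → D}
    (h : MutuallyIndep P X J N S) {g : C → E} (hg : Measurable g) :
    MutuallyIndep P X J (fun ω => g (N ω)) S := by
  obtain ⟨h1, h2, h3⟩ := h
  exact ⟨h1.comp (ψ := fun q : B × C × D => (q.1, g q.2.1, q.2.2)) measurable_id (by fun_prop),
    h2.comp (ψ := fun q : C × D => (g q.1, q.2)) measurable_id (by fun_prop),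
    h3.comp hg measurable_id⟩

lemma integral_mul_star_of_indep {X : Ω → A} {Y : Ω → B} (h : IndepFun X Y P) (hX : Measurable X)
    (hY : Measurable Y) {f : A → ℂ} {g : B → ℂ} (hf : Measurable f) (hg : Measurable g)
    (h0 : (∫ ω, f (X ω) ∂P) = 0 ∨ (∫ ω, g (Y ω) ∂P) = 0) :
    ∫ ω, f (X ω) * star (g (Y ω)) ∂P = 0 := by
  have h1 : IndepFun (fun ω => f (X ω)) (fun ω => star (g (Y ω))) P :=
    h.comp hf (Complex.continuous_conj.measurable.comp hg)
  have h2 : ∫ ω, star (g (Y ω)) ∂P = star (∫ ω, g (Y ω) ∂P) := integral_conj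
  rw [h1.integral_fun_mul_eq_mul_integral (hf.comp hX).aestronglyMeasurable
    (Complex.continuous_conj.measurable.comp (hg.comp hY)).aestronglyMeasurable, h2]
  rcases h0 with h0 | h0 <;> simp [h0]

end Independence

/-! ### The channel with a common front-end matrix for signal and noise -/

section ChannelMatrix

set_option linter.unusedSectionVars false

variable {Ω : Type*} {k : ℕ} {κ : Type*} [Fintype κ]

/-- The matrix of the channel `y = L (B x + w) + J v` with signal `x`, interference `v` and
noise `w`. -/
noncomputable def channelMatrix (L : Ω → Matrix (Fin k) κ ℂ) (B : Ω → Matrix κ (Fin k) ℂ)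
    (J : Ω → Matrix (Fin k) (Fin k) ℂ) (ω : Ω) : Matrix (Fin k) (Fin k ⊕ (Fin k ⊕ κ)) ℂ :=
  fromCols (L ω * B ω) (fromCols (J ω) (L ω))

/-- The stacked vector of signal, interference and noise. -/
def sourceVec (x v : Ω → Fin k → ℂ) (w : Ω → κ → ℂ) (ω : Ω) : Fin k ⊕ (Fin k ⊕ κ) → ℂ :=
  Sum.elim (x ω) (Sum.elim (v ω) (w ω))

variable {L : Ω → Matrix (Fin k) κ ℂ} {B : Ω → Matrix κ (Fin k) ℂ}
  {J : Ω → Matrix (Fin k) (Fin k) ℂ} {x v : Ω → Fin k → ℂ} {w : Ω → κ → ℂ}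

lemma channelMatrix_mulVec_sourceVec (ω : Ω) :
    channelMatrix L B J ω *ᵥ sourceVec x v w ω
      = (L ω * B ω) *ᵥ x ω + (J ω *ᵥ v ω + L ω *ᵥ w ω) := by
  simp [channelMatrix, sourceVec]

lemma channelMatrix_mul_conjTranspose (ω : Ω) :
    channelMatrix L B J ω * (channelMatrix L B J ω)ᴴ
      = (L ω * B ω) * (L ω * B ω)ᴴ + (J ω * (J ω)ᴴ + L ω * (L ω)ᴴ) := by
  simp only [channelMatrix, conjTranspose_fromCols_eq_fromRows_conjTranspose,
    fromCols_mul_fromRows]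

variable {m 𝓢 𝓤 : MeasurableSpace Ω} [mΩ : MeasurableSpace Ω] {P : Measure Ω}
  [IsProbabilityMeasure P] [DecidableEq κ]
  {T 𝒵 : Type*} [mT : MeasurableSpace T] [mZ : MeasurableSpace 𝒵] {Θ : Ω → T} {Z : Ω → 𝒵}

/-- The σ-algebra generated by the channel state and the side information. -/
abbrev stateAlgebra (Z : Ω → 𝒵) (Θ : Ω → T) : MeasurableSpace Ω :=
  MeasurableSpace.comap (fun ω => (Z ω, Θ ω)) inferInstance

/-- Each cross-correlation between different blocks vanishes because at least one of the two
independent factors is centred. Only `x` and `w` have to be, so the interference `v` may have a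
nonzero mean. -/
lemma whiteChannel_channelMatrix (hx : Measurable x) (hv : Measurable v) (hw : Measurable w)
    (hZ : Measurable Z) (hΘ : Measurable Θ)
    (hind : MutuallyIndep P x v w fun ω => (Z ω, Θ ω)) (hlaw : P.map x = stdCNVec k)
    (hvcov : ∀ i j, ∫ ω, v ω i * star (v ω j) ∂P = if i = j then 1 else 0)
    (hwmean : ∀ a, ∫ ω, w ω a ∂P = 0)
    (hwcov : ∀ a b, ∫ ω, w ω a * star (w ω b) ∂P = if a = b then 1 else 0)
    (hLm : EntryMeasurable (stateAlgebra Z Θ) L) (hBm : EntryMeasurable (stateAlgebra Z Θ) B)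
    (hJm : EntryMeasurable (stateAlgebra Z Θ) J)
    (hL : AllMoments P L) (hB : AllMoments P B) (hJ : AllMoments P J) :
    WhiteChannel P (mT.comap Θ) (stateAlgebra Z Θ)
      (MeasurableSpace.comap (fun ω => (x ω, v ω, w ω)) inferInstance)
      (sourceVec x v w) (channelMatrix L B J) := by
  have hxv : IndepFun x v P := hind.1.comp measurable_id measurable_fst
  have hxw : IndepFun x w P := hind.1.comp measurable_id (measurable_fst.comp measurable_snd)
  have hvw : IndepFun v w P := hind.2.1.comp measurable_id measurable_fst
  have hsrc : ∀ g : (Fin k → ℂ) × (Fin k → ℂ) × (κ → ℂ) → ℂ, Measurable g →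
      Measurable[MeasurableSpace.comap (fun ω => (x ω, v ω, w ω)) inferInstance]
        fun ω => g (x ω, v ω, w ω) := fun g hg => hg.comp (comap_measurable _)
  have hx0 : ∀ i, ∫ ω, x ω i ∂P = 0 := integral_of_law hx hlaw
  refine
    { side_le := ?_, state_le := (hZ.prodMk hΘ).comap_le
      source_le := (hx.prodMk (hv.prodMk hw)).comap_le
      indep := (IndepFun_iff_Indep _ _ _).1
        (hind.indepFun_source hx hv hw (hZ.prodMk hΘ))
      source_meas := ?_, source_memLp := ?_, source_white := ?_
      matrix_meas := ?_, matrix_memLp := ?_ }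
  · have : Measurable[stateAlgebra Z Θ] Θ := measurable_snd.comp (comap_measurable _)
    exact this.comap_le
  · rintro (i | i | a)
    · exact hsrc (fun q => q.1 i) (by fun_prop)
    · exact hsrc (fun q => q.2.1 i) (by fun_prop)
    · exact hsrc (fun q => q.2.2 a) (by fun_prop)
  · rintro (i | i | a)
    · exact memLp_of_law hx hlaw i
    · exact memLp_of_integral_mul_star_eq_one ((measurable_pi_apply i).comp hv)
        ((hvcov i i).trans (if_pos rfl))
    · exact memLp_of_integral_mul_star_eq_one ((measurable_pi_apply a).comp hw)
        ((hwcov a a).trans (if_pos rfl))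
  · rintro (i | i | a) (j | j | b)
    · simpa [sourceVec] using integral_mul_star_of_law hx hlaw i j
    · simpa [sourceVec] using integral_mul_star_of_indep hxv hx hv
        (measurable_pi_apply i) (measurable_pi_apply j) (.inl (hx0 i))
    · simpa [sourceVec] using integral_mul_star_of_indep hxw hx hw
        (measurable_pi_apply i) (measurable_pi_apply b) (.inl (hx0 i))
    · simpa [sourceVec] using integral_mul_star_of_indep hxv.symm hv hx
        (measurable_pi_apply i) (measurable_pi_apply j) (.inr (hx0 j))
    · simpa [sourceVec] using hvcov i j
    · simpa [sourceVec] using integral_mul_star_of_indep hvw hv hw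
        (measurable_pi_apply i) (measurable_pi_apply b) (.inr (hwmean b))
    · simpa [sourceVec] using integral_mul_star_of_indep hxw.symm hw hx
        (measurable_pi_apply a) (measurable_pi_apply j) (.inr (hx0 j))
    · simpa [sourceVec] using integral_mul_star_of_indep hvw.symm hw hv
        (measurable_pi_apply a) (measurable_pi_apply j) (.inl (hwmean a))
    · simpa [sourceVec] using hwcov a b
  · rintro i (j | j | a)
    exacts [hLm.mul hBm i j, hJm i j, hLm i a]
  · rintro i (j | j | a)
    exacts [(hL.mul hB).memLp_two i j, hJ.memLp_two i j, hL.memLp_two i a]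

open scoped ComplexOrder in
-- The noise passes through the same `L` as the signal, so the noise part exceeds `L Lᴴ` by `J Jᴴ`.
-- The factored form of `channelMatrix` exists for this domination.
lemma integrable_log_det_precision_channelMatrix
    (h : WhiteChannel P m 𝓢 𝓤 (sourceVec x v w) (channelMatrix L B J))
    (hL : AllMoments P L) (hB : AllMoments P B) :
    Integrable (fun ω => Real.log (precision P m (channelMatrix L B J) ω).det.re) P := by
  refine h.integrable_log_det_precision hL.memLp_two hB.memLp_two (fun ω => ?_) fun ω => ?_
  · simp [channelMatrix]
  · have : (channelMatrix L B J ω).toCols₂ * ((channelMatrix L B J ω).toCols₂)ᴴ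
        = J ω * (J ω)ᴴ + L ω * (L ω)ᴴ := by
      simp only [channelMatrix, toCols₂_fromCols, conjTranspose_fromCols_eq_fromRows_conjTranspose,
        fromCols_mul_fromRows]
    rw [this, add_sub_cancel_right]
    exact posSemidef_self_mul_conjTranspose _

lemma meanGain_channelMatrix (ω : Ω) :
    meanGain P m (channelMatrix L B J) ω = condExpMat P m (fun ω => L ω * B ω) ω := by
  simp [meanGain, channelMatrix]

/-- The effective noise covariance of the channel `y = L (B x + w) + J v`. -/
lemma effNoise_channelMatrix (hL : AllMoments P L) (hB : AllMoments P B)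
    (hJ : AllMoments P J) :
    effNoise P m (channelMatrix L B J) =ᵐ[P] fun ω =>
      condExpMat P m (fun ω => (L ω * B ω) * (L ω * B ω)ᴴ) ω
        + (condExpMat P m (fun ω => J ω * (J ω)ᴴ) ω + condExpMat P m (fun ω => L ω * (L ω)ᴴ) ω)
        - condExpMat P m (fun ω => L ω * B ω) ω * (condExpMat P m (fun ω => L ω * B ω) ω)ᴴ := by
  have hC := hL.mul hB
  have hCC := hC.mul hC.conjTranspose
  have hJJ := hJ.mul hJ.conjTranspose
  have hLL := hL.mul hL.conjTranspose
  filter_upwards [condExpMat_add (m := m) hCC.integrable (hJJ.add hLL).integrable,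
    condExpMat_add (m := m) hJJ.integrable hLL.integrable] with ω h1 h2
  rw [effNoise, meanGain_channelMatrix, obsCov, funext channelMatrix_mul_conjTranspose, h1, h2]

end ChannelMatrix

/-! ### Bounds for the precoder and the regularized combiner -/

section Bounds

lemma norm_normalizeCols_le {k l : ℕ} (X : Matrix (Fin k) (Fin l) ℂ) (i : Fin k) (j : Fin l) :
    ‖normalizeCols X i j‖ ≤ 1 := by
  simp only [normalizeCols, of_apply, norm_div, Complex.norm_real]
  rw [Real.norm_of_nonneg (Real.sqrt_nonneg _)]
  refine div_le_one_of_le₀ (Real.le_sqrt_of_sq_le ?_) (Real.sqrt_nonneg _)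
  exact Finset.single_le_sum (f := fun i' => ‖X i' j‖ ^ 2) (fun _ _ => sq_nonneg _)
    (Finset.mem_univ i)

lemma EntryMeasurable.measurable {Ω : Type*} {m : MeasurableSpace Ω} {k l : ℕ}
    {X : Ω → Matrix (Fin k) (Fin l) ℂ} (hX : EntryMeasurable m X) : Measurable X :=
  measurable_pi_iff.2 fun i => measurable_pi_iff.2 fun j => hX i j

lemma measurable_entry {k l : ℕ} (i : Fin k) (j : Fin l) :
    Measurable fun A : Matrix (Fin k) (Fin l) ℂ => A i j :=
  (measurable_pi_apply (X := fun _ : Fin l => ℂ) j).comp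
    (measurable_pi_apply (X := fun _ : Fin k => Fin l → ℂ) i)

lemma measurable_entry_apply {ι : Type*} {k l : ℕ} (a : ι) (i : Fin k) (j : Fin l) :
    Measurable fun A : ι → Matrix (Fin k) (Fin l) ℂ => A a i j :=
  (measurable_entry i j).comp
    (measurable_pi_apply (X := fun _ : ι => Matrix (Fin k) (Fin l) ℂ) a)

lemma EntryMeasurable.normalizeCols {Ω : Type*} {m : MeasurableSpace Ω} {k l : ℕ}
    {X : Ω → Matrix (Fin k) (Fin l) ℂ} (hX : EntryMeasurable m X) :
    EntryMeasurable m fun ω => normalizeCols (X ω) := fun i j => by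
  simp only [Surveillance.normalizeCols, of_apply]
  refine (hX i j).div (Complex.measurable_ofReal.comp (Real.continuous_sqrt.measurable.comp ?_))
  exact Finset.measurable_fun_sum _ fun i' _ => ((hX i' j).norm).pow_const 2

open scoped ComplexOrder in
/-- The entries of a regularized least-squares matrix `B (Bᴴ B + r)⁻¹` are bounded. -/
lemma norm_regularized_le {ι κ : Type*} [Fintype ι] [Fintype κ] [DecidableEq κ]
    (B : Matrix ι κ ℂ) {r : ℝ} (hr : 0 < r) (i : ι) (j : κ) :
    ‖(B * (Bᴴ * B + (r : ℂ) • (1 : Matrix κ κ ℂ))⁻¹ : Matrix ι κ ℂ) i j‖ ≤ Real.sqrt (1 / (4 * r)) := by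
  set G : Matrix κ κ ℂ := Bᴴ * B + (r : ℂ) • 1 with hG
  have hrc : (r : ℂ) ≠ 0 := by exact_mod_cast hr.ne'
  have hGpd : G.PosDef :=
    (PosDef.one.smul (by exact_mod_cast hr)).posSemidef_add (posSemidef_conjTranspose_mul_self B)
  have hGinv : G⁻¹ * G = 1 := nonsing_inv_mul _ ((isUnit_iff_isUnit_det _).1 hGpd.isUnit)
  have hH : (G⁻¹)ᴴ = G⁻¹ := hGpd.inv.1
  have hV : (B * G⁻¹)ᴴ * (B * G⁻¹) = G⁻¹ - (r : ℂ) • (G⁻¹ * G⁻¹) := by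
    have h1 : Bᴴ * B = G - (r : ℂ) • 1 := by simp [hG]
    calc (B * G⁻¹)ᴴ * (B * G⁻¹) = G⁻¹ * (Bᴴ * B) * G⁻¹ := by
          rw [conjTranspose_mul, hH]; simp only [Matrix.mul_assoc]
      _ = _ := by rw [h1, Matrix.mul_sub, hGinv]; simp [Matrix.sub_mul]
  -- Completing the square: with `g` in place of `G⁻¹`, the function `g - r g²` has its maximum `1 /
  -- (4 r)` at `g = 1 / (2 r)`, and the gap is `r (g - 1 / (2 r))²`.
  have hsq : ((1 / (4 * r) : ℝ) : ℂ) • (1 : Matrix κ κ ℂ) - (B * G⁻¹)ᴴ * (B * G⁻¹)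
      = (r : ℂ) • ((G⁻¹ - ((1 / (2 * r) : ℝ) : ℂ) • 1)ᴴ * (G⁻¹ - ((1 / (2 * r) : ℝ) : ℂ) • 1)) := by
    rw [hV, conjTranspose_sub, hH, conjTranspose_smul, conjTranspose_one, Complex.star_def,
      Complex.conj_ofReal]
    simp only [Matrix.sub_mul, Matrix.mul_sub, Matrix.smul_mul, Matrix.mul_smul, Matrix.one_mul,
      Matrix.mul_one, smul_sub, smul_smul]
    have e1 : (r : ℂ) * ((1 / (2 * r) : ℝ) : ℂ) = 1 / 2 := by push_cast; field_simp
    have e2 : (r : ℂ) * (((1 / (2 * r) : ℝ) : ℂ) * ((1 / (2 * r) : ℝ) : ℂ))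
        = ((1 / (4 * r) : ℝ) : ℂ) := by push_cast; field_simp; norm_num
    rw [e1, e2]
    have e3 : G⁻¹ = (1 / 2 : ℂ) • G⁻¹ + (1 / 2 : ℂ) • G⁻¹ := by
      rw [← add_smul]; norm_num
    nth_rewrite 1 [e3]
    abel
  have hpsd : (((1 / (4 * r) : ℝ) : ℂ) • (1 : Matrix κ κ ℂ)
      - (B * G⁻¹)ᴴ * (B * G⁻¹)).PosSemidef := by
    rw [hsq]
    exact (posSemidef_conjTranspose_mul_self _).smul (by exact_mod_cast hr.le)
  have hdiag := (Complex.nonneg_iff.1 (hpsd.diag_nonneg (i := j))).1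
  rw [Matrix.sub_apply, Matrix.smul_apply, one_apply_eq, mul_apply] at hdiag
  simp only [conjTranspose_apply, Complex.sub_re, smul_eq_mul, mul_one, Complex.ofReal_re,
    Complex.re_sum] at hdiag
  have hterm : ∀ z : ℂ, (star z * z).re = ‖z‖ ^ 2 := by
    intro z
    rw [← Complex.normSq_eq_norm_sq]
    simp [Complex.normSq_apply]
  simp only [hterm] at hdiag
  refine Real.le_sqrt_of_sq_le ?_
  have := Finset.single_le_sum (f := fun a => ‖(B * G⁻¹ : Matrix ι κ ℂ) a j‖ ^ 2) (fun _ _ => sq_nonneg _)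
    (Finset.mem_univ i)
  linarith

end Bounds

/-! ### Identities for the deterministic parameters -/

namespace Params

variable {M N Nt Nr τt τr : ℕ} (p : Params M N Nt Nr τt τr)

lemma star_α (m : Fin M) : star (p.α m) = p.α m := by
  unfold α; split_ifs <;> simp

lemma α_mul_self (m : Fin M) : p.α m * p.α m = p.α m := by
  unfold α; split_ifs <;> simp

lemma prelog_nonneg : 0 ≤ p.prelog := by
  unfold prelog
  have h1 : (0 : ℝ) < p.τ := by exact_mod_cast p.τ_pos
  have h2 : (τt : ℝ) + τr ≤ p.τ := by exact_mod_cast p.training_le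
  rw [sub_nonneg]
  exact div_le_one_of_le₀ h2 h1.le

lemma conjTranspose_sqrtLam : p.sqrtLamᴴ = p.sqrtLam := by
  simp only [sqrtLam, sqrtDiag, diagonal_conjTranspose]
  congr 1
  ext n
  simp

lemma sqrtLam_mul_sqrtLam : p.sqrtLam * p.sqrtLam = p.Lam := by
  simp only [sqrtLam, sqrtDiag, Lam, diagonal_mul_diagonal]
  congr 1
  ext n
  rw [← Complex.ofReal_mul, Real.mul_self_sqrt (p.lam_nonneg n)]

lemma sqrt_mul_self_ofReal {a : ℝ} (ha : 0 ≤ a) :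
    ((Real.sqrt a : ℝ) : ℂ) * ((Real.sqrt a : ℝ) : ℂ) = (a : ℂ) := by
  rw [← Complex.ofReal_mul, Real.mul_self_sqrt ha]

end Params

/-! ### Measurability and moments of the system's random matrices -/

namespace Model

variable {Ω : Type*} [mΩ : MeasurableSpace Ω] {P : Measure Ω}
  {M N Nt Nr τt τr : ℕ} (S : Model P M N Nt Nr τt τr) (p : Params M N Nt Nr τt τr)
  {T : Type*} [mT : MeasurableSpace T]

section Measurability

variable (Θ : Ω → T)

lemma measurable_state : Measurable S.state :=
  S.Htr_meas.prodMk (S.Hmr_meas.prodMk (S.Htm_meas.prodMk (S.Hmm_meas.prodMk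
    (S.Wt_meas.prodMk (S.Wul_meas.prodMk S.Wdl_meas)))))

lemma measurable_stateAlgebra : Measurable[stateAlgebra S.state Θ] S.state :=
  measurable_fst.comp (comap_measurable _)

lemma entryMeasurable_Gtr : EntryMeasurable (stateAlgebra S.state Θ) (S.Gtr p) :=
  EntryMeasurable.smul _ fun i j =>
    ((measurable_entry i j).comp measurable_fst).comp (S.measurable_stateAlgebra Θ)

lemma entryMeasurable_Gmr (m : Fin M) :
    EntryMeasurable (stateAlgebra S.state Θ) (S.Gmr p m) :=
  EntryMeasurable.smul _ fun i j => ((measurable_entry_apply m i j).comp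
    measurable_snd.fst).comp (S.measurable_stateAlgebra Θ)

lemma entryMeasurable_Gtm (m : Fin M) :
    EntryMeasurable (stateAlgebra S.state Θ) (S.Gtm p m) :=
  EntryMeasurable.smul _ fun i j => ((measurable_entry_apply m i j).comp
    measurable_snd.snd.fst).comp (S.measurable_stateAlgebra Θ)

lemma entryMeasurable_Gmm (m m' : Fin M) :
    EntryMeasurable (stateAlgebra S.state Θ) (S.Gmm p m m') := by
  unfold Gmm
  split_ifs
  · exact EntryMeasurable.const _
  · exact EntryMeasurable.smul _ fun i j => (((measurable_entry_apply m' i j).comp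
      (measurable_pi_apply (X := fun _ : Fin M => Fin M → Matrix (Fin N) (Fin N) ℂ) m)).comp
      measurable_snd.snd.snd.fst).comp (S.measurable_stateAlgebra Θ)

lemma entryMeasurable_Wt : EntryMeasurable (stateAlgebra S.state Θ) S.Wt := fun i j =>
  ((measurable_entry i j).comp measurable_snd.snd.snd.snd.fst).comp
    (S.measurable_stateAlgebra Θ)

lemma entryMeasurable_Wul (m : Fin M) :
    EntryMeasurable (stateAlgebra S.state Θ) fun ω => S.Wul ω m := fun i j =>
  ((measurable_entry_apply m i j).comp
    measurable_snd.snd.snd.snd.snd.fst).comp (S.measurable_stateAlgebra Θ)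

lemma entryMeasurable_Wdl (m : Fin M) :
    EntryMeasurable (stateAlgebra S.state Θ) fun ω => S.Wdl ω m := fun i j =>
  ((measurable_entry_apply m i j).comp
    measurable_snd.snd.snd.snd.snd.snd).comp (S.measurable_stateAlgebra Θ)

lemma entryMeasurable_W : EntryMeasurable (stateAlgebra S.state Θ) (S.W p) := by
  have h : EntryMeasurable (stateAlgebra S.state Θ) (S.Gtrhat p) :=
    (((((S.entryMeasurable_Gtr p Θ).mul (.const _)).smul _).add
      (S.entryMeasurable_Wt Θ)).mul (.const _)).smul _
  exact EntryMeasurable.normalizeCols (X := fun ω => p.precoder (S.Gtrhat p ω)) fun i j =>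
    (measurable_entry i j).comp (p.precoder_meas.comp h.measurable)

lemma entryMeasurable_Gmrhat (m : Fin M) :
    EntryMeasurable (stateAlgebra S.state Θ) (S.Gmrhat p m) :=
  (((((S.entryMeasurable_Gmr p Θ m).mul (.const _)).smul _).add
    (S.entryMeasurable_Wul Θ m)).mul (.const _)).smul _

lemma entryMeasurable_A : EntryMeasurable (stateAlgebra S.state Θ) (S.A p) :=
  (S.entryMeasurable_Gtr p Θ).conjTranspose.mul (S.entryMeasurable_W p Θ)

lemma entryMeasurable_B (m : Fin M) : EntryMeasurable (stateAlgebra S.state Θ) (S.B p m) :=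
  (S.entryMeasurable_Gtm p Θ m).conjTranspose.mul (S.entryMeasurable_W p Θ)

lemma entryMeasurable_Ymt (m : Fin M) : EntryMeasurable (stateAlgebra S.state Θ) (S.Ymt p m) :=
  ((((((S.entryMeasurable_Gtm p Θ m).conjTranspose.mul (S.entryMeasurable_W p Θ)).mul
    (.const _)).smul _).add (S.entryMeasurable_Wdl Θ m)).mul (.const _))

lemma entryMeasurable_Bhat (m : Fin M) :
    EntryMeasurable (stateAlgebra S.state Θ) (S.Bhat p m) := fun i j => by
  simp only [Bhat, bhat, of_apply, Pi.star_apply, Pi.add_apply, Pi.smul_apply, mulVec, dotProduct,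
    Pi.sub_apply, smul_eq_mul]
  refine Complex.continuous_conj.measurable.comp (Measurable.const_add (Measurable.const_mul
    (Finset.measurable_fun_sum _ fun l _ => Measurable.const_mul (Measurable.sub_const ?_ _) _) _) _)
  exact Complex.continuous_conj.measurable.comp (S.entryMeasurable_Ymt p Θ m i l)

lemma entryMeasurable_V (m : Fin M) : EntryMeasurable (stateAlgebra S.state Θ) (S.V p m) :=
  (S.entryMeasurable_Bhat p Θ m).mul
    (((S.entryMeasurable_Bhat p Θ m).conjTranspose.mul (S.entryMeasurable_Bhat p Θ m)).add
      (.const _)).inv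

lemma entryMeasurable_FJr : EntryMeasurable (stateAlgebra S.state Θ) (S.FJr p) :=
  EntryMeasurable.sum _ fun m => (((S.entryMeasurable_Gmr p Θ m).conjTranspose.mul
    (S.entryMeasurable_Gmrhat p Θ m)).mul (.const _)).smul _

lemma entryMeasurable_FJm (m : Fin M) :
    EntryMeasurable (stateAlgebra S.state Θ) (S.FJm p m) :=
  EntryMeasurable.sum _ fun m' => (((S.entryMeasurable_Gmm p Θ m m').conjTranspose.mul
    (S.entryMeasurable_Gmrhat p Θ m')).mul (.const _)).smul _

end Measurability

section Moments

set_option linter.unusedSectionVars false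

variable [IsProbabilityMeasure P]

/-- Trivial side information in `Unit` makes the measurability lemmas for the state σ-algebra usable
for the ambient one. -/
lemma entryMeasurable_of_stateAlgebra {ι κ : Type*} {X : Ω → Matrix ι κ ℂ}
    (hX : EntryMeasurable (stateAlgebra S.state fun _ => ()) X) : EntryMeasurable mΩ X :=
  fun i j => (hX i j).mono (S.measurable_state.prodMk measurable_const).comap_le le_rfl

lemma allMoments_W : AllMoments P (S.W p) :=
  AllMoments.of_bounded (S.entryMeasurable_of_stateAlgebra (S.entryMeasurable_W p _)) 1
    fun _ i j => norm_normalizeCols_le _ i j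

/-- The combiner contains a matrix inverse, so its moments come from the deterministic bound
supplied by the regularization, not from those of the channels. -/
lemma allMoments_V (m : Fin M) : AllMoments P (S.V p m) :=
  AllMoments.of_bounded (S.entryMeasurable_of_stateAlgebra (S.entryMeasurable_V p _ m)) _
    fun _ i j => norm_regularized_le _ p.reg_pos i j

lemma allMoments_Gtr : AllMoments P (S.Gtr p) :=
  (allMoments_of_law S.Htr_meas S.Htr_law).smul _

lemma allMoments_Gmr (m : Fin M) : AllMoments P (S.Gmr p m) :=
  (allMoments_of_law ((measurable_pi_apply m).comp S.Hmr_meas) (S.Hmr_law m)).smul _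

lemma allMoments_Gtm (m : Fin M) : AllMoments P (S.Gtm p m) :=
  (allMoments_of_law ((measurable_pi_apply m).comp S.Htm_meas) (S.Htm_law m)).smul _

lemma allMoments_Gmm (m m' : Fin M) : AllMoments P (S.Gmm p m m') := by
  by_cases h : m = m'
  · have : S.Gmm p m m' = fun _ => 0 := by ext ω : 1; simp [Gmm, h]
    rw [this]
    exact AllMoments.const _
  · have : S.Gmm p m m' = fun ω => ((Real.sqrt (p.βmm m m') : ℝ) : ℂ) • S.Hmm ω m m' := by
      ext ω : 1; simp [Gmm, h]
    rw [this]
    exact (allMoments_of_law ((measurable_pi_apply m').comp ((measurable_pi_apply m).comp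
      S.Hmm_meas)) (S.Hmm_law m m' h)).smul _

lemma allMoments_Gmrhat (m : Fin M) : AllMoments P (S.Gmrhat p m) :=
  (((((S.allMoments_Gmr p m).mul (.const _)).smul _).add
    (allMoments_of_law ((measurable_pi_apply m).comp S.Wul_meas) (S.Wul_law m))).mul
    (.const _)).smul _

lemma allMoments_A : AllMoments P (S.A p) :=
  (S.allMoments_Gtr p).conjTranspose.mul (S.allMoments_W p)

lemma allMoments_B (m : Fin M) : AllMoments P (S.B p m) :=
  (S.allMoments_Gtm p m).conjTranspose.mul (S.allMoments_W p)

lemma allMoments_FJr : AllMoments P (S.FJr p) :=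
  AllMoments.sum _ fun m => (((S.allMoments_Gmr p m).conjTranspose.mul
    (S.allMoments_Gmrhat p m)).mul (.const _)).smul _

lemma allMoments_FJm (m : Fin M) : AllMoments P (S.FJm p m) :=
  AllMoments.sum _ fun m' => (((S.allMoments_Gmm p m m').conjTranspose.mul
    (S.allMoments_Gmrhat p m')).mul (.const _)).smul _

lemma allMoments_D : AllMoments P (S.D p) :=
  AllMoments.sum _ fun m => (((S.allMoments_V p m).conjTranspose.mul
    (S.allMoments_B p m)).mul (.const _)).smul _

end Moments

end Model

set_option linter.unusedSectionVars false

/-! ### Rates of a white channel and explicit covariance formulas -/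

section Rates

variable {Ω T : Type*} {m 𝓢 𝓤 : MeasurableSpace Ω} [mΩ : MeasurableSpace Ω]
  [mT : MeasurableSpace T] {P : Measure Ω}
  [IsProbabilityMeasure P] {k : ℕ} {η : Type*} [DecidableEq η] [Fintype η]
  {Θ : Ω → T} {u : Ω → Fin k ⊕ η → ℂ}
  {R : Ω → Matrix (Fin k) (Fin k ⊕ η) ℂ} {x y : Ω → Fin k → ℂ}

/-- Integrability of the rate, its equality with the SE under MMSE detection, and its
achievability from the estimate and from the observation. -/
lemma WhiteChannel.rates (h : WhiteChannel P (mT.comap Θ) 𝓢 𝓤 u R) (hΘ : Measurable Θ)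
    (hx : ∀ ω i, x ω i = u ω (.inl i)) (hy : ∀ ω, y ω = R ω *ᵥ u ω) (hxm : Measurable x)
    (hlaw : P.map x = stdCNVec k)
    (hlog : Integrable (fun ω => Real.log (precision P (mT.comap Θ) R ω).det.re) P)
    {f : ℝ} (hf : 0 ≤ f) {Υ : Ω → Matrix (Fin k) (Fin k) ℂ}
    (hΥ : ∀ᵐ ω ∂P, 1 + Υ ω = precision P (mT.comap Θ) R ω) :
    Integrable (fun ω => log2det (1 + Υ ω)) P ∧
    ((∀ᵐ ω ∂P, (effNoise P (mT.comap Θ) R ω).det ≠ 0) →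
      mmseSE P f Θ x y = f * ∫ ω, log2det (1 + Υ ω) ∂P) ∧
    IsAchievableSE f (mutualInfo P x fun ω => (mmseEstimate P Θ x y ω, Θ ω))
      (f * ∫ ω, log2det (1 + Υ ω) ∂P) ∧
    IsAchievableSE f (mutualInfo P x fun ω => (y ω, Θ ω))
      (f * ∫ ω, log2det (1 + Υ ω) ∂P) := by
  have hae : (fun ω => log2det (1 + Υ ω)) =ᵐ[P]
      fun ω => log2det (precision P (mT.comap Θ) R ω) := by
    filter_upwards [hΥ] with ω hω
    rw [hω]
  rw [integral_congr_ae hae]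
  exact ⟨(hlog.div_const (Real.log 2)).congr hae.symm, fun hdet => h.mmseSE_eq hx hy hdet f,
    h.isAchievableSE_estimate hΘ hx hy hxm hlaw hlog hf,
    h.isAchievableSE_obs hΘ hx hy hxm hlaw hlog hf⟩

variable {κ : Type*} [Fintype κ] [DecidableEq κ] {L : Ω → Matrix (Fin k) κ ℂ}
  {B : Ω → Matrix κ (Fin k) ℂ} {J C K : Ω → Matrix (Fin k) (Fin k) ℂ}

lemma smul_mul_conjTranspose_smul {ι : Type*} {a : ℝ} (ha : 0 ≤ a) (X Y : Matrix ι κ ℂ) :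
    (((Real.sqrt a : ℝ) : ℂ) • X) * (((Real.sqrt a : ℝ) : ℂ) • Y)ᴴ = (a : ℂ) • (X * Yᴴ) := by
  rw [conjTranspose_smul, Complex.star_def, Complex.conj_ofReal, Matrix.smul_mul,
    Matrix.mul_smul, smul_smul, Params.sqrt_mul_self_ofReal ha]

lemma precision_channelMatrix_of_gain {ρ : ℝ} (hρ : 0 ≤ ρ) (hC : AllMoments P C)
    (hLB : ∀ ω, L ω * B ω = ((Real.sqrt ρ : ℝ) : ℂ) • C ω) :
    precision P m (channelMatrix L B J) =ᵐ[P] fun ω =>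
      1 + (ρ : ℂ) • (condExpMat P m (fun ω => (C ω)ᴴ) ω
        * (effNoise P m (channelMatrix L B J) ω)⁻¹ * condExpMat P m C ω) := by
  filter_upwards [condExpMat_conjTranspose (m := m) hC.integrable,
    condExpMat_smul (P := P) (m := m) ((Real.sqrt ρ : ℝ) : ℂ) C] with ω h1 h2
  rw [precision, meanGain_channelMatrix, funext hLB, h2, h1, conjTranspose_smul, Complex.star_def,
    Complex.conj_ofReal, Matrix.smul_mul, smul_mul_smul_comm, Params.sqrt_mul_self_ofReal hρ]

lemma effNoise_channelMatrix_of_gain {ρ σ : ℝ} (hρ : 0 ≤ ρ) (hσ : 0 ≤ σ) (hL : AllMoments P L)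
    (hB : AllMoments P B) (hK : AllMoments P K)
    (hLB : ∀ ω, L ω * B ω = ((Real.sqrt ρ : ℝ) : ℂ) • C ω) :
    effNoise P m (channelMatrix L B fun ω => ((Real.sqrt σ : ℝ) : ℂ) • K ω) =ᵐ[P] fun ω =>
      (ρ : ℂ) • condExpMat P m (fun ω => C ω * (C ω)ᴴ) ω
        + ((σ : ℂ) • condExpMat P m (fun ω => K ω * (K ω)ᴴ) ω
          + condExpMat P m (fun ω => L ω * (L ω)ᴴ) ω)
        - (ρ : ℂ) • (condExpMat P m C ω * (condExpMat P m C ω)ᴴ) := by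
  filter_upwards [effNoise_channelMatrix (m := m) hL hB (hK.smul ((Real.sqrt σ : ℝ) : ℂ)),
    condExpMat_smul (P := P) (m := m) ((Real.sqrt ρ : ℝ) : ℂ) C,
    condExpMat_smul (P := P) (m := m) (ρ : ℂ) (fun ω => C ω * (C ω)ᴴ),
    condExpMat_smul (P := P) (m := m) (σ : ℂ) (fun ω => K ω * (K ω)ᴴ)] with ω h1 h2 h3 h4
  rw [h1]
  simp only [hLB, smul_mul_conjTranspose_smul hρ, smul_mul_conjTranspose_smul hσ]
  rw [h2, h3, h4, smul_mul_conjTranspose_smul hρ]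

lemma condExpMat_const {ι ν : Type*} (hm : m ≤ mΩ) (A : Matrix ι ν ℂ) (ω : Ω) :
    condExpMat P m (fun _ => A) ω = A := by
  ext i j
  simp [condExpMat, condExp_const hm]

open scoped ComplexOrder in
-- With `L = 1` the additive noise contributes the identity to the effective noise covariance, which
-- makes it invertible without any further assumption.
lemma effNoise_channelMatrix_one_posDef {w v : Ω → Fin k → ℂ} {B : Ω → Matrix (Fin k) (Fin k) ℂ}
    (h : WhiteChannel P m 𝓢 𝓤 (sourceVec x v w) (channelMatrix (fun _ => 1) B J))
    (hJ : AllMoments P J) :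
    ∀ᵐ ω ∂P, (effNoise P m (channelMatrix (fun _ => 1) B J) ω).PosDef := by
  have hJJ := hJ.mul hJ.conjTranspose
  have hN : ∀ ω, (channelMatrix (fun _ => 1) B J ω).toCols₂
      * ((channelMatrix (fun _ => 1) B J ω).toCols₂)ᴴ = J ω * (J ω)ᴴ + 1 := fun ω => by
    simp only [channelMatrix, toCols₂_fromCols, conjTranspose_fromCols_eq_fromRows_conjTranspose,
      fromCols_mul_fromRows, conjTranspose_one, Matrix.mul_one]
  have hpsd := h.effNoise_sub_posSemidef
  rw [funext hN] at hpsd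
  filter_upwards [hpsd, condExpMat_add (m := m) hJJ.integrable (AllMoments.const 1).integrable,
    condExpMat_posSemidef (m := m) hJJ.integrable
      (.of_forall fun ω => posSemidef_self_mul_conjTranspose (J ω))] with ω h1 h2 h3
  rw [h2, condExpMat_const h.side_le'] at h1
  have h4 := PosDef.one.posSemidef_add (h1.add h3)
  convert h4 using 1
  abel

end Rates

lemma integral_mul_star_of_expMat {Ω : Type*} [MeasurableSpace Ω] {P : Measure Ω} {k : ℕ}
    {v : Ω → Fin k → ℂ} (h : expMat P (fun ω => outer (v ω) (v ω)) = 1) (i j : Fin k) :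
    ∫ ω, v ω i * star (v ω j) ∂P = if i = j then 1 else 0 := by
  rw [← one_apply, ← h]
  rfl

namespace Model

variable {Ω : Type*} [mΩ : MeasurableSpace Ω] {P : Measure Ω} [IsProbabilityMeasure P]
  {M N Nt Nr τt τr : ℕ} (S : Model P M N Nt Nr τt τr) (p : Params M N Nt Nr τt τr)
  {T : Type*} [mT : MeasurableSpace T] {Θ : Ω → T}

/-! ### The untrusted receiver -/

section Receiver

/-- The channel from signal, jamming and noise to the untrusted receiver. -/
noncomputable def receiverChannel : Ω → Matrix (Fin Nr) (Fin Nr ⊕ (Fin Nr ⊕ Fin Nr)) ℂ :=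
  channelMatrix (fun _ => 1) (fun ω => ((Real.sqrt p.ρt : ℝ) : ℂ) • (S.A p ω * p.sqrtLam))
    fun ω => ((Real.sqrt p.ρJ : ℝ) : ℂ) • S.FJr p ω

lemma allMoments_A_mul_sqrtLam : AllMoments P fun ω => S.A p ω * p.sqrtLam :=
  (S.allMoments_A p).mul (.const _)

lemma yr_eq (ω : Ω) :
    S.yr p ω = S.receiverChannel p ω *ᵥ sourceVec S.x S.xJ S.wr ω := by
  rw [receiverChannel, channelMatrix_mulVec_sourceVec, yr, st, A, FJr, Matrix.one_mul,
    Matrix.one_mulVec, ← add_assoc]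
  congr 2
  · rw [mulVec_smul, mulVec_mulVec, smul_mulVec, Matrix.mul_assoc]
  · rw [smul_mulVec, sum_mulVec, Finset.smul_sum]
    refine Finset.sum_congr rfl fun m _ => ?_
    rw [sJ, mulVec_smul, mulVec_mulVec, smul_mulVec, smul_smul, mul_comm, Matrix.mul_assoc]

lemma whiteChannel_receiver (hΘ : Measurable Θ)
    (hind : MutuallyIndep P S.x S.xJ S.wr fun ω => (S.state ω, Θ ω)) :
    WhiteChannel P (mT.comap Θ) (stateAlgebra S.state Θ)
      (MeasurableSpace.comap (fun ω => (S.x ω, S.xJ ω, S.wr ω)) inferInstance)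
      (sourceVec S.x S.xJ S.wr) (S.receiverChannel p) :=
  whiteChannel_channelMatrix S.x_meas S.xJ_meas S.wr_meas S.measurable_state hΘ hind S.x_law
    (integral_mul_star_of_expMat S.xJ_cov) S.wr_mean (integral_mul_star_of_expMat S.wr_cov)
    (.const _) (((S.entryMeasurable_A p Θ).mul (.const _)).smul _)
    ((S.entryMeasurable_FJr p Θ).smul _) (.const _) ((S.allMoments_A_mul_sqrtLam p).smul _)
    ((S.allMoments_FJr p).smul _)

lemma Psir_ae_eq_effNoise (hΘ : Measurable Θ) :
    S.Psir p Θ =ᵐ[P] effNoise P (mT.comap Θ) (S.receiverChannel p) := by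
  have hC := S.allMoments_A_mul_sqrtLam p
  have hCC : ∀ ω, S.A p ω * p.sqrtLam * (S.A p ω * p.sqrtLam)ᴴ
      = S.A p ω * p.Lam * (S.A p ω)ᴴ := fun ω => by
    rw [conjTranspose_mul, p.conjTranspose_sqrtLam, ← p.sqrtLam_mul_sqrtLam]
    simp only [Matrix.mul_assoc]
  filter_upwards [effNoise_channelMatrix_of_gain (m := mT.comap Θ) p.ρt_nonneg p.ρJ_nonneg
    (.const 1) (hC.smul _) (S.allMoments_FJr p) fun ω => Matrix.one_mul _] with ω h1
  rw [receiverChannel, h1]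
  simp only [hCC, conjTranspose_one, Matrix.mul_one]
  rw [condExpMat_const hΘ.comap_le, Psir]
  simp only [condMat, condExpMat]
  abel

lemma one_add_Upsilonr_ae_eq (hΘ : Measurable Θ) :
    ∀ᵐ ω ∂P, 1 + S.Upsilonr p Θ ω = precision P (mT.comap Θ) (S.receiverChannel p) ω := by
  have hC := S.allMoments_A_mul_sqrtLam p
  filter_upwards [precision_channelMatrix_of_gain (m := mT.comap Θ)
    (J := fun ω => ((Real.sqrt p.ρJ : ℝ) : ℂ) • S.FJr p ω) p.ρt_nonneg hC
    fun ω => Matrix.one_mul _, S.Psir_ae_eq_effNoise p hΘ] with ω h1 h2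
  rw [receiverChannel, h1, Upsilonr, h2]
  simp only [conjTranspose_mul, p.conjTranspose_sqrtLam]
  rfl

open scoped ComplexOrder in
lemma isUnit_det_Psir (hΘ : Measurable Θ)
    (hind : MutuallyIndep P S.x S.xJ S.wr fun ω => (S.state ω, Θ ω)) :
    ∀ᵐ ω ∂P, IsUnit (S.Psir p Θ ω).det := by
  filter_upwards [S.Psir_ae_eq_effNoise p hΘ, effNoise_channelMatrix_one_posDef
    (S.whiteChannel_receiver p hΘ hind) ((S.allMoments_FJr p).smul _)] with ω h1 h2
  rw [h1]
  exact (isUnit_iff_isUnit_det _).1 h2.isUnit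

lemma Psir_ae_eq_PsirUncond (hΘ : Measurable Θ) (hind : IndepFun (S.FJr p) Θ P) :
    S.Psir p Θ =ᵐ[P] S.PsirUncond p Θ := by
  have hF : Measurable (S.FJr p) :=
    (S.entryMeasurable_of_stateAlgebra (S.entryMeasurable_FJr p _)).measurable
  have hFF : EntryMeasurable ((inferInstance : MeasurableSpace (Matrix (Fin Nr) (Fin Nr) ℂ)).comap
      (S.FJr p)) fun ω => S.FJr p ω * (S.FJr p ω)ᴴ := by
    have : EntryMeasurable ((inferInstance : MeasurableSpace (Matrix (Fin Nr) (Fin Nr) ℂ)).comap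
      (S.FJr p)) (S.FJr p) := fun i j => (measurable_entry i j).comp (comap_measurable _)
    exact this.mul this.conjTranspose
  have h : ∀ᵐ ω ∂P, condMat P Θ (fun ω' => S.FJr p ω' * (S.FJr p ω')ᴴ) ω
      = expMat P (fun ω' => S.FJr p ω' * (S.FJr p ω')ᴴ) := by
    filter_upwards [ae_all_iff.2 fun i => ae_all_iff.2 fun j =>
      condExp_indep_eq hF.comap_le hΘ.comap_le (hFF i j).stronglyMeasurable
        ((IndepFun_iff_Indep _ _ _).1 hind)] with ω hω
    ext i j
    exact hω i j
  filter_upwards [h] with ω hω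
  rw [Psir, PsirUncond, hω]

end Receiver

/-! ### The CPU, with the antennas of all nodes stacked into one vector -/

section CPU

/-- The stacked weighted combining matrices. -/
noncomputable def combiner (ω : Ω) : Matrix (Fin Nr) (Fin M × Fin N) ℂ :=
  Matrix.of fun i a => p.α a.1 * star (S.V p a.1 ω a.2 i)

/-- The stacked effective channels to the observing nodes. -/
noncomputable def stackedGain (ω : Ω) : Matrix (Fin M × Fin N) (Fin Nr) ℂ :=
  Matrix.of fun a j => (S.B p a.1 ω * p.sqrtLam) a.2 j

/-- The effective jamming channel to the CPU. -/
noncomputable def FJc (ω : Ω) : Matrix (Fin Nr) (Fin Nr) ℂ :=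
  ∑ m, p.α m • ((S.V p m ω)ᴴ * S.FJm p m ω)

/-- The stacked noise of the monitoring nodes. -/
def stackedNoise (ω : Ω) (a : Fin M × Fin N) : ℂ := S.wm ω a.1 a.2

/-- The channel from signal, jamming and noise to the CPU. -/
noncomputable def cpuChannel : Ω → Matrix (Fin Nr) (Fin Nr ⊕ (Fin Nr ⊕ (Fin M × Fin N))) ℂ :=
  channelMatrix (S.combiner p) (fun ω => ((Real.sqrt p.ρt : ℝ) : ℂ) • S.stackedGain p ω)
    fun ω => ((Real.sqrt p.ρJ : ℝ) : ℂ) • S.FJc p ω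

lemma combiner_mul_smul_stackedGain (ω : Ω) :
    S.combiner p ω * (((Real.sqrt p.ρt : ℝ) : ℂ) • S.stackedGain p ω)
      = ((Real.sqrt p.ρt : ℝ) : ℂ) • S.D p ω := by
  rw [Matrix.mul_smul]
  congr 1
  ext i j
  simp only [D, mul_apply, Fintype.sum_prod_type, Matrix.sum_apply, Matrix.smul_apply, smul_eq_mul,
    combiner, stackedGain, of_apply, Finset.mul_sum, Matrix.mul_assoc, conjTranspose_apply]
  simp only [mul_assoc]

lemma combiner_mul_conjTranspose (ω : Ω) :
    S.combiner p ω * (S.combiner p ω)ᴴ = ∑ m, p.α m • ((S.V p m ω)ᴴ * S.V p m ω) := by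
  ext i j
  simp only [mul_apply, Fintype.sum_prod_type, Matrix.sum_apply, Matrix.smul_apply, smul_eq_mul,
    combiner, of_apply, Finset.mul_sum, conjTranspose_apply, star_mul', star_star, p.star_α]
  refine Finset.sum_congr rfl fun m _ => Finset.sum_congr rfl fun n _ => ?_
  -- The mode variable occurs in both factors; being `0` or `1`, it equals its square.
  rw [mul_mul_mul_comm, p.α_mul_self]

lemma combiner_mulVec (ω : Ω) (w : Fin M → Fin N → ℂ) :
    (S.combiner p ω *ᵥ fun a => w a.1 a.2) = ∑ m, p.α m • ((S.V p m ω)ᴴ *ᵥ w m) := by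
  ext i
  simp only [mulVec, dotProduct, Fintype.sum_prod_type, Finset.sum_apply, Pi.smul_apply,
    smul_eq_mul, combiner, of_apply, Finset.mul_sum, conjTranspose_apply, mul_assoc]

lemma FJc_mul_conjTranspose (ω : Ω) :
    S.FJc p ω * (S.FJc p ω)ᴴ = ∑ m, ∑ l, (p.α m * p.α l) •
      ((S.V p m ω)ᴴ * S.FJm p m ω * (S.FJm p l ω)ᴴ * S.V p l ω) := by
  simp only [FJc, conjTranspose_sum, Finset.sum_mul, Finset.mul_sum, conjTranspose_smul,
    smul_mul_smul_comm, p.star_α, conjTranspose_mul, conjTranspose_conjTranspose, Matrix.mul_assoc]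
  exact Finset.sum_comm

lemma entryMeasurable_combiner : EntryMeasurable (stateAlgebra S.state Θ) (S.combiner p) :=
  fun i a => ((S.entryMeasurable_V p Θ a.1).conjTranspose i a.2).const_mul _

lemma entryMeasurable_stackedGain : EntryMeasurable (stateAlgebra S.state Θ) (S.stackedGain p) :=
  fun a j => ((S.entryMeasurable_B p Θ a.1).mul (.const _)) a.2 j

lemma entryMeasurable_FJc : EntryMeasurable (stateAlgebra S.state Θ) (S.FJc p) :=
  EntryMeasurable.sum _ fun m => ((S.entryMeasurable_V p Θ m).conjTranspose.mul
    (S.entryMeasurable_FJm p Θ m)).smul _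

lemma allMoments_combiner : AllMoments P (S.combiner p) := fun i a =>
  ((S.allMoments_V p a.1).conjTranspose.smul (p.α a.1)) i a.2

lemma allMoments_stackedGain : AllMoments P (S.stackedGain p) := fun a j =>
  ((S.allMoments_B p a.1).mul (.const _)) a.2 j

lemma allMoments_FJc : AllMoments P (S.FJc p) :=
  AllMoments.sum _ fun m => ((S.allMoments_V p m).conjTranspose.mul (S.allMoments_FJm p m)).smul _

lemma measurable_unstack :
    Measurable fun (w : Fin M → Fin N → ℂ) (a : Fin M × Fin N) => w a.1 a.2 := by
  fun_prop

lemma integral_stackedNoise_mul_star (a b : Fin M × Fin N) :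
    ∫ ω, S.stackedNoise ω a * star (S.stackedNoise ω b) ∂P = if a = b then 1 else 0 := by
  obtain ⟨m, n⟩ := a
  obtain ⟨l, q⟩ := b
  by_cases h : m = l
  · subst h
    simpa [stackedNoise] using integral_mul_star_of_expMat (S.wm_cov m) n q
  · rw [if_neg fun h' => h (congrArg Prod.fst h')]
    exact congrFun (congrFun (S.wm_uncorr m l h) n) q

lemma zc_eq (ω : Ω) :
    S.zc p ω = S.cpuChannel p ω *ᵥ sourceVec S.x S.xJ S.stackedNoise ω := by
  have hJ : ∀ m, ∑ m', (S.Gmm p m m' ω)ᴴ *ᵥ S.sJ p m' ω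
      = ((Real.sqrt p.ρJ : ℝ) : ℂ) • (S.FJm p m ω *ᵥ S.xJ ω) := fun m => by
    rw [FJm, sum_mulVec, Finset.smul_sum]
    refine Finset.sum_congr rfl fun m' _ => ?_
    rw [sJ, mulVec_smul, mulVec_mulVec, smul_mulVec, smul_smul, mul_comm, Matrix.mul_assoc]
  have hS : ∀ m, (S.Gtm p m ω)ᴴ *ᵥ S.st p ω
      = ((Real.sqrt p.ρt : ℝ) : ℂ) • ((S.B p m ω * p.sqrtLam) *ᵥ S.x ω) := fun m => by
    rw [st, mulVec_smul, mulVec_mulVec, B, Matrix.mul_assoc]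
  rw [cpuChannel, channelMatrix_mulVec_sourceVec, combiner_mul_smul_stackedGain]
  have hw : S.combiner p ω *ᵥ S.stackedNoise ω = _ := S.combiner_mulVec p ω (S.wm ω)
  rw [hw, zc, D, FJc, smul_mulVec, smul_mulVec, sum_mulVec, sum_mulVec, Finset.smul_sum,
    Finset.smul_sum, ← Finset.sum_add_distrib, ← Finset.sum_add_distrib]
  refine Finset.sum_congr rfl fun m _ => ?_
  -- The signal term carries the mode variable twice, from the reception at the node and from the
  -- aggregation; idempotence leaves one factor, as in `D`.
  rw [ym, hJ, hS, mulVec_add, mulVec_add, smul_add, smul_add, add_assoc, mulVec_smul, smul_smul,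
    p.α_mul_self]
  simp only [smul_mulVec, mulVec_smul, mulVec_mulVec, Matrix.mul_assoc, smul_comm (p.α m)]

lemma whiteChannel_cpu (hΘ : Measurable Θ)
    (hind : MutuallyIndep P S.x S.xJ S.wm fun ω => (S.state ω, Θ ω)) :
    WhiteChannel P (mT.comap Θ) (stateAlgebra S.state Θ)
      (MeasurableSpace.comap (fun ω => (S.x ω, S.xJ ω, S.stackedNoise ω)) inferInstance)
      (sourceVec S.x S.xJ S.stackedNoise) (S.cpuChannel p) :=
  whiteChannel_channelMatrix S.x_meas S.xJ_meas (measurable_unstack.comp S.wm_meas)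
    S.measurable_state hΘ (hind.comp_noise measurable_unstack) S.x_law
    (integral_mul_star_of_expMat S.xJ_cov) (fun a => S.wm_mean a.1 a.2)
    S.integral_stackedNoise_mul_star
    (S.entryMeasurable_combiner p) ((S.entryMeasurable_stackedGain p).smul _)
    ((S.entryMeasurable_FJc p).smul _) (S.allMoments_combiner p)
    ((S.allMoments_stackedGain p).smul _) ((S.allMoments_FJc p).smul _)

lemma Psic_ae_eq_effNoise :
    S.Psic p Θ =ᵐ[P] effNoise P (mT.comap Θ) (S.cpuChannel p) := by
  filter_upwards [effNoise_channelMatrix_of_gain (m := mT.comap Θ) p.ρt_nonneg p.ρJ_nonneg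
    (S.allMoments_combiner p) ((S.allMoments_stackedGain p).smul _)
    (S.allMoments_FJc p) (S.combiner_mul_smul_stackedGain p),
    condExpMat_conjTranspose (m := mT.comap Θ) (S.allMoments_D p).integrable] with ω h1 h2
  -- `Psic` contains the conditional expectation of `Dᴴ`, which agrees with the conjugate transpose
  -- of that of `D` only almost surely.
  rw [cpuChannel, h1, ← h2]
  simp only [FJc_mul_conjTranspose, combiner_mul_conjTranspose]
  rw [Psic]
  simp only [condMat, condExpMat]
  abel

lemma one_add_Upsilonc_ae_eq :
    ∀ᵐ ω ∂P, 1 + S.Upsilonc p Θ ω = precision P (mT.comap Θ) (S.cpuChannel p) ω := by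
  filter_upwards [precision_channelMatrix_of_gain (m := mT.comap Θ)
    (J := fun ω => ((Real.sqrt p.ρJ : ℝ) : ℂ) • S.FJc p ω) p.ρt_nonneg (S.allMoments_D p)
    (S.combiner_mul_smul_stackedGain p), S.Psic_ae_eq_effNoise p (Θ := Θ)] with ω h1 h2
  rw [cpuChannel, h1, Upsilonc, h2]
  rfl

end CPU

end Model

end Surveillance

theorem proposition2 {Ω : Type*} [MeasurableSpace Ω] (P : Measure Ω) [IsProbabilityMeasure P]
    {M N Nt Nr τt τr : ℕ} (p : Surveillance.Params M N Nt Nr τt τr)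
    (S : Surveillance.Model P M N Nt Nr τt τr)
    {Tr Tc : Type*} [MeasurableSpace Tr] [MeasurableSpace Tc]
    (Θr : Ω → Tr) (Θc : Ω → Tc) (hΘr : Measurable Θr) (hΘc : Measurable Θc)
    (hr : Surveillance.MutuallyIndep P S.x S.xJ S.wr (fun ω => (S.state ω, Θr ω)))
    (hc : Surveillance.MutuallyIndep P S.x S.xJ S.wm (fun ω => (S.state ω, Θc ω))) :
    -- the untrusted receiver
    ((∀ᵐ ω ∂P, IsUnit (S.Psir p Θr ω).det) ∧
      (IndepFun (S.FJr p) Θr P → S.Psir p Θr =ᵐ[P] S.PsirUncond p Θr) ∧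
      Integrable (fun ω => Surveillance.log2det (1 + S.Upsilonr p Θr ω)) P ∧
      Surveillance.mmseSE P p.prelog Θr S.x (S.yr p) = S.SEr p Θr ∧
      Surveillance.IsAchievableSE p.prelog (Surveillance.mutualInfo P S.x
        (fun ω => (Surveillance.mmseEstimate P Θr S.x (S.yr p) ω, Θr ω))) (S.SEr p Θr) ∧
      Surveillance.IsAchievableSE p.prelog (Surveillance.mutualInfo P S.x
        (fun ω => (S.yr p ω, Θr ω))) (S.SEr p Θr)) ∧
    -- the CPU
    (Integrable (fun ω => Surveillance.log2det (1 + S.Upsilonc p Θc ω)) P ∧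
      ((∀ᵐ ω ∂P, IsUnit (S.Psic p Θc ω).det) →
        Surveillance.mmseSE P p.prelog Θc S.x (S.zc p) = S.SEc p Θc) ∧
      Surveillance.IsAchievableSE p.prelog (Surveillance.mutualInfo P S.x
        (fun ω => (Surveillance.mmseEstimate P Θc S.x (S.zc p) ω, Θc ω))) (S.SEc p Θc) ∧
      Surveillance.IsAchievableSE p.prelog (Surveillance.mutualInfo P S.x
        (fun ω => (S.zc p ω, Θc ω))) (S.SEc p Θc)) := by

  have hR := S.whiteChannel_receiver p hΘr hr
  have hC := S.whiteChannel_cpu p hΘc hc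
  -- At the receiver the common factor is `L = 1`, and `B` is the whole effective gain; at the CPU
  -- `L` is the stacked combiner.
  have hlogR := Surveillance.integrable_log_det_precision_channelMatrix hR
    (.const 1) ((S.allMoments_A_mul_sqrtLam p).smul _)
  have hlogC := Surveillance.integrable_log_det_precision_channelMatrix hC
    (S.allMoments_combiner p) ((S.allMoments_stackedGain p).smul _)
  obtain ⟨hr1, hr2, hr3, hr4⟩ := hR.rates hΘr (fun _ _ => rfl) (S.yr_eq p) S.x_meas S.x_law hlogR
    p.prelog_nonneg (S.one_add_Upsilonr_ae_eq p hΘr)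
  obtain ⟨hc1, hc2, hc3, hc4⟩ := hC.rates hΘc (fun _ _ => rfl) (S.zc_eq p) S.x_meas S.x_law hlogC
    p.prelog_nonneg (S.one_add_Upsilonc_ae_eq p)
  have hunit := S.isUnit_det_Psir p hΘr hr
  refine ⟨⟨hunit, S.Psir_ae_eq_PsirUncond p hΘr, hr1, hr2 ?_, hr3, hr4⟩, hc1,
    fun h => hc2 ?_, hc3, hc4⟩
  · filter_upwards [hunit, S.Psir_ae_eq_effNoise p hΘr] with ω h1 h2
    exact h2 ▸ h1.ne_zero
  · filter_upwards [h, S.Psic_ae_eq_effNoise p (Θ := Θc)] with ω h1 h2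
    exact h2 ▸ h1.ne_zero
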